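/- Let $1\le q$, $n\ge q+3$, $d\ge 2$. A germ at $0\in\mathbb C^n$ of holomorphic $q$-form $\eta$ is called integrable if near every point $p$ close to $0$ with $\eta(p)\ne0$ it can be written $\eta=\omega_1\wedge\dots\wedge\omega_q$ with holomorphic $1$-forms $\omega_i$ such that $d\omega_i\wedge\eta=0$ for all $i$. For a germ $\zeta$ at $0\in\mathbb C^{q+2}$ of integrable $q$-form, its rotational is the vector field $X$ with $d\zeta=i_X\nu$, $\nu=dx_1\wedge\dots\wedge dx_{q+2}$. We say that $0$ is an NGK (nilpotent generalized Kupka) singularity of $\zeta$ if $\zeta(0)=0$, $0$ is an isolated singularity of $d\zeta$ (equivalently, an isolated zero of $X$) and $DX(0)$ is nilpotent; it is of type $(p_1,\dots,p_{q+2}:\ell)$, where the $p_i$ are relatively prime positive integers and $\ell$ is a positive integer, if $\zeta=i_Yi_X\nu$ for some germ $Y$ of holomorphic vector field with $Y(0)=0$ such that the eigenvalues of $DY(0)$, with multiplicities, are $p_1/N,\dots,p_{q+2}/N$, where $N=\ell+p_1+\dots+p_{q+2}$. It is conic of degree $d$ if it is of type $(1,\dots,1:d-1)$. A germ $\eta$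 of integrable $q$-form at $0\in\mathbb C^n$ has a conic NGK singularity of degree $d$ at $0$ if, for some holomorphic coordinate system $(x,y)\in\mathbb C^{q+2}\times\mathbb C^{n-q-2}$ centred at $0$, the restriction $\eta|_{\{y=0\}}$ has a conic NGK singularity of degree $d$ at $0\in\mathbb C^{q+2}$. **Lemma.** Let $\eta$ be a germ at $0\in\mathbb C^n$ of integrable $q$-form having a conic NGK singularity of degree $d$ at $0$. Then there exists a germ of biholomorphism $\phi=(x,y)\colon(\mathbb C^n,0)\to(\mathbb C^{q+2}\times\mathbb C^{n-q-2},(0,0))$ such that $\phi_*(\eta)$ depends only on $x=(x_1,\dots,x_{q+2})$, has homogeneous polynomial coefficients of degree $d+1$, $$\phi_*(\eta)=\sum_{\sigma}A_\sigma(x)\,dx_{\sigma(1)}\wedge\dots\wedge dx_{\sigma(q)}$$ (sum over $1\le\sigma(1)<\dots<\sigma(q)\le q+2$), and is dicritical, i.e. $i_R\,\phi_*(\eta)=0$ for the radial vector field $R=\sum_j x_j\,\partial/\partial x_j$. In other words, the form $\sum_\sigma A_\sigma\,dx_{\sigma(1)}\wedge\dots\wedge dx_{\sigma(q)}$ is integrable,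 vanishes at $0$, is not identically zero and defines a singular foliation of dimension two on $(\mathbb C^{q+2},0)$, and $\phi$ maps the foliation defined by $\eta$ to the product of this foliation with the regular foliation of dimension $n-q-2$ whose leaves are the levels $x=c$. -/

import Mathlib

open Filter Topology

noncomputable section

namespace NGK

/-- The form `dx_1 ∧ ... ∧ dx_m` on `ℂ^m`: its value at `(v_1, ..., v_m)` is the determinant of the
matrix whose rows are the `v_i`. -/
def volForm (m : ℕ) : (Fin m → ℂ) [⋀^Fin m]→L[ℂ] ℂ :=
  { (Matrix.detRowAlternating : (Fin m → ℂ) [⋀^Fin m]→ₗ[ℂ] ℂ) with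
    cont := Continuous.matrix_det (A := fun M : Matrix (Fin m) (Fin m) ℂ => M) continuous_id }

section Forms

variable {E F : Type*} [NormedAddCommGroup E] [NormedSpace ℂ E]
  [NormedAddCommGroup F] [NormedSpace ℂ F]

/-- The pull-back `f^* ω` of a differential form. -/
def pullback {q : ℕ} (f : E → F) (ω : F → F [⋀^Fin q]→L[ℂ] ℂ) (x : E) : E [⋀^Fin q]→L[ℂ] ℂ :=
  (ω (f x)).compContinuousLinearMap (fderiv ℂ f x)

/-- The exterior product of two alternating forms. -/
def wedge {k l : ℕ} (α : E [⋀^Fin k]→L[ℂ] ℂ) (β : E [⋀^Fin l]→L[ℂ] ℂ) :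
    E [⋀^Fin k ⊕ Fin l]→ₗ[ℂ] ℂ :=
  (LinearMap.mul' ℂ ℂ).compAlternatingMap (α.toAlternatingMap.domCoprod β.toAlternatingMap)

/-- The exterior product `ω_1 ∧ ... ∧ ω_q` of linear forms: its value at `(v_1, ..., v_q)` is
`det (ω_j (v_i))`. -/
def wedgeLin {q : ℕ} (ω : Fin q → (E →L[ℂ] ℂ)) : E [⋀^Fin q]→L[ℂ] ℂ :=
  (volForm q).compContinuousLinearMap (ContinuousLinearMap.pi ω)

/-- A field of linear forms, regarded as a differential form of degree one. -/
def oneForm (ω : E → (E →L[ℂ] ℂ)) (x : E) : E [⋀^Fin 1]→L[ℂ] ℂ :=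
  ContinuousAlternatingMap.ofSubsingleton ℂ E ℂ (0 : Fin 1) (ω x)

/-- The germ at `0` of the holomorphic `q`-form `η` is integrable: near every point `p` (close to
`0`) with `η p ≠ 0`, it is an exterior product `ω_1 ∧ ... ∧ ω_q` of holomorphic `1`-forms which
satisfy the Frobenius condition `dω_i ∧ η = 0` for all `i`. -/
def IsIntegrable {q : ℕ} (η : E → E [⋀^Fin q]→L[ℂ] ℂ) : Prop :=
  AnalyticAt ℂ η 0 ∧
  ∀ᶠ p in 𝓝 (0 : E), η p ≠ 0 →
    ∃ ω : Fin q → E → (E →L[ℂ] ℂ),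
      (∀ i, AnalyticAt ℂ (ω i) p) ∧
      ∀ᶠ x in 𝓝 p,
        η x = wedgeLin (fun i => ω i x) ∧
        ∀ i, wedge (extDeriv (oneForm (ω i)) x) (η x) = 0

/-- The kernel `{v | i_v α = 0}` of an alternating form (of positive degree). For an integrable
form `η` and `η p ≠ 0`, the kernel of `η p` is the tangent space at `p` of the foliation defined
by `η`. -/
def formKernel {q : ℕ} (α : E [⋀^Fin q]→L[ℂ] ℂ) : Submodule ℂ E where
  carrier := {v | ∀ (w : Fin q → E) (i : Fin q), α (Function.update w i v) = 0}
  add_mem' := by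
    intro a b ha hb w i
    rw [α.map_update_add, ha w i, hb w i, add_zero]
  zero_mem' := by
    intro w i
    exact α.map_coord_zero i (by simp)
  smul_mem' := by
    intro c a ha w i
    rw [α.map_update_smul, ha w i, smul_zero]

/-- `φ` represents a germ of biholomorphism `(E, 0) → (F, 0)`. -/
def IsGermBiholomorphism (φ : OpenPartialHomeomorph E F) : Prop :=
  (0 : E) ∈ φ.source ∧ φ 0 = 0 ∧ AnalyticOnNhd ℂ φ φ.source ∧ AnalyticOnNhd ℂ φ.symm φ.target

end Forms

/-- The germ `X` of holomorphic vector field at `0 ∈ ℂ^(q+2)` is the rotational of the `q`-form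
`η`: `dη = i_X ν`, where `ν = dx_1 ∧ ... ∧ dx_(q+2)`. -/
def IsRotational {q : ℕ} (η : (Fin (q + 2) → ℂ) → (Fin (q + 2) → ℂ) [⋀^Fin q]→L[ℂ] ℂ)
    (X : (Fin (q + 2) → ℂ) → (Fin (q + 2) → ℂ)) : Prop :=
  AnalyticAt ℂ X 0 ∧ ∀ᶠ x in 𝓝 0, extDeriv η x = (volForm (q + 2)).curryLeft (X x)

/-- `0 ∈ ℂ^(q+2)` is a nilpotent generalized Kupka singularity of the germ of `q`-form `η` with
rotational `X`: `η 0 = 0`, the origin is an isolated singularity of `dη` and `DX(0)` is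
nilpotent. -/
structure IsNGK {q : ℕ} (η : (Fin (q + 2) → ℂ) → (Fin (q + 2) → ℂ) [⋀^Fin q]→L[ℂ] ℂ)
    (X : (Fin (q + 2) → ℂ) → (Fin (q + 2) → ℂ)) : Prop where
  integrable : IsIntegrable η
  rotational : IsRotational η X
  apply_zero : η 0 = 0
  extDeriv_zero : extDeriv η 0 = 0
  isolated : ∀ᶠ x in 𝓝[≠] 0, extDeriv η x ≠ 0
  nilpotent : IsNilpotent (fderiv ℂ X 0)

/-- `0 ∈ ℂ^(q+2)` is an NGK singularity of `η` of type `(p_1, ..., p_(q+2) : l)`: if `X` is the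
rotational of `η`, then `η = i_Y i_X ν` for a germ `Y` of holomorphic vector field whose linear
part at the singular point `0` has the eigenvalues `p_i / N` (with multiplicities), where the
positive integers `p_i` are relatively prime and `N`, `l` are related by
`l = N - (p_1 + ... + p_(q+2))`, i.e. `l = N (1 - tr DY(0))`. -/
def IsNGKOfType {q : ℕ} (η : (Fin (q + 2) → ℂ) → (Fin (q + 2) → ℂ) [⋀^Fin q]→L[ℂ] ℂ)
    (p : Fin (q + 2) → ℕ) (l : ℕ) : Prop :=
  (∀ i, 0 < p i) ∧ Finset.univ.gcd p = 1 ∧ 0 < l ∧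
  ∃ X Y : (Fin (q + 2) → ℂ) → (Fin (q + 2) → ℂ),
    IsNGK η X ∧ AnalyticAt ℂ Y 0 ∧ Y 0 = 0 ∧
    (∀ᶠ x in 𝓝 0, η x = ((volForm (q + 2)).curryLeft (X x)).curryLeft (Y x)) ∧
    (fderiv ℂ Y 0 : (Fin (q + 2) → ℂ) →ₗ[ℂ] (Fin (q + 2) → ℂ)).charpoly =
      ∏ i, (Polynomial.X - Polynomial.C ((p i : ℂ) / ((l + ∑ j, p j : ℕ) : ℂ)))

/-- A germ at `0 ∈ ℂ^n` of `q`-form has a conic NGK singularity of degree `d` (`d ≥ 2`): for some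
system `(x, y) ∈ ℂ^(q+2) × ℂ^(n-q-2)` of holomorphic coordinates centred at `0`, the restriction of
the form to the plane `y = 0` has an NGK singularity of type `(1, ..., 1 : d - 1)` at the origin. -/
def HasConicNGK {n q : ℕ} (η : (Fin n → ℂ) → (Fin n → ℂ) [⋀^Fin q]→L[ℂ] ℂ) (d : ℕ) : Prop :=
  ∃ φ : OpenPartialHomeomorph (Fin n → ℂ) ((Fin (q + 2) → ℂ) × (Fin (n - q - 2) → ℂ)),
    IsGermBiholomorphism φ ∧
    IsNGKOfType (pullback (fun x : Fin (q + 2) → ℂ => φ.symm (x, 0)) η) (fun _ => 1) (d - 1)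

/-- The `q`-form `∑_σ A_σ(x) dx_σ(1) ∧ ... ∧ dx_σ(q)` on `ℂ^m` with polynomial coefficients, the
sum being over the strictly increasing maps `σ : {1, ..., q} → {1, ..., m}`. -/
def polyForm {q m : ℕ} (A : (Fin q ↪o Fin m) → MvPolynomial (Fin m) ℂ) (x : Fin m → ℂ) :
    (Fin m → ℂ) [⋀^Fin q]→L[ℂ] ℂ :=
  ∑ σ : Fin q ↪o Fin m, MvPolynomial.eval x (A σ) •
    wedgeLin (fun i => ContinuousLinearMap.proj (R := ℂ) (φ := fun _ : Fin m => ℂ) (σ i))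

end NGK

end

noncomputable section

set_option linter.unusedSectionVars false

namespace NGK

/-! Let ζ be the restriction of η to y = 0, with rotational X and ζ = i_Y i_X ν = i_Y dζ. Put N = d
- 1 + (q + 2) and a = 1/N. The linear part of Y at 0 has the single eigenvalue a, so there are no
resonances of degree at least two and Y is conjugate to az + Bz with B nilpotent
(`exists_linearization`). The relation ζ = i_Y dζ does not depend on coordinates, and Cartan's
formula turns it into DX(z)(az + Bz) = d a X + B X (`lie_identity`). Hence X is equivariant under
the flow of az + Bz. Since e^{tB} grows only polynomially, every homogeneous part of X of degree
other than d vanishes, and the isolated zero then forces B = 0 (`homogeneous_of_euler`). So ζ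
becomes a i_R i_X ν with X homogeneous of degree d (`exists_homogeneous_model`), which makes it
homogeneous of degree d + 1 and dicritical.

The transverse variables are removed by a deformation (`exists_unfolding`). Let η' be the pull-back
of η by (x, y, t) ↦ (x, ty). On the slice t = 0 only ζ remains; on a slice t ≠ 0 it is η up to a
linear change of coordinates. The flow of a field ∂_t + v ∂_x lying in the kernels of η' and dη'
identifies these slices. Integrability gives, at generic points, that ker dη' has codimension at
most q + 1 and lies in ker η' (`formKernel_extDeriv_of_integrable`); therefore it suffices that the
contraction of dη' with the field vanishes on the x-directions (`rotational_mem_formKernel`). This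
is the division of a form annihilated by X, or equivalently of a bivector B with X ∧ B = 0 as B = X
∧ v. It is possible because X deforms a homogeneous field with isolated zero in dimension q + 2 ≥ 3,
where the Koszul complex is exact on bivectors (`exists_koszul_division`).

The analysis takes place in the Banach algebra of power series converging absolutely on the closed
unit polydisc. There, composition with a holomorphic germ is an analytic map (`exists_extension`),
division by a coordinate is a bounded shift, and the unbounded derivations occur only composed with
operators that make them bounded. Flows and linearization follow from the inverse function theorem
with a homothety as parameter, division from a geometrically convergent iteration. -/

/-! ### The Wiener algebra of absolutely convergent power series on the closed unit polydisc -/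

/-- The space of families of coefficients of power series in the variables `x_i`, `i : ι`, which
converge absolutely on the closed unit polydisc. -/
def Wiener (ι : Type*) : Type _ := lp (fun _ : ι → ℕ => ℂ) 1

namespace Wiener

variable {ι : Type*} {F : Type*} [NormedAddCommGroup F] [NormedSpace ℂ F]

instance : NormedAddCommGroup (Wiener ι) :=
  inferInstanceAs (NormedAddCommGroup (lp (fun _ : ι → ℕ => ℂ) 1))

instance : NormedSpace ℂ (Wiener ι) :=
  inferInstanceAs (NormedSpace ℂ (lp (fun _ : ι → ℕ => ℂ) 1))

instance : CompleteSpace (Wiener ι) :=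
  inferInstanceAs (CompleteSpace (lp (fun _ : ι → ℕ => ℂ) 1))

open Classical in
/-- The monomial with exponent `α`. -/
def mono (α : ι → ℕ) : Wiener ι :=
  lp.single (E := fun _ : ι → ℕ => ℂ) 1 α 1

/-- The coefficients of a power series. -/
def coeff (f : Wiener ι) (α : ι → ℕ) : ℂ :=
  (show lp (fun _ : ι → ℕ => ℂ) 1 from f) α

lemma norm_mono (α : ι → ℕ) : ‖(mono α : Wiener ι)‖ = 1 := by
  classical
  have h := lp.norm_single (E := fun _ : ι → ℕ => ℂ) (p := 1) one_pos α (1 : ℂ)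
  rw [norm_one] at h
  exact h

lemma hasSum_norm_coeff (f : Wiener ι) : HasSum (fun α => ‖coeff f α‖) ‖f‖ := by
  have h := lp.hasSum_norm (E := fun _ : ι → ℕ => ℂ) (p := 1) (by simp) f
  simp only [ENNReal.toReal_one, Real.rpow_one] at h
  exact h

lemma hasSum_mono (f : Wiener ι) : HasSum (fun α => coeff f α • mono α) f := by
  classical
  have h := lp.hasSum_single (E := fun _ : ι → ℕ => ℂ) (p := 1) (by simp) f
  have e : (fun α => coeff f α • mono α) =
      fun α => lp.single (E := fun _ : ι → ℕ => ℂ) 1 α (coeff f α) := by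
    funext α
    have h2 := lp.single_smul (E := fun _ : ι → ℕ => ℂ) (𝕜 := ℂ) 1 α (coeff f α) (1 : ℂ)
    rw [smul_eq_mul, mul_one] at h2
    exact h2.symm
  rw [e]
  exact h

lemma coeff_add (f g : Wiener ι) (α : ι → ℕ) : coeff (f + g) α = coeff f α + coeff g α := rfl

lemma coeff_smul (c : ℂ) (f : Wiener ι) (α : ι → ℕ) : coeff (c • f) α = c * coeff f α := rfl

theorem ext_mono {f g : Wiener ι →L[ℂ] F} (h : ∀ α, f (mono α) = g (mono α)) : f = g := by
  ext a
  have h1 := (hasSum_mono a).mapL f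
  have h2 := (hasSum_mono a).mapL g
  simp only [map_smul, h] at h1 h2
  exact h1.unique h2

/-- For an ℓ¹ norm, the operator norm is controlled by the images of the basis vectors. Every norm
estimate for an operator on `Wiener ι` below is read off from monomials in this way. -/
lemma norm_apply_le_of_mono {T : Wiener ι →L[ℂ] F} {C : ℝ} (hv : ∀ α, ‖T (mono α)‖ ≤ C)
    (f : Wiener ι) : ‖T f‖ ≤ C * ‖f‖ := by
  have h := (hasSum_mono f).mapL T
  rw [← h.tsum_eq]
  refine tsum_of_norm_bounded ((hasSum_norm_coeff f).mul_left C) fun α => ?_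
  rw [map_smul, norm_smul, mul_comm]
  exact mul_le_mul_of_nonneg_right (hv α) (norm_nonneg _)

lemma norm_le_of_mono {T : Wiener ι →L[ℂ] F} {C : ℝ} (hv : ∀ α, ‖T (mono α)‖ ≤ C) : ‖T‖ ≤ C :=
  T.opNorm_le_bound ((norm_nonneg _).trans (hv 0)) (norm_apply_le_of_mono hv)

variable [CompleteSpace F]

lemma summable_coeff_smul {v : (ι → ℕ) → F} {C : ℝ} (hv : ∀ α, ‖v α‖ ≤ C) (f : Wiener ι) :
    Summable fun α => coeff f α • v α := by
  refine Summable.of_norm_bounded ((hasSum_norm_coeff f).summable.mul_right C) fun α => ?_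
  rw [norm_smul]
  exact mul_le_mul_of_nonneg_left (hv α) (norm_nonneg _)

open Classical in
/-- The continuous linear map with prescribed (bounded) values at the monomials. -/
def lift (v : (ι → ℕ) → F) : Wiener ι →L[ℂ] F :=
  if hv : ∃ C, ∀ α, ‖v α‖ ≤ C then
    LinearMap.mkContinuous
      { toFun := fun f => ∑' α, coeff f α • v α
        map_add' := fun f g => by
          obtain ⟨C, hC⟩ := hv
          rw [← (summable_coeff_smul hC f).tsum_add (summable_coeff_smul hC g)]
          simp only [coeff_add, add_smul]
        map_smul' := fun c f => by
          obtain ⟨C, hC⟩ := hv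
          rw [RingHom.id_apply, ← (summable_coeff_smul hC f).tsum_const_smul]
          simp only [coeff_smul, mul_smul] }
      hv.choose (fun f => by
        refine tsum_of_norm_bounded ((hasSum_norm_coeff f).mul_left hv.choose) fun α => ?_
        rw [norm_smul, mul_comm]
        exact mul_le_mul_of_nonneg_right (hv.choose_spec α) (norm_nonneg _))
  -- Default value for unbounded families; each use comes with a bound, and `lift_mono` requires
  -- one.
  else 0

lemma coeff_mono (α β : ι → ℕ) [Decidable (β = α)] :
    coeff (mono α : Wiener ι) β = if β = α then 1 else 0 := by
  classical
  have := lp.single_apply (E := fun _ : ι → ℕ => ℂ) 1 α 1 β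
  rw [Pi.single_apply] at this
  refine Eq.trans ?_ (this.trans ?_)
  · unfold coeff mono
    congr
  · congr

lemma lift_mono {v : (ι → ℕ) → F} {C : ℝ} (hv : ∀ α, ‖v α‖ ≤ C) (α : ι → ℕ) :
    lift v (mono α) = v α := by
  classical
  have h : ∃ C, ∀ α, ‖v α‖ ≤ C := ⟨C, hv⟩
  rw [lift, dif_pos h]
  change ∑' β, coeff (mono α) β • v β = v α
  rw [tsum_eq_single α fun β hβ => by rw [coeff_mono, if_neg hβ, zero_smul], coeff_mono,
    if_pos rfl, one_smul]

lemma norm_lift_le {v : (ι → ℕ) → F} {C : ℝ} (hv : ∀ α, ‖v α‖ ≤ C) : ‖lift v‖ ≤ C :=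
  norm_le_of_mono fun α => by rw [lift_mono hv]; exact hv α

/-! ### The ring structure -/

/-- Multiplication of power series, as a continuous bilinear map. -/
def mulL : Wiener ι →L[ℂ] Wiener ι →L[ℂ] Wiener ι :=
  lift fun α => lift fun β => mono (α + β)

lemma mulL_mono (α β : ι → ℕ) : mulL (mono α) (mono β : Wiener ι) = mono (α + β) := by
  have h : ∀ α β : ι → ℕ, ‖(mono (α + β) : Wiener ι)‖ ≤ 1 := fun α β => (norm_mono _).le
  rw [mulL, lift_mono (C := 1) fun α => norm_lift_le (h α), lift_mono (h α)]

lemma norm_mulL_le (f g : Wiener ι) : ‖mulL f g‖ ≤ ‖f‖ * ‖g‖ := by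
  have h1 : ∀ α : ι → ℕ, ‖mulL (mono α : Wiener ι)‖ ≤ 1 := fun α =>
    norm_le_of_mono fun β => by rw [mulL_mono, norm_mono]
  have h2 := norm_apply_le_of_mono h1 f
  rw [one_mul] at h2
  exact ((mulL f).le_opNorm g).trans (mul_le_mul_of_nonneg_right h2 (norm_nonneg _))

/-- Identities between operators are proved throughout by currying both sides into continuous linear
maps and testing them on monomials, where they become identities between exponents. -/
lemma mulL_comm (f g : Wiener ι) : mulL f g = mulL g f := by
  have h : (mulL : Wiener ι →L[ℂ] _) = (mulL : Wiener ι →L[ℂ] _).flip :=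
    ext_mono fun α => ext_mono fun β => by
      rw [ContinuousLinearMap.flip_apply, mulL_mono, mulL_mono, add_comm]
  exact DFunLike.congr_fun (DFunLike.congr_fun h f) g

lemma mulL_assoc (f g h : Wiener ι) : mulL (mulL f g) h = mulL f (mulL g h) := by
  have key : ((ContinuousLinearMap.compL ℂ (Wiener ι) (Wiener ι) _) mulL).comp mulL =
      ((ContinuousLinearMap.compL ℂ (Wiener ι) (Wiener ι →L[ℂ] Wiener ι)
        (Wiener ι →L[ℂ] Wiener ι)).flip (mulL (ι := ι))).comp
          ((ContinuousLinearMap.compL ℂ (Wiener ι) (Wiener ι) (Wiener ι)).comp mulL) := by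
    refine ext_mono fun α => ext_mono fun β => ext_mono fun γ => ?_
    simp [mulL_mono, add_assoc]
  have := DFunLike.congr_fun (DFunLike.congr_fun (DFunLike.congr_fun key f) g) h
  simpa using this

lemma mulL_one (f : Wiener ι) : mulL (mono 0) f = f := by
  have key : mulL (mono 0 : Wiener ι) = ContinuousLinearMap.id ℂ _ :=
    ext_mono fun α => by rw [mulL_mono, zero_add]; rfl
  rw [key]; rfl

instance : NormedCommRing (Wiener ι) :=
  { (inferInstance : NormedAddCommGroup (Wiener ι)) with
    mul := fun f g => mulL f g
    one := mono 0
    left_distrib := fun f g h => map_add (mulL f) g h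
    right_distrib := fun f g h => by
      change mulL (f + g) h = mulL f h + mulL g h
      rw [map_add]; rfl
    zero_mul := fun f => by
      change mulL 0 f = 0
      rw [map_zero]; rfl
    mul_zero := fun f => map_zero (mulL f)
    mul_assoc := mulL_assoc
    one_mul := mulL_one
    mul_one := fun f => (mulL_comm _ _).trans (mulL_one f)
    mul_comm := mulL_comm
    norm_mul_le := norm_mulL_le }

lemma mul_def (f g : Wiener ι) : f * g = mulL f g := rfl

lemma one_def : (1 : Wiener ι) = mono 0 := rfl

lemma mono_mul_mono (α β : ι → ℕ) : (mono α * mono β : Wiener ι) = mono (α + β) := mulL_mono α β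

instance : NormedAlgebra ℂ (Wiener ι) :=
  { Algebra.ofModule
      (fun c f g => by
        change mulL (c • f) g = c • mulL f g
        rw [map_smul]; rfl)
      (fun c f g => map_smul (mulL f) c g) with
    norm_smul_le := fun c f => (norm_smul c f).le }

instance : NormOneClass (Wiener ι) := ⟨norm_mono 0⟩



variable [DecidableEq ι]

/-- The coordinate function `x_i`. -/
def X (i : ι) : Wiener ι := mono (Pi.single i 1)

lemma X_mul_mono (i : ι) (α : ι → ℕ) : X i * mono α = mono (Pi.single i 1 + α) :=
  mono_mul_mono _ _

lemma norm_X (i : ι) : ‖(X i : Wiener ι)‖ = 1 := norm_mono _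

/-- The diagonal operator with (bounded) eigenvalues `c α`. -/
def diag (c : (ι → ℕ) → ℂ) : Wiener ι →L[ℂ] Wiener ι := lift fun α => c α • mono α

omit [DecidableEq ι] in
lemma diag_mono {c : (ι → ℕ) → ℂ} {C : ℝ} (hc : ∀ α, ‖c α‖ ≤ C) (α : ι → ℕ) :
    diag c (mono α) = c α • mono α :=
  lift_mono (C := C) (fun α => by rw [norm_smul, norm_mono, mul_one]; exact hc α) α

omit [DecidableEq ι] in
lemma norm_diag_le {c : (ι → ℕ) → ℂ} {C : ℝ} (hc : ∀ α, ‖c α‖ ≤ C) : ‖diag c‖ ≤ C :=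
  norm_lift_le fun α => by rw [norm_smul, norm_mono, mul_one]; exact hc α

/-- The backward shift `f ↦ (f - f|_{x_i = 0}) / x_i`. -/
def bshift (i : ι) : Wiener ι →L[ℂ] Wiener ι :=
  lift fun α => if α i = 0 then 0 else mono (α - Pi.single i 1)

lemma norm_bshift_aux (i : ι) (α : ι → ℕ) :
    ‖if α i = 0 then 0 else (mono (α - Pi.single i 1) : Wiener ι)‖ ≤ 1 := by
  split_ifs
  · rw [norm_zero]; exact zero_le_one
  · rw [norm_mono]

lemma bshift_mono (i : ι) (α : ι → ℕ) :
    bshift i (mono α) = if α i = 0 then 0 else mono (α - Pi.single i 1) :=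
  lift_mono (norm_bshift_aux i) α

lemma bshift_mono_of_eq_zero {i : ι} {α : ι → ℕ} (h : α i = 0) : bshift i (mono α) = 0 := by
  rw [bshift_mono, if_pos h]

lemma bshift_mono_add (i : ι) (α : ι → ℕ) :
    bshift i (mono (Pi.single i 1 + α)) = mono α := by
  rw [bshift_mono, if_neg (by simp), add_tsub_cancel_left]

lemma norm_bshift_le (i : ι) : ‖bshift i‖ ≤ 1 := norm_lift_le (norm_bshift_aux i)

lemma bshift_X_mul (i : ι) (f : Wiener ι) : bshift i (X i * f) = f := by
  have key : (bshift i).comp (mulL (X i)) = ContinuousLinearMap.id ℂ _ := ext_mono fun α => by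
    change bshift i (X i * mono α) = mono α
    rw [X_mul_mono, bshift_mono_add]
  exact DFunLike.congr_fun key f

lemma exists_eq_single_add {i : ι} {α : ι → ℕ} (h : α i ≠ 0) :
    ∃ β : ι → ℕ, α = Pi.single i 1 + β := by
  refine ⟨α - Pi.single i 1, funext fun k => ?_⟩
  by_cases hk : k = i
  · subst hk
    simp only [Pi.add_apply, Pi.sub_apply, Pi.single_eq_same]
    omega
  · simp [hk]

/-- Together with `bshift_X_mul` this says that the variables form a regular sequence with bounded,
compatible left inverses; the Koszul homotopy uses nothing else. -/
lemma bshift_X_mul_of_ne {i j : ι} (hij : i ≠ j) (f : Wiener ι) :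
    bshift i (X j * f) = X j * bshift i f := by
  have key : (bshift i).comp (mulL (X j)) = (mulL (X j)).comp (bshift i) := ext_mono fun α => by
    change bshift i (X j * mono α) = X j * bshift i (mono α)
    rw [X_mul_mono]
    by_cases h : α i = 0
    · rw [bshift_mono_of_eq_zero h, bshift_mono_of_eq_zero, mul_zero]
      simp [h, hij]
    · obtain ⟨β, rfl⟩ := exists_eq_single_add h
      rw [add_left_comm, bshift_mono_add, bshift_mono_add, X_mul_mono]
  exact DFunLike.congr_fun key f

/-! ### Evaluation -/

section Eval

variable [Fintype ι]

/-- Evaluation at a point `z` of the closed unit polydisc. -/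
def ev (z : ι → ℂ) : Wiener ι →L[ℂ] ℂ := lift fun α => ∏ i, z i ^ α i

lemma norm_prod_pow_le {z : ι → ℂ} (hz : ‖z‖ ≤ 1) (α : ι → ℕ) : ‖∏ i, z i ^ α i‖ ≤ 1 := by
  rw [norm_prod]
  refine Finset.prod_le_one (fun i _ => norm_nonneg _) fun i _ => ?_
  rw [norm_pow]
  exact pow_le_one₀ (norm_nonneg _) ((norm_le_pi_norm z i).trans hz)

lemma ev_mono {z : ι → ℂ} (hz : ‖z‖ ≤ 1) (α : ι → ℕ) : ev z (mono α) = ∏ i, z i ^ α i :=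
  lift_mono (norm_prod_pow_le hz) α

lemma norm_ev_le {z : ι → ℂ} (hz : ‖z‖ ≤ 1) : ‖ev z‖ ≤ 1 := norm_lift_le (norm_prod_pow_le hz)

lemma ev_mul {z : ι → ℂ} (hz : ‖z‖ ≤ 1) (f g : Wiener ι) : ev z (f * g) = ev z f * ev z g := by
  have key : (ContinuousLinearMap.compL ℂ (Wiener ι) (Wiener ι) ℂ (ev z)).comp mulL =
      ((ContinuousLinearMap.mul ℂ ℂ).flip.comp (ev z)).flip.comp (ev z) := by
    refine ext_mono fun α => ext_mono fun β => ?_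
    simp [mulL_mono, ev_mono hz, pow_add, Finset.prod_mul_distrib, mul_comm]
  have := DFunLike.congr_fun (DFunLike.congr_fun key f) g
  simpa [mul_def, mul_comm] using this

lemma ev_one {z : ι → ℂ} (hz : ‖z‖ ≤ 1) : ev z 1 = 1 := by
  rw [one_def, ev_mono hz]; simp

lemma ev_X {z : ι → ℂ} (hz : ‖z‖ ≤ 1) (i : ι) : ev z (X i) = z i := by
  rw [X, ev_mono hz, Finset.prod_eq_single i]
  · simp
  · intro j _ hj; simp [hj]
  · simp

/-- Evaluation at a point of the closed unit polydisc, as a character. -/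
def evHom (z : ι → ℂ) (hz : ‖z‖ ≤ 1) : Wiener ι →ₐ[ℂ] ℂ :=
  AlgHom.ofLinearMap (ev z : Wiener ι →ₗ[ℂ] ℂ) (ev_one hz) (ev_mul hz)

lemma ev_bshift {z : ι → ℂ} (hz : ‖z‖ ≤ 1) (i : ι) (f : Wiener ι) :
    ev z f = ev (Function.update z i 0) f + z i * ev z (bshift i f) := by
  have hz' : ‖Function.update z i 0‖ ≤ 1 := by
    rw [pi_norm_le_iff_of_nonneg zero_le_one]
    intro j
    by_cases hj : j = i
    · subst hj; simp
    · rw [Function.update_of_ne hj]; exact (norm_le_pi_norm z j).trans hz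
  have key : ev z = ev (Function.update z i 0) + (z i) • (ev z).comp (bshift i) := by
    refine ext_mono fun α => ?_
    simp only [add_apply, smul_apply,
      ContinuousLinearMap.comp_apply, smul_eq_mul]
    by_cases h : α i = 0
    · rw [bshift_mono_of_eq_zero h, map_zero, mul_zero, add_zero, ev_mono hz, ev_mono hz']
      refine Finset.prod_congr rfl fun j _ => ?_
      by_cases hj : j = i
      · subst hj; simp [h]
      · rw [Function.update_of_ne hj]
    · obtain ⟨β, rfl⟩ := exists_eq_single_add h
      rw [bshift_mono_add, ← X_mul_mono, ev_mul hz, ev_mul hz', ev_X hz, ev_X hz']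
      simp
  have := DFunLike.congr_fun key f
  simpa using this

end Eval

end Wiener

namespace Wiener

variable {ι : Type*} [DecidableEq ι] [Fintype ι]

lemma norm_piecewise_le (s : Finset ι) (z : ι → ℂ) : ‖s.piecewise z 0‖ ≤ ‖z‖ := by
  refine (pi_norm_le_iff_of_nonneg (norm_nonneg _)).2 fun i => ?_
  by_cases hi : i ∈ s
  · simpa [hi] using norm_le_pi_norm z i
  · simp [hi]

lemma isUnit_one_sub_smul_bshift {c : ℂ} (hc : ‖c‖ < 1) (i : ι) :
    IsUnit (1 - c • bshift i : Wiener ι →L[ℂ] Wiener ι) := by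
  refine isUnit_one_sub_of_norm_lt_one ?_
  rw [norm_smul]
  calc ‖c‖ * ‖bshift i‖ ≤ ‖c‖ * 1 := mul_le_mul_of_nonneg_left (norm_bshift_le i) (norm_nonneg _)
    _ < 1 := by rwa [mul_one]

/-- `ev_bshift` reads `ev w ∘ (1 - z j • bshift j) = ev (w with w j = 0)`, and the operator on the
left is invertible by a geometric series. So one more coordinate is switched on by composing with a
resolvent. -/
lemma ev_piecewise_insert {z : ι → ℂ} (hz : ‖z‖ < 1) {s : Finset ι} {j : ι} (hj : j ∉ s) :
    ev ((insert j s).piecewise z 0) =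
      (ev (s.piecewise z 0)).comp (Ring.inverse (1 - z j • bshift j)) := by
  set w := (insert j s).piecewise z 0 with hw
  have hw1 : ‖w‖ ≤ 1 := (norm_piecewise_le _ _).trans hz.le
  have hwj : w j = z j := by simp [hw]
  have hup : Function.update w j 0 = s.piecewise z 0 := by
    funext i
    by_cases hi : i = j
    · subst hi; simp [hj]
    · by_cases his : i ∈ s <;> simp [hw, hi, his]
  have h1 : (ev w).comp (1 - z j • bshift j) = ev (s.piecewise z 0) := by
    ext f
    have := ev_bshift hw1 j f
    rw [hup, hwj] at this
    simp [this]
  have h2 := Ring.mul_inverse_cancel _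
    (isUnit_one_sub_smul_bshift ((norm_le_pi_norm z j).trans_lt hz) j)
  rw [← h1, ContinuousLinearMap.comp_assoc]
  change ev w = (ev w).comp ((1 - z j • bshift j) * Ring.inverse (1 - z j • bshift j))
  rw [h2]
  rfl

/-- Starting from evaluation at the origin, the coordinates are switched on one at a time, each by a
resolvent of a shift, and inversion in a Banach algebra is analytic. Analyticity holds for the
evaluation as a vector of the dual space, so it is uniform over all series. -/
theorem analyticAt_ev {z : ι → ℂ} (hz : ‖z‖ < 1) :
    AnalyticAt ℂ (ev : (ι → ℂ) → Wiener ι →L[ℂ] ℂ) z := by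
  have key : ∀ s : Finset ι, AnalyticAt ℂ (fun z : ι → ℂ => ev (s.piecewise z 0)) z := by
    intro s
    induction s using Finset.induction_on with
    | empty => simpa using analyticAt_const
    | insert j s hj ih =>
      have hev : ∀ᶠ w in 𝓝 z, ‖w‖ < 1 := continuous_norm.continuousAt.eventually_lt_const hz
      refine AnalyticAt.congr ?_ (hev.mono fun w hw => (ev_piecewise_insert hw hj).symm)
      have hinv : AnalyticAt ℂ (fun w : ι → ℂ => Ring.inverse (1 - w j • bshift j)) z := by
        obtain ⟨u, hu⟩ := isUnit_one_sub_smul_bshift ((norm_le_pi_norm z j).trans_lt hz) j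
        have h1 := analyticAt_inverse (𝕜 := ℂ) u
        rw [hu] at h1
        have h2 : AnalyticAt ℂ
            (fun w : ι → ℂ => (1 - w j • bshift j : Wiener ι →L[ℂ] Wiener ι)) z :=
          analyticAt_const.sub
            (((ContinuousLinearMap.proj j : (ι → ℂ) →L[ℂ] ℂ).analyticAt z).smul analyticAt_const)
        exact AnalyticAt.fun_comp (f := fun w : ι → ℂ =>
          (1 - w j • bshift j : Wiener ι →L[ℂ] Wiener ι)) h1 h2
      have h3 := (ContinuousLinearMap.compL ℂ (Wiener ι) (Wiener ι) ℂ).analyticAt_bilinear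
        (ev (s.piecewise z 0), Ring.inverse (1 - z j • bshift j))
      exact AnalyticAt.fun_comp (f := fun w : ι → ℂ =>
        (ev (s.piecewise w 0), Ring.inverse (1 - w j • bshift j : Wiener ι →L[ℂ] Wiener ι)))
        h3 (ih.prod hinv)
  simpa using key Finset.univ

lemma analyticAt_ev_apply {z : ι → ℂ} (hz : ‖z‖ < 1) (f : Wiener ι) :
    AnalyticAt ℂ (fun w => ev w f) z :=
  ((ContinuousLinearMap.apply ℂ ℂ f).analyticAt _).fun_comp (analyticAt_ev hz)

/-- The coefficient of a monomial, as a continuous linear form. -/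
def coeffL (α : ι → ℕ) : Wiener ι →L[ℂ] ℂ := lift fun β => if β = α then 1 else 0

lemma coeffL_mono (α β : ι → ℕ) : coeffL α (mono β) = if β = α then 1 else 0 :=
  lift_mono (C := 1) (fun β => by split_ifs <;> simp) β

lemma coeffL_apply (α : ι → ℕ) (f : Wiener ι) : coeffL α f = coeff f α := by
  have h := (hasSum_mono f).mapL (coeffL α)
  refine h.unique ?_
  have h2 : (fun β => coeffL α (coeff f β • mono β)) =
      fun β => if β = α then coeff f α else 0 := by
    funext β
    rw [map_smul, coeffL_mono]
    split_ifs with hb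
    · rw [hb, smul_eq_mul, mul_one]
    · rw [smul_zero]
  rw [h2]
  exact hasSum_ite_eq α _

lemma coeffL_bshift (i : ι) (α : ι → ℕ) (f : Wiener ι) :
    coeffL α (bshift i f) = coeffL (Pi.single i 1 + α) f := by
  have key : (coeffL α).comp (bshift i) = coeffL (Pi.single i 1 + α) := ext_mono fun β => by
    rw [ContinuousLinearMap.comp_apply, coeffL_mono]
    by_cases h : β i = 0
    · rw [bshift_mono_of_eq_zero h, map_zero, if_neg]
      rintro rfl
      simp at h
    · obtain ⟨γ, rfl⟩ := exists_eq_single_add h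
      rw [bshift_mono_add, coeffL_mono]
      simp
  exact DFunLike.congr_fun key f

lemma coeffL_zero_eq_ev (f : Wiener ι) : coeffL 0 f = ev 0 f := by
  have key : (coeffL 0 : Wiener ι →L[ℂ] ℂ) = ev 0 := ext_mono fun β => by
    rw [coeffL_mono, ev_mono (by simp)]
    split_ifs with h
    · simp [h]
    · obtain ⟨i, hi⟩ := Function.ne_iff.1 h
      rw [Finset.prod_eq_zero (Finset.mem_univ i)]
      simpa using hi
  exact DFunLike.congr_fun key f

lemma eventually_norm_lt_one : ∀ᶠ z : ι → ℂ in 𝓝 0, ‖z‖ < 1 :=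
  continuous_norm.continuousAt.eventually_lt_const (by simp)

/-- By `ev_bshift`, the product of `z i` with the value of the shifted series vanishes near 0. The
factor cancels off the hyperplane `z i = 0`, and continuity carries the vanishing across it. -/
lemma ev_bshift_eventually_zero {f : Wiener ι} (h : ∀ᶠ z in 𝓝 0, ev z f = 0) (i : ι) :
    ∀ᶠ z in 𝓝 0, ev z (bshift i f) = 0 := by
  have hup : Tendsto (fun z : ι → ℂ => Function.update z i 0) (𝓝 0) (𝓝 0) := by
    have : Continuous fun z : ι → ℂ => Function.update z i (0 : ℂ) := by fun_prop
    have h2 := this.tendsto 0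
    rwa [show Function.update (0 : ι → ℂ) i (0 : ℂ) = 0 from Function.update_eq_self i (0 : ι → ℂ)] at h2
  have h1 : ∀ᶠ z : ι → ℂ in 𝓝 0, z i * ev z (bshift i f) = 0 := by
    filter_upwards [h, hup.eventually h, eventually_norm_lt_one] with z hz hz2 hz1
    have := ev_bshift hz1.le i f
    rw [hz, hz2, zero_add] at this
    exact this.symm
  obtain ⟨ε, hε, hb⟩ := Metric.eventually_nhds_iff_ball.1 (h1.and eventually_norm_lt_one)
  refine Metric.eventually_nhds_iff_ball.2 ⟨ε, hε, fun z hz => ?_⟩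
  have hcont : ContinuousAt (fun c : ℂ => ev (Function.update z i c) (bshift i f)) (z i) := by
    have h3 : ContinuousAt (fun w => ev w (bshift i f)) (Function.update z i (z i)) := by
      rw [Function.update_eq_self]
      exact (analyticAt_ev_apply (hb z hz).2 _).continuousAt
    exact ContinuousAt.comp (f := fun c : ℂ => Function.update z i c) h3
      (by fun_prop : Continuous fun c : ℂ => Function.update z i c).continuousAt
  have hz' : ∀ᶠ c in 𝓝 (z i), Function.update z i c ∈ Metric.ball (0 : ι → ℂ) ε := by
    have : Continuous fun c : ℂ => Function.update z i c := by fun_prop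
    refine this.continuousAt.eventually_mem (Metric.isOpen_ball.mem_nhds ?_)
    rwa [Function.update_eq_self]
  have hfreq : ∀ᶠ c in 𝓝[{0}ᶜ] (z i), ev (Function.update z i c) (bshift i f) = 0 := by
    filter_upwards [nhdsWithin_le_nhds hz', self_mem_nhdsWithin] with c hc hc0
    have := (hb _ hc).1
    rw [Function.update_self] at this
    exact (mul_eq_zero.1 this).resolve_left hc0
  have hne : (𝓝[{0}ᶜ] (z i)).NeBot :=
    mem_closure_iff_nhdsWithin_neBot.1 (dense_compl_singleton (0 : ℂ) (z i))
  have hlim := (hcont.tendsto.mono_left (nhdsWithin_le_nhds (s := {0}ᶜ)))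
  have := tendsto_nhds_unique hlim (tendsto_const_nhds.congr' (hfreq.mono fun c hc => hc.symm))
  simpa using this

/-- The coefficient at `α` is the value at 0 of the series after `α` backward shifts, and each shift
preserves vanishing near 0. Elements of the algebra may thus be identified with germs. -/
theorem eq_zero_of_ev {f : Wiener ι} (h : ∀ᶠ z in 𝓝 0, ev z f = 0) : f = 0 := by
  have key : ∀ n : ℕ, ∀ α : ι → ℕ, ∑ i, α i = n → ∀ f : Wiener ι, (∀ᶠ z in 𝓝 0, ev z f = 0) →
      coeffL α f = 0 := by
    intro n
    induction n with
    | zero =>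
      intro α hα f hf
      have : α = 0 := by
        funext i
        exact (Finset.sum_eq_zero_iff.1 hα) i (Finset.mem_univ i)
      rw [this, coeffL_zero_eq_ev]
      exact hf.self_of_nhds
    | succ n ih =>
      intro α hα f hf
      obtain ⟨i, hi⟩ : ∃ i, α i ≠ 0 := by
        by_contra! h0
        simp [h0] at hα
      obtain ⟨β, rfl⟩ := exists_eq_single_add hi
      rw [← coeffL_bshift]
      refine ih β ?_ _ (ev_bshift_eventually_zero hf i)
      simp only [Pi.add_apply, Finset.sum_add_distrib] at hα
      simp at hα
      omega
  have h2 := hasSum_mono f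
  refine h2.unique ?_
  have : (fun α => coeff f α • (mono α : Wiener ι)) = fun _ => 0 := by
    funext α
    rw [← coeffL_apply, key _ α rfl f h, zero_smul]
  rw [this]
  exact hasSum_zero

theorem eq_of_ev {f g : Wiener ι} (h : ∀ᶠ z in 𝓝 0, ev z f = ev z g) : f = g :=
  sub_eq_zero.1 (eq_zero_of_ev (h.mono fun z hz => by rw [map_sub, hz, sub_self]))

end Wiener

/-! ### Holomorphic functional calculus in commutative Banach algebras. -/

section FunctionalCalculus

variable {ι : Type*} [Fintype ι] [DecidableEq ι]
  (𝒜 : Type*) [NormedCommRing 𝒜] [NormedAlgebra ℂ 𝒜] [NormOneClass 𝒜]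

/-- The extension of a power series on `ℂ^ι` to a Banach algebra. -/
def extendSeries (p : FormalMultilinearSeries ℂ (ι → ℂ) ℂ) :
    FormalMultilinearSeries ℂ (ι → 𝒜) 𝒜 := fun k =>
  ∑ s : Fin k → ι, (p k fun l => Pi.single (s l) 1) •
    (ContinuousMultilinearMap.mkPiAlgebraFin ℂ k 𝒜).compContinuousLinearMap
      fun l => ContinuousLinearMap.proj (R := ℂ) (φ := fun _ : ι => 𝒜) (s l)

lemma extendSeries_apply (p : FormalMultilinearSeries ℂ (ι → ℂ) ℂ) (k : ℕ) (U : Fin k → ι → 𝒜) :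
    extendSeries 𝒜 p k U =
      ∑ s : Fin k → ι, (p k fun l => Pi.single (s l) 1) • (List.ofFn fun l => U l (s l)).prod := by
  simp [extendSeries]

lemma norm_extendSeries_le (p : FormalMultilinearSeries ℂ (ι → ℂ) ℂ) (k : ℕ) :
    ‖extendSeries 𝒜 p k‖ ≤ (Fintype.card ι : ℝ) ^ k * ‖p k‖ := by
  refine ContinuousMultilinearMap.opNorm_le_bound (by positivity) fun U => ?_
  rw [extendSeries_apply]
  refine (norm_sum_le _ _).trans ?_
  have h : ∀ s : Fin k → ι, ‖(p k fun l => Pi.single (s l) 1) •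
      (List.ofFn fun l => U l (s l)).prod‖ ≤ ‖p k‖ * ∏ l, ‖U l‖ := by
    intro s
    rw [norm_smul]
    refine mul_le_mul ?_ ?_ (norm_nonneg _) (norm_nonneg _)
    · refine ((p k).le_opNorm _).trans (mul_le_of_le_one_right (norm_nonneg _) ?_)
      refine Finset.prod_le_one (fun _ _ => norm_nonneg _) fun l _ => ?_
      refine (pi_norm_le_iff_of_nonneg zero_le_one).2 fun j => ?_
      rw [Pi.single_apply]
      split_ifs <;> simp
    · rw [List.prod_ofFn]
      refine (Finset.norm_prod_le _ _).trans ?_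
      exact Finset.prod_le_prod (fun _ _ => norm_nonneg _) fun l _ => norm_le_pi_norm (U l) (s l)
  refine (Finset.sum_le_sum fun s _ => h s).trans (le_of_eq ?_)
  simp [mul_assoc]

/-- Summing over the `card ι ^ k` index words divides the radius by at most `card ι`; the added 1
keeps the quotient meaningful when `ι` is empty. -/
lemma extendSeries_radius_pos {p : FormalMultilinearSeries ℂ (ι → ℂ) ℂ} (hp : 0 < p.radius) :
    0 < (extendSeries 𝒜 p).radius := by
  obtain ⟨r, hr0, hr⟩ := ENNReal.lt_iff_exists_nnreal_btwn.1 hp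
  obtain ⟨C, hC, h⟩ := p.norm_mul_pow_le_of_lt_radius hr
  have hr0' : 0 < r := by exact_mod_cast hr0
  have hc : (0 : NNReal) < r / (Fintype.card ι + 1) := by positivity
  refine lt_of_lt_of_le (ENNReal.coe_pos.2 hc)
    (FormalMultilinearSeries.le_radius_of_bound _ C fun k => ?_)
  refine le_trans ?_ (h k)
  have h1 : (Fintype.card ι : ℝ) ^ k * ((r / (Fintype.card ι + 1) : NNReal) : ℝ) ^ k ≤ (r : ℝ) ^ k := by
    rw [← mul_pow]
    refine pow_le_pow_left₀ (by positivity) ?_ k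
    push_cast
    rw [mul_div_assoc', div_le_iff₀ (by positivity)]
    nlinarith [r.2, (Nat.cast_nonneg (Fintype.card ι) : (0 : ℝ) ≤ _)]
  calc _ ≤ ((Fintype.card ι : ℝ) ^ k * ‖p k‖) * ((r / (Fintype.card ι + 1) : NNReal) : ℝ) ^ k :=
        mul_le_mul_of_nonneg_right (norm_extendSeries_le 𝒜 p k) (by positivity)
    _ = ‖p k‖ * ((Fintype.card ι : ℝ) ^ k * ((r / (Fintype.card ι + 1) : NNReal) : ℝ) ^ k) := by ring
    _ ≤ _ := mul_le_mul_of_nonneg_left h1 (norm_nonneg _)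

/-- The coefficients are scalars, so a character passes through them and only substitutes `χ (U i)`
for `U i`. -/
lemma extendSeries_character (p : FormalMultilinearSeries ℂ (ι → ℂ) ℂ) (k : ℕ) (χ : 𝒜 →ₐ[ℂ] ℂ)
    (U : ι → 𝒜) : χ (extendSeries 𝒜 p k fun _ => U) = p k fun _ i => χ (U i) := by
  have h : (fun _ : Fin k => fun i => χ (U i)) =
      fun _ : Fin k => ∑ i, χ (U i) • (Pi.single i (1 : ℂ) : ι → ℂ) := by
    funext _ j
    simp [Finset.sum_apply, Pi.single_apply]
  rw [h, extendSeries_apply, map_sum]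
  erw [MultilinearMap.map_sum]
  refine Finset.sum_congr rfl fun s _ => ?_
  erw [MultilinearMap.map_smul_univ]
  rw [map_smul, map_list_prod, List.map_ofFn, List.prod_ofFn, smul_eq_mul, smul_eq_mul, mul_comm]
  rfl

variable [CompleteSpace 𝒜]

/-- **Holomorphic functional calculus** in several variables: a germ of holomorphic function at
`0 ∈ ℂ^ι` extends to a germ of analytic function on `𝒜^ι`, for every commutative Banach algebra
`𝒜`. -/
theorem exists_functional_calculus {f : (ι → ℂ) → ℂ} (hf : AnalyticAt ℂ f 0) :
    ∃ g : (ι → 𝒜) → 𝒜, AnalyticAt ℂ g 0 ∧ (f 0 = 0 → g 0 = 0) ∧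
      (HasFDerivAt f (0 : (ι → ℂ) →L[ℂ] ℂ) 0 →
        HasStrictFDerivAt g (0 : (ι → 𝒜) →L[ℂ] 𝒜) 0) ∧
      ∀ᶠ U in 𝓝 (0 : ι → 𝒜), ∀ χ : 𝒜 →ₐ[ℂ] ℂ, (∀ a, ‖χ a‖ ≤ ‖a‖) →
        χ (g U) = f fun i => χ (U i) := by
  obtain ⟨p, r, hp⟩ := hf
  have hpos : 0 < (extendSeries 𝒜 p).radius :=
    extendSeries_radius_pos 𝒜 (hp.r_pos.trans_le hp.r_le)
  have hg := (extendSeries 𝒜 p).hasFPowerSeriesOnBall hpos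
  refine ⟨(extendSeries 𝒜 p).sum, hg.analyticAt, fun h0 => ?_, fun hd => ?_, ?_⟩
  · have h1 := hg.coeff_zero (fun _ => 0)
    rw [← h1]
    have h2 := hp.coeff_zero (fun _ => 0)
    rw [extendSeries_apply]
    refine Finset.sum_eq_zero fun s _ => ?_
    rw [hp.coeff_zero, h0, zero_smul]
  · have h1 := hg.hasFPowerSeriesAt.hasStrictFDerivAt
    have h2 := hp.hasFPowerSeriesAt.hasFDerivAt.unique hd
    -- The linear coefficients of the extension are the partial derivatives of `f` at 0, which
    -- vanish.
    have h0 : continuousMultilinearCurryFin1 ℂ (ι → 𝒜) 𝒜 (extendSeries 𝒜 p 1) = 0 := by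
      refine ContinuousLinearMap.ext fun U => ?_
      rw [continuousMultilinearCurryFin1_apply, extendSeries_apply]
      refine Finset.sum_eq_zero fun s _ => ?_
      have h3 := DFunLike.congr_fun h2 (Pi.single (s 0) 1)
      simp only [zero_apply, continuousMultilinearCurryFin1_apply] at h3
      have h4 : (fun l : Fin 1 => (Pi.single (s l) 1 : ι → ℂ)) =
          Fin.snoc 0 (Pi.single (s 0) 1) := by
        funext l
        rw [Subsingleton.elim l (Fin.last 0), Fin.snoc_last]
        rfl
      rw [h4, h3, zero_smul]
    rwa [h0] at h1
  · have hball : ∀ᶠ U in 𝓝 (0 : ι → 𝒜), U ∈ Metric.eball 0 (min r (extendSeries 𝒜 p).radius) :=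
      Metric.eball_mem_nhds _ (lt_min hp.r_pos hpos)
    filter_upwards [hball] with U hU χ hχ
    have hU1 : U ∈ Metric.eball 0 (extendSeries 𝒜 p).radius :=
      Metric.eball_subset_eball (min_le_right _ _) hU
    -- Contractivity of `χ` keeps the scalar point inside the ball of convergence of `p`, and also
    -- makes `χ` continuous, so it can be applied term by term.
    have hU2 : (fun i => χ (U i)) ∈ Metric.eball (0 : ι → ℂ) r := by
      have h1 : U ∈ Metric.eball 0 r := Metric.eball_subset_eball (min_le_left _ _) hU
      rw [Metric.mem_eball, edist_zero_right] at h1 ⊢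
      refine lt_of_le_of_lt ?_ h1
      rw [← ofReal_norm, ← ofReal_norm]
      refine ENNReal.ofReal_le_ofReal ?_
      exact (pi_norm_le_iff_of_nonneg (norm_nonneg _)).2 fun i =>
        (hχ _).trans (norm_le_pi_norm U i)
    have h1 := (hg.hasSum hU1)
    have h2 := (hp.hasSum hU2)
    rw [zero_add] at h1 h2
    let χ' : 𝒜 →L[ℂ] ℂ := LinearMap.mkContinuous χ.toLinearMap 1 fun a => by
      rw [one_mul]; exact hχ a
    have h3 := h1.mapL χ'
    have h5 : (fun k => χ' (extendSeries 𝒜 p k fun _ => U)) = fun k => p k fun _ i => χ (U i) :=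
      funext fun k => extendSeries_character 𝒜 p k χ U
    rw [h5] at h3
    exact h3.unique h2

end FunctionalCalculus

/-! ### Composition of holomorphic germs with elements of the Wiener algebra. -/

namespace Wiener

variable {ι κ : Type*} [Fintype ι] [DecidableEq ι] [Fintype κ] [DecidableEq κ]

/-- Evaluations at points of the closed polydisc are contractive characters, so on this algebra the
functional calculus is the composition `U ↦ f ∘ U`. Nonlinear functional equations thereby become
analytic equations in a Banach space. -/
theorem exists_extension {f : (ι → ℂ) → ℂ} (hf : AnalyticAt ℂ f 0) :
    ∃ g : (ι → Wiener κ) → Wiener κ, AnalyticAt ℂ g 0 ∧ (f 0 = 0 → g 0 = 0) ∧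
      (HasFDerivAt f (0 : (ι → ℂ) →L[ℂ] ℂ) 0 →
        HasStrictFDerivAt g (0 : (ι → Wiener κ) →L[ℂ] Wiener κ) 0) ∧
      ∀ᶠ U in 𝓝 (0 : ι → Wiener κ), ∀ z : κ → ℂ, ‖z‖ ≤ 1 →
        ev z (g U) = f fun i => ev z (U i) := by
  obtain ⟨g, h1, h2, h3, h4⟩ := exists_functional_calculus (Wiener κ) hf
  refine ⟨g, h1, h2, h3, h4.mono fun U hU z hz => hU (evHom z hz) fun a => ?_⟩
  calc ‖ev z a‖ ≤ ‖ev z‖ * ‖a‖ := (ev z).le_opNorm a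
    _ ≤ 1 * ‖a‖ := mul_le_mul_of_nonneg_right (norm_ev_le hz) (norm_nonneg _)
    _ = ‖a‖ := one_mul _

/-- A germ of holomorphic function at `0` becomes an element of the Wiener algebra after a
homothety. -/
theorem exists_ev_eq {f : (ι → ℂ) → ℂ} (hf : AnalyticAt ℂ f 0) :
    ∀ᶠ ρ in 𝓝 (0 : ℂ), ∃ a : Wiener ι, ∀ z : ι → ℂ, ‖z‖ ≤ 1 → ev z a = f (ρ • z) := by
  obtain ⟨g, -, -, -, h4⟩ := exists_extension (κ := ι) hf
  have hc : Tendsto (fun ρ : ℂ => fun i => ρ • (X i : Wiener ι)) (𝓝 0) (𝓝 0) := by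
    have : Continuous (fun ρ : ℂ => fun i => ρ • (X i : Wiener ι)) := by fun_prop
    have h := this.tendsto 0
    simp only [zero_smul] at h
    exact h
  filter_upwards [hc.eventually h4] with ρ hρ
  refine ⟨g fun i => ρ • X i, fun z hz => ?_⟩
  rw [hρ z hz]
  congr 1
  funext i
  simp [ev_X hz]

end Wiener

/-! ### Derivatives of evaluations, and primitives. -/

namespace Wiener

section Derivative

variable {ι : Type*} [Fintype ι] [DecidableEq ι]

/-- Partial differentiation is unbounded on the Wiener algebra, but the derivative of evaluation at
an interior point is a bounded functional. Differential identities can therefore still be tested on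
monomials. -/
lemma fderiv_ev_mono {z : ι → ℂ} (hz : ‖z‖ < 1) (v : ι → ℂ) (α : ι → ℕ) :
    fderiv ℂ ev z v (mono α) = ∑ i, v i * (α i * ev z (bshift i (mono α))) := by
  have h1 : HasFDerivAt (fun w : ι → ℂ => ev w (mono α))
      ((ContinuousLinearMap.apply ℂ ℂ (mono α)).comp (fderiv ℂ ev z)) z :=
    (ContinuousLinearMap.apply ℂ ℂ (mono α : Wiener ι)).hasFDerivAt.comp z
      (analyticAt_ev hz).differentiableAt.hasFDerivAt
  have h2 : HasFDerivAt (fun w : ι → ℂ => ∏ i, w i ^ α i)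
      (∑ i, (∏ j ∈ Finset.univ.erase i, z j ^ α j) •
        ((α i • z i ^ (α i - 1)) • (ContinuousLinearMap.proj i : (ι → ℂ) →L[ℂ] ℂ))) z := by
    refine HasFDerivAt.finsetProd fun i _ => ?_
    exact ((ContinuousLinearMap.proj i : (ι → ℂ) →L[ℂ] ℂ).hasFDerivAt (x := z)).pow (α i)
  have h3 : (fun w : ι → ℂ => ev w (mono α)) =ᶠ[𝓝 z] fun w => ∏ i, w i ^ α i :=
    (continuous_norm.continuousAt.eventually_lt_const hz).mono fun w hw => ev_mono hw.le α
  have h4 := DFunLike.congr_fun (h1.unique (h2.congr_of_eventuallyEq h3)) v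
  simp only [ContinuousLinearMap.comp_apply, ContinuousLinearMap.apply_apply, sum_apply,
    smul_apply, ContinuousLinearMap.proj_apply, smul_eq_mul, nsmul_eq_mul] at h4
  rw [h4]
  refine Finset.sum_congr rfl fun i _ => ?_
  by_cases h : α i = 0
  · simp [h]
  · rw [bshift_mono, if_neg h, ev_mono hz.le, ← Finset.mul_prod_erase _ _ (Finset.mem_univ i)]
    have : ∏ j ∈ Finset.univ.erase i, z j ^ (α - Pi.single i 1 : ι → ℕ) j =
        ∏ j ∈ Finset.univ.erase i, z j ^ α j := by
      refine Finset.prod_congr rfl fun j hj => ?_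
      simp [Finset.ne_of_mem_erase hj]
    rw [this]
    simp
    ring

lemma mul_ev_bshift_mono {z : ι → ℂ} (hz : ‖z‖ ≤ 1) (i : ι) (α : ι → ℕ) :
    (α i : ℂ) * (z i * ev z (bshift i (mono α))) = α i * ev z (mono α) := by
  by_cases h : α i = 0
  · simp [h]
  · obtain ⟨β, rfl⟩ := exists_eq_single_add h
    rw [bshift_mono_add, ← X_mul_mono, ev_mul hz, ev_X hz]

/-- The primitive with respect to the variable `x_τ` which vanishes for `x_τ = 0`. -/
def primitive (τ : ι) : Wiener ι →L[ℂ] Wiener ι :=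
  lift fun α => (1 / (α τ + 1) : ℂ) • mono (Pi.single τ 1 + α)

lemma primitive_mono (τ : ι) (α : ι → ℕ) :
    primitive τ (mono α) = (1 / (α τ + 1) : ℂ) • mono (Pi.single τ 1 + α) := by
  refine lift_mono (C := 1) (fun α => ?_) α
  rw [norm_smul, norm_mono, mul_one, norm_div, norm_one]
  have : ((α τ : ℂ) + 1) = ((α τ + 1 : ℕ) : ℂ) := by push_cast; ring
  rw [this, Complex.norm_natCast]
  exact (div_le_one (by positivity)).2 (by exact_mod_cast Nat.le_add_left 1 _)

lemma ev_primitive_of_eq_zero {z : ι → ℂ} (hz : ‖z‖ ≤ 1) {τ : ι} (h : z τ = 0) (f : Wiener ι) :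
    ev z (primitive τ f) = 0 := by
  have key : (ev z).comp (primitive τ) = 0 := ext_mono fun α => by
    rw [ContinuousLinearMap.comp_apply, primitive_mono, map_smul, ← X_mul_mono, ev_mul hz,
      ev_X hz, h]
    simp
  exact DFunLike.congr_fun key f

lemma fderiv_ev_primitive {z : ι → ℂ} (hz : ‖z‖ < 1) (τ : ι) (f : Wiener ι) :
    fderiv ℂ ev z (Pi.single τ 1) (primitive τ f) = ev z f := by
  have key : (fderiv ℂ ev z (Pi.single τ 1)).comp (primitive τ) = ev z := ext_mono fun α => by
    rw [ContinuousLinearMap.comp_apply, primitive_mono, map_smul, fderiv_ev_mono hz,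
      Finset.sum_eq_single τ (fun j _ hj => by simp [hj]) (by simp), bshift_mono_add]
    have : (α τ : ℂ) + 1 ≠ 0 := Nat.cast_add_one_ne_zero _
    simp
    field_simp
    ring
  exact DFunLike.congr_fun key f

lemma hasFDerivAt_ev_apply {z : ι → ℂ} (hz : ‖z‖ < 1) (f : Wiener ι) :
    HasFDerivAt (fun w => ev w f)
      ((ContinuousLinearMap.apply ℂ ℂ f).comp (fderiv ℂ ev z)) z :=
  (ContinuousLinearMap.apply ℂ ℂ f).hasFDerivAt.comp z
    (analyticAt_ev hz).differentiableAt.hasFDerivAt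

end Derivative

end Wiener

/-! ### Parametrized inverse function theorem and holomorphic flows. -/

lemma eventually_exists_of_surj {E F : Type*} [NormedAddCommGroup E] [NormedSpace ℂ E]
    [NormedAddCommGroup F] [NormedSpace ℂ F] [CompleteSpace E] [CompleteSpace F]
    {Φ : E × ℂ → F} {Φ' : E × ℂ →L[ℂ] F} (hΦ : HasStrictFDerivAt Φ Φ' 0) (h0 : Φ 0 = 0)
    (hs : ∀ w : F, ∃ u : E, Φ' (u, 0) = w) {Q : E × ℂ → Prop} (hQ : ∀ᶠ p in 𝓝 0, Q p) :
    ∀ᶠ ρ in 𝓝 (0 : ℂ), ∃ u : E, Φ (u, ρ) = 0 ∧ Q (u, ρ) := by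
  -- With the parameter adjoined, the map still has surjective derivative, hence is open at the
  -- origin; no splitting of the kernel is needed. The neighbourhood `Q` is mapped onto a
  -- neighbourhood of `(0, 0)`, so the solutions can be taken in `Q`.
  have h1 : HasStrictFDerivAt (fun p : E × ℂ => (Φ p, p.2))
      (Φ'.prod (ContinuousLinearMap.snd ℂ E ℂ)) 0 := hΦ.prodMk hasStrictFDerivAt_snd
  have h2 : (Φ'.prod (ContinuousLinearMap.snd ℂ E ℂ)).range = ⊤ := by
    rw [LinearMap.range_eq_top]
    rintro ⟨w, r⟩
    obtain ⟨u, hu⟩ := hs (w - Φ' (0, r))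
    refine ⟨(u, r), ?_⟩
    have : ((u, r) : E × ℂ) = (u, 0) + (0, r) := by simp
    simp only [ContinuousLinearMap.coe_coe, ContinuousLinearMap.prod_apply,
      ContinuousLinearMap.coe_snd', Prod.mk.injEq, and_true]
    rw [this, map_add, hu]
    abel
  have h3 := h1.map_nhds_eq_of_surj h2
  have h4 : (fun p : E × ℂ => (Φ p, p.2)) '' {p | Q p} ∈ 𝓝 ((0 : F), (0 : ℂ)) := by
    have h5 := image_mem_map (m := fun p : E × ℂ => (Φ p, p.2)) hQ
    rw [h3] at h5
    simpa [h0] using h5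
  have h6 : Tendsto (fun ρ : ℂ => ((0 : F), ρ)) (𝓝 0) (𝓝 ((0 : F), (0 : ℂ))) :=
    (Continuous.prodMk_right (0 : F)).tendsto 0
  filter_upwards [h6.eventually h4] with ρ hρ
  obtain ⟨⟨u, r⟩, hq, he⟩ := hρ
  simp only [Prod.mk.injEq] at he
  obtain ⟨he1, rfl⟩ := he
  exact ⟨u, he1, hq⟩

-- The initial value problem is written as the integral equation `U = ρ (x + ∫ a)` on the unit
-- polydisc, with all variables divided by `ρ`. At `ρ = 0` its derivative in `U` is the identity, so
-- a solution exists for some `ρ ≠ 0`, and `z ↦ U(ρ⁻¹ z)` is the flow. Shrinking `ρ` replaces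
-- shrinking the domain.
open Wiener in
theorem exists_flow_pi {ι : Type*} [Fintype ι] [DecidableEq ι] {a : (Option ι → ℂ) → ι → ℂ}
    (ha : AnalyticAt ℂ a 0) :
    ∃ g : (Option ι → ℂ) → ι → ℂ, AnalyticAt ℂ g 0 ∧
      (∀ᶠ z in 𝓝 0, z none = 0 → g z = fun i => z (some i)) ∧
      ∀ᶠ z in 𝓝 0, fderiv ℂ g z (Pi.single none 1) =
        a (fun k => k.elim (z none) (g z)) := by
  have ha' : ∀ i, AnalyticAt ℂ (fun z => a z i) 0 := fun i =>
    ((ContinuousLinearMap.proj i : (ι → ℂ) →L[ℂ] ℂ).analyticAt _).fun_comp ha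
  choose A hA1 hA2 hA3 hA4 using fun i => exists_extension (κ := Option ι) (ha' i)
  -- The argument of `a`: the unknown `U` in the space components and `ρ` times the time variable in
  -- the component `none`.
  let e : (ι → Wiener (Option ι)) × ℂ →L[ℂ] (Option ι → Wiener (Option ι)) :=
    ContinuousLinearMap.pi fun k => k.elim
      ((ContinuousLinearMap.snd ℂ _ ℂ).smulRight (Wiener.X none))
      fun i => (ContinuousLinearMap.proj i).comp (ContinuousLinearMap.fst ℂ _ ℂ)
  let G : (ι → Wiener (Option ι)) × ℂ → ι → Wiener (Option ι) := fun p i =>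
    Wiener.X (some i) + primitive none (A i (e p))
  have hG : AnalyticAt ℂ G 0 := by
    refine AnalyticAt.pi fun i => analyticAt_const.add ?_
    refine ((primitive none).analyticAt _).fun_comp ?_
    have h := hA1 i
    rw [← map_zero e] at h
    exact h.fun_comp (e.analyticAt 0)
  have hΦ : HasStrictFDerivAt (fun p : (ι → Wiener (Option ι)) × ℂ => p.1 - p.2 • G p) _ 0 :=
    hasStrictFDerivAt_fst.sub (hasStrictFDerivAt_snd.smul hG.hasStrictFDerivAt)
  have hQ : ∀ᶠ p in 𝓝 (0 : (ι → Wiener (Option ι)) × ℂ), ∀ i, ∀ z : Option ι → ℂ, ‖z‖ ≤ 1 →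
      ev z (A i (e p)) = a (fun k => ev z (e p k)) i := by
    refine eventually_all.2 fun i => ?_
    have := e.continuous.tendsto 0
    rw [map_zero] at this
    exact this.eventually (hA4 i)
  have hsol := eventually_exists_of_surj hΦ (by simp) (fun w => ⟨w, by simp⟩) hQ
  obtain ⟨ρ, ⟨U, hU, hUQ⟩, hρ⟩ := ((hsol.filter_mono nhdsWithin_le_nhds).and
    (self_mem_nhdsWithin (s := {(0 : ℂ)}ᶜ))).exists
  have hρ0 : ρ ≠ 0 := hρ
  have hUi : ∀ i, U i = ρ • (Wiener.X (some i) + primitive none (A i (e (U, ρ)))) := fun i =>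
    congrFun (sub_eq_zero.1 hU) i
  have hsmall : ∀ᶠ z : Option ι → ℂ in 𝓝 0, ‖ρ⁻¹ • z‖ < 1 := by
    have : Continuous fun z : Option ι → ℂ => ‖ρ⁻¹ • z‖ := by fun_prop
    exact this.continuousAt.eventually_lt_const (by simp)
  have hev : ∀ z : Option ι → ℂ, ‖ρ⁻¹ • z‖ < 1 → ∀ i,
      HasFDerivAt (fun z : Option ι → ℂ => ev (ρ⁻¹ • z) (U i))
        (((ContinuousLinearMap.apply ℂ ℂ (U i)).comp (fderiv ℂ ev (ρ⁻¹ • z))).comp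
          (ρ⁻¹ • ContinuousLinearMap.id ℂ _)) z := fun z hz i =>
    (hasFDerivAt_ev_apply hz (U i)).comp z ((hasFDerivAt_id z).const_smul ρ⁻¹)
  refine ⟨fun z i => ev (ρ⁻¹ • z) (U i), ?_, ?_, ?_⟩
  · refine AnalyticAt.pi fun i => ?_
    have h1 : AnalyticAt ℂ (fun w => ev w (U i)) (ρ⁻¹ • (0 : Option ι → ℂ)) :=
      analyticAt_ev_apply (by simp) (U i)
    exact h1.fun_comp ((ρ⁻¹ • ContinuousLinearMap.id ℂ (Option ι → ℂ)).analyticAt 0)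
  · filter_upwards [hsmall] with z hz hz0
    funext i
    rw [hUi i, map_smul, map_add, ev_X hz.le, ev_primitive_of_eq_zero hz.le (by simp [hz0])]
    simp [hρ0]
  · filter_upwards [hsmall] with z hz
    have h1 := (hasFDerivAt_pi.2 (hev z hz)).fderiv
    rw [h1]
    funext i
    have h2 : (fun k => ev (ρ⁻¹ • z) (e (U, ρ) k)) =
        fun k => Option.elim k (z none) fun i => ev (ρ⁻¹ • z) (U i) := by
      funext k
      cases k with
      | none => simp [e, ev_X hz.le, hρ0]
      | some i => simp [e]
    have h3 : fderiv ℂ ev (ρ⁻¹ • z) (Pi.single none 1) (U i) =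
        ρ * a (fun k => Option.elim k (z none) fun i => ev (ρ⁻¹ • z) (U i)) i := by
      rw [hUi i, map_smul, map_add, fderiv_ev_primitive hz, hUQ i _ hz.le, h2, Wiener.X,
        fderiv_ev_mono hz]
      rw [Finset.sum_eq_zero]
      · simp
      · intro j _
        cases j <;> simp
    simp [h3, hρ0]


/-- Local solution of a non-autonomous holomorphic differential equation, depending
holomorphically on the initial value. -/
theorem exists_flow {E : Type*} [NormedAddCommGroup E] [NormedSpace ℂ E] [FiniteDimensional ℂ E]
    {a : E × ℂ → E} (ha : AnalyticAt ℂ a 0) :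
    ∃ g : E × ℂ → E, AnalyticAt ℂ g 0 ∧ (∀ᶠ z in 𝓝 (0 : E × ℂ), z.2 = 0 → g z = z.1) ∧
      ∀ᶠ z in 𝓝 (0 : E × ℂ), fderiv ℂ g z (0, 1) = a (g z, z.2) := by
  let e : E ≃L[ℂ] (Fin (Module.finrank ℂ E) → ℂ) := ContinuousLinearEquiv.ofFinrankEq (by simp)
  let j : E × ℂ →L[ℂ] (Option (Fin (Module.finrank ℂ E)) → ℂ) :=
    ContinuousLinearMap.pi fun k => k.elim (ContinuousLinearMap.snd ℂ _ ℂ)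
      fun i => ((ContinuousLinearMap.proj i).comp e.toContinuousLinearMap).comp
        (ContinuousLinearMap.fst ℂ _ ℂ)
  let j' : (Option (Fin (Module.finrank ℂ E)) → ℂ) →L[ℂ] E × ℂ :=
    (e.symm.toContinuousLinearMap.comp
      (ContinuousLinearMap.pi fun i => ContinuousLinearMap.proj (some i))).prod
      (ContinuousLinearMap.proj none)
  have ha' : AnalyticAt ℂ (fun z => e (a (j' z))) 0 := by
    rw [← map_zero j'] at ha
    exact (e.toContinuousLinearMap.analyticAt _).fun_comp (ha.fun_comp (j'.analyticAt 0))
  obtain ⟨g, hg1, hg2, hg3⟩ := exists_flow_pi ha'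
  have hj : Tendsto j (𝓝 0) (𝓝 0) := by
    have := j.continuous.tendsto 0
    rwa [map_zero] at this
  have hg1' : AnalyticAt ℂ g (j 0) := by rwa [map_zero]
  refine ⟨fun z => e.symm (g (j z)),
    (e.symm.toContinuousLinearMap.analyticAt _).fun_comp (hg1'.fun_comp (j.analyticAt 0)), ?_, ?_⟩
  · filter_upwards [hj.eventually hg2] with z hz h0
    rw [hz (by simpa [j] using h0)]
    simp only [j]
    exact e.symm_apply_apply z.1
  · filter_upwards [hj.eventually hg3, hj.eventually hg1.eventually_analyticAt] with z hz hza
    have h1 : HasFDerivAt (fun z => e.symm (g (j z)))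
        (e.symm.toContinuousLinearMap.comp ((fderiv ℂ g (j z)).comp j)) z :=
      e.symm.toContinuousLinearMap.hasFDerivAt.comp z
        (hza.differentiableAt.hasFDerivAt.comp z j.hasFDerivAt)
    have h2 : j (0, 1) = Pi.single none 1 := by
      funext k
      cases k <;> simp [j]
    rw [h1.fderiv]
    simp only [ContinuousLinearMap.comp_apply, h2, hz]
    simp [j', j]

/-! ### Linearization of a vector field with a single nonzero eigenvalue. -/

namespace Wiener

variable {ι : Type*} [Fintype ι] [DecidableEq ι]

/-- The projection onto the power series of order at least two. -/
def highPart : Wiener ι →L[ℂ] Wiener ι := diag fun α => if 2 ≤ ∑ i, α i then 1 else 0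

/-- The coefficients of the inverse of `f ↦ a (∑ x_i ∂f/∂x_i - f)` on the power series of order at
least two. -/
def eulerCoeff (a : ℂ) (α : ι → ℕ) : ℂ :=
  if 2 ≤ ∑ i, α i then 1 / (a * ((∑ i, α i : ℕ) - 1)) else 0

/-- The inverse of `f ↦ a (∑ x_i ∂f/∂x_i - f)` on the power series of order at least two. -/
def eulerInv (a : ℂ) : Wiener ι →L[ℂ] Wiener ι := diag (eulerCoeff a)

/-- The operator `∂/∂x_j ∘ eulerInv a`. -/
def derivEulerInv (a : ℂ) (j : ι) : Wiener ι →L[ℂ] Wiener ι :=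
  lift fun α => (eulerCoeff a α * α j) • bshift j (mono α)

lemma norm_highPart_coeff (α : ι → ℕ) : ‖(if 2 ≤ ∑ i, α i then 1 else 0 : ℂ)‖ ≤ 1 := by
  split_ifs <;> simp

lemma highPart_mono (α : ι → ℕ) :
    highPart (mono α : Wiener ι) = if 2 ≤ ∑ i, α i then mono α else 0 := by
  rw [highPart, diag_mono norm_highPart_coeff]
  split_ifs <;> simp

lemma norm_sub_one_eq {n : ℕ} (hn : 2 ≤ n) : ‖((n : ℂ) - 1)‖ = n - 1 := by
  have h : ((n : ℂ) - 1) = ((n - 1 : ℕ) : ℂ) := by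
    rw [Nat.cast_sub (by omega)]; simp
  rw [h, Complex.norm_natCast, Nat.cast_sub (by omega)]
  simp

/-- For `|α| ≥ 2` one has `α j ≤ |α| ≤ 2(|α| - 1)`: the small divisors gain exactly the factor lost
by differentiating, so `derivEulerInv` is bounded. -/
lemma norm_eulerCoeff_mul_le (a : ℂ) (α : ι → ℕ) (j : ι) :
    ‖eulerCoeff a α * α j‖ ≤ 2 / ‖a‖ := by
  unfold eulerCoeff
  split_ifs with h
  · rw [norm_mul, norm_div, norm_one, norm_mul, norm_sub_one_eq h, Complex.norm_natCast,
      one_div, mul_inv, mul_assoc, div_eq_inv_mul]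
    refine mul_le_mul_of_nonneg_left ?_ (by positivity)
    have h1 : (α j : ℝ) ≤ (∑ i, α i : ℕ) := by
      exact_mod_cast Finset.single_le_sum (fun _ _ => Nat.zero_le _) (Finset.mem_univ j)
    have h2 : (2 : ℝ) ≤ (∑ i, α i : ℕ) := by exact_mod_cast h
    rw [inv_mul_le_iff₀ (by linarith)]
    linarith
  · rw [zero_mul, norm_zero]; positivity

lemma norm_eulerCoeff_le (a : ℂ) (α : ι → ℕ) : ‖eulerCoeff a α‖ ≤ 1 / ‖a‖ := by
  unfold eulerCoeff
  split_ifs with h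
  · rw [norm_div, norm_one, norm_mul, norm_sub_one_eq h,
      one_div, mul_inv, one_div]
    refine mul_le_of_le_one_right (by positivity) ?_
    have h2 : (2 : ℝ) ≤ (∑ i, α i : ℕ) := by exact_mod_cast h
    exact inv_le_one_of_one_le₀ (by linarith)
  · rw [norm_zero]; positivity

lemma eulerInv_mono (a : ℂ) (α : ι → ℕ) : eulerInv a (mono α) = eulerCoeff a α • mono α :=
  diag_mono (norm_eulerCoeff_le a) α

lemma norm_derivEulerInv_aux (a : ℂ) (j : ι) (α : ι → ℕ) :
    ‖(eulerCoeff a α * α j) • bshift j (mono α)‖ ≤ 2 / ‖a‖ := by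
  rw [norm_smul]
  refine (mul_le_of_le_one_right (norm_nonneg _) ?_).trans (norm_eulerCoeff_mul_le a α j)
  rw [bshift_mono]
  exact norm_bshift_aux j α

lemma derivEulerInv_mono (a : ℂ) (j : ι) (α : ι → ℕ) :
    derivEulerInv a j (mono α) = (eulerCoeff a α * α j) • bshift j (mono α) :=
  lift_mono (norm_derivEulerInv_aux a j) α

lemma eulerCoeff_of_lt {a : ℂ} {α : ι → ℕ} (h : ¬ 2 ≤ ∑ i, α i) : eulerCoeff a α = 0 := if_neg h

lemma highPart_highPart (f : Wiener ι) : highPart (highPart f) = highPart f := by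
  have key : (highPart : Wiener ι →L[ℂ] Wiener ι).comp highPart = highPart := ext_mono fun α => by
    rw [ContinuousLinearMap.comp_apply, highPart_mono]
    split_ifs with h
    · rw [highPart_mono, if_pos h]
    · rw [map_zero]
  exact DFunLike.congr_fun key f

lemma highPart_eulerInv (a : ℂ) (f : Wiener ι) : highPart (eulerInv a f) = eulerInv a f := by
  have key : (highPart : Wiener ι →L[ℂ] Wiener ι).comp (eulerInv a) = eulerInv a :=
    ext_mono fun α => by
      rw [ContinuousLinearMap.comp_apply, eulerInv_mono, map_smul, highPart_mono]
      split_ifs with h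
      · rfl
      · rw [eulerCoeff_of_lt h, zero_smul, zero_smul]
  exact DFunLike.congr_fun key f

lemma highPart_X_mul_derivEulerInv (a : ℂ) (j k : ι) (f : Wiener ι) :
    highPart (X k * derivEulerInv a j f) = X k * derivEulerInv a j f := by
  have key : (highPart : Wiener ι →L[ℂ] Wiener ι).comp ((mulL (X k)).comp (derivEulerInv a j)) =
      (mulL (X k)).comp (derivEulerInv a j) := ext_mono fun α => by
    change highPart (X k * derivEulerInv a j (mono α)) = X k * derivEulerInv a j (mono α)
    rw [derivEulerInv_mono]
    by_cases h : α j = 0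
    · simp [h]
    · obtain ⟨β, rfl⟩ := exists_eq_single_add h
      rw [bshift_mono_add, mul_smul_comm, X_mul_mono, map_smul, highPart_mono]
      split_ifs with h2
      · rfl
      · rw [eulerCoeff_of_lt, zero_mul, zero_smul, zero_smul]
        simpa [Finset.sum_add_distrib] using h2
  exact DFunLike.congr_fun key f

lemma ev_zero_eulerInv (a : ℂ) (f : Wiener ι) : ev 0 (eulerInv a f) = 0 := by
  have key : (ev 0).comp (eulerInv a) = (0 : Wiener ι →L[ℂ] ℂ) := ext_mono fun α => by
    rw [ContinuousLinearMap.comp_apply, eulerInv_mono, map_smul, ← coeffL_zero_eq_ev, coeffL_mono]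
    split_ifs with h
    · rw [eulerCoeff_of_lt (by simp [h]), zero_smul]; rfl
    · simp
  exact DFunLike.congr_fun key f

/-- On a monomial the field `a z` acts by `a |α| = a (|α| - 1) + a`. After `eulerInv`, the first
summand gives `highPart` and the second `a • eulerInv`. The linear field `B` contributes the double
sum, bounded because of `derivEulerInv`. -/
lemma fderiv_ev_eulerInv {z : ι → ℂ} (hz : ‖z‖ < 1) {a : ℂ} (ha : a ≠ 0) (B : ι → ι → ℂ)
    (f : Wiener ι) :
    fderiv ℂ ev z (fun i => a * z i + ∑ k, B i k * z k) (eulerInv a f) =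
      ev z (highPart f) + a * ev z (eulerInv a f) +
        ∑ j, ∑ k, B j k * (z k * ev z (derivEulerInv a j f)) := by
  have key : (fderiv ℂ ev z (fun i => a * z i + ∑ k, B i k * z k)).comp (eulerInv a) =
      (ev z).comp highPart + a • (ev z).comp (eulerInv a) +
        ∑ j, ∑ k, B j k • (z k • (ev z).comp (derivEulerInv a j)) := ext_mono fun α => by
    simp only [ContinuousLinearMap.comp_apply, add_apply, smul_apply, sum_apply, smul_eq_mul,
      eulerInv_mono, derivEulerInv_mono, map_smul, fderiv_ev_mono hz]
    have h1 : ∀ i, (a * z i + ∑ k, B i k * z k) * ((α i : ℂ) * ev z (bshift i (mono α))) =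
        a * ((α i : ℂ) * ev z (mono α)) +
          ∑ k, B i k * (z k * ((α i : ℂ) * ev z (bshift i (mono α)))) := by
      intro i
      rw [add_mul, ← mul_ev_bshift_mono hz.le, Finset.sum_mul]
      congr 1
      · ring
      · exact Finset.sum_congr rfl fun k _ => by ring
    rw [Finset.sum_congr rfl fun i _ => h1 i, Finset.sum_add_distrib, mul_add]
    congr 1
    · rw [← Finset.mul_sum, ← Finset.sum_mul, highPart_mono]
      unfold eulerCoeff
      split_ifs with h
      · have h2 : ((∑ i, α i : ℕ) : ℂ) - 1 ≠ 0 := by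
          rw [← norm_ne_zero_iff, norm_sub_one_eq h]
          have : (2 : ℝ) ≤ (∑ i, α i : ℕ) := by exact_mod_cast h
          linarith
        rw [← Nat.cast_sum]
        field_simp
        ring
      · simp
    · rw [Finset.mul_sum]
      refine Finset.sum_congr rfl fun j _ => ?_
      rw [Finset.mul_sum]
      exact Finset.sum_congr rfl fun k _ => by ring
  have := DFunLike.congr_fun key f
  simpa only [ContinuousLinearMap.comp_apply, add_apply, smul_apply, sum_apply, smul_eq_mul]
    using this

lemma coeffL_single_eq_fderiv_ev (j : ι) (f : Wiener ι) :
    coeffL (Pi.single j 1) f = fderiv ℂ ev 0 (Pi.single j 1) f := by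
  have key : (coeffL (Pi.single j 1) : Wiener ι →L[ℂ] ℂ) = fderiv ℂ ev 0 (Pi.single j 1) :=
    ext_mono fun α => by
      rw [fderiv_ev_mono (by simp), Finset.sum_eq_single j (fun i _ hi => by simp [hi]) (by simp),
        ← coeffL_zero_eq_ev, coeffL_bshift, add_zero, coeffL_mono]
      split_ifs with h
      · simp [h]
      · simp
  exact DFunLike.congr_fun key f

lemma highPart_eq_self {f : Wiener ι} (h0 : ev 0 f = 0)
    (h1 : ∀ j, fderiv ℂ ev 0 (Pi.single j 1) f = 0) : highPart f = f := by
  have hs := (hasSum_mono f).mapL highPart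
  refine hs.unique ?_
  have : (fun α => highPart (coeff f α • mono α : Wiener ι)) = fun α => coeff f α • mono α := by
    funext α
    rw [map_smul, highPart_mono]
    split_ifs with h
    · rfl
    · have hc : coeff f α = 0 := by
        rw [← coeffL_apply]
        by_cases hα : α = 0
        · rw [hα, coeffL_zero_eq_ev, h0]
        · obtain ⟨j, hj⟩ := Function.ne_iff.1 hα
          obtain ⟨β, rfl⟩ := exists_eq_single_add hj
          have hβ : β = 0 := by
            funext i
            simp only [Pi.add_apply, Finset.sum_add_distrib, Finset.sum_pi_single',
              Finset.mem_univ, if_true] at h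
            have := Finset.single_le_sum (f := β) (fun _ _ => Nat.zero_le _) (Finset.mem_univ i)
            simp only [Pi.zero_apply]
            have h3 : ∑ x, (Pi.single j 1 : ι → ℕ) x = 1 := by simp
            omega
          rw [hβ, add_zero, coeffL_single_eq_fderiv_ev, h1]
      rw [hc, zero_smul, zero_smul]
  rw [this]
  exact hasSum_mono f

end Wiener

open Wiener

variable {ι : Type*} [Fintype ι] [DecidableEq ι]

/-- The operator which describes the action of the linear vector field `B` in the linearization
problem. -/
def nilpotentOp (a : ℂ) (B : ι → ι → ℂ) : (ι → Wiener ι) →L[ℂ] (ι → Wiener ι) :=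
  ContinuousLinearMap.pi fun i =>
    (∑ j, ∑ k, B j k • ((mulL (Wiener.X k)).comp (derivEulerInv a j)).comp
      (ContinuousLinearMap.proj i)) -
    ∑ k, B i k • (eulerInv a).comp (ContinuousLinearMap.proj k)

lemma nilpotentOp_apply (a : ℂ) (B : ι → ι → ℂ) (g : ι → Wiener ι) (i : ι) :
    nilpotentOp a B g i = (∑ j, ∑ k, B j k • (Wiener.X k * derivEulerInv a j (g i))) -
      ∑ k, B i k • eulerInv a (g k) := by
  simp only [nilpotentOp, ContinuousLinearMap.coe_pi', sub_apply, sum_apply, smul_apply,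
    ContinuousLinearMap.comp_apply, ContinuousLinearMap.proj_apply]
  rfl

lemma norm_nilpotentOp_le (a : ℂ) (B : ι → ι → ℂ) :
    ‖nilpotentOp a B‖ ≤ (∑ j, ∑ k, ‖B j k‖) * (3 / ‖a‖) := by
  refine ContinuousLinearMap.opNorm_le_bound _ (by positivity) fun g => ?_
  refine (pi_norm_le_iff_of_nonneg (by positivity)).2 fun i => ?_
  rw [nilpotentOp_apply]
  have h1 : ‖∑ j, ∑ k, B j k • (Wiener.X k * derivEulerInv a j (g i))‖ ≤
      (∑ j, ∑ k, ‖B j k‖) * (2 / ‖a‖ * ‖g‖) := by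
    rw [Finset.sum_mul]
    refine (norm_sum_le _ _).trans (Finset.sum_le_sum fun j _ => ?_)
    rw [Finset.sum_mul]
    refine (norm_sum_le _ _).trans (Finset.sum_le_sum fun k _ => ?_)
    rw [norm_smul]
    refine mul_le_mul_of_nonneg_left ?_ (norm_nonneg _)
    calc ‖Wiener.X k * derivEulerInv a j (g i)‖ ≤ ‖(Wiener.X k : Wiener ι)‖ * ‖derivEulerInv a j (g i)‖ :=
          norm_mul_le _ _
      _ = ‖derivEulerInv a j (g i)‖ := by rw [norm_X, one_mul]
      _ ≤ 2 / ‖a‖ * ‖g i‖ := ((derivEulerInv a j).le_opNorm _).trans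
          (mul_le_mul_of_nonneg_right (norm_lift_le (norm_derivEulerInv_aux a j)) (norm_nonneg _))
      _ ≤ 2 / ‖a‖ * ‖g‖ := mul_le_mul_of_nonneg_left (norm_le_pi_norm g i) (by positivity)
  have h2 : ‖∑ k, B i k • eulerInv a (g k)‖ ≤ (∑ j, ∑ k, ‖B j k‖) * (1 / ‖a‖ * ‖g‖) := by
    have h3 : ∑ k, ‖B i k‖ ≤ ∑ j, ∑ k, ‖B j k‖ :=
      Finset.single_le_sum (f := fun j => ∑ k, ‖B j k‖)
        (fun j _ => Finset.sum_nonneg fun k _ => norm_nonneg _) (Finset.mem_univ i)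
    refine le_trans ?_ (mul_le_mul_of_nonneg_right h3 (by positivity))
    rw [Finset.sum_mul]
    refine (norm_sum_le _ _).trans (Finset.sum_le_sum fun k _ => ?_)
    rw [norm_smul]
    refine mul_le_mul_of_nonneg_left ?_ (norm_nonneg _)
    exact ((eulerInv a).le_opNorm _).trans (mul_le_mul (norm_diag_le (norm_eulerCoeff_le a))
      (norm_le_pi_norm g k) (norm_nonneg _) (by positivity))
  refine (norm_sub_le _ _).trans ((add_le_add h1 h2).trans (le_of_eq ?_))
  ring

/-- Linearization of a vector field whose linear part is close to a homothety. -/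
theorem exists_linearization_of_small {Y : (ι → ℂ) → ι → ℂ} (hY : AnalyticAt ℂ Y 0)
    (hY0 : Y 0 = 0) {a : ℂ} (ha : a ≠ 0) {B : ι → ι → ℂ}
    (hB : (∑ j, ∑ k, ‖B j k‖) * (3 / ‖a‖) < 1)
    (hYB : ∀ z i, fderiv ℂ Y 0 z i = a * z i + ∑ k, B i k * z k) :
    ∃ (ψ : (ι → ℂ) → ι → ℂ) (ρ : ℂ), ρ ≠ 0 ∧ AnalyticAt ℂ ψ 0 ∧ ψ 0 = 0 ∧
      fderiv ℂ ψ 0 = ρ • ContinuousLinearMap.id ℂ _ ∧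
      ∀ᶠ z in 𝓝 0, fderiv ℂ ψ z (fun i => a * z i + ∑ k, B i k * z k) = Y (ψ z) := by
  let f : ι → (ι → ℂ) → ℂ := fun i z => Y z i - fderiv ℂ Y 0 z i
  have hfa : ∀ i, AnalyticAt ℂ (f i) 0 := fun i => by
    have h1 : AnalyticAt ℂ (fun z => Y z i) 0 :=
      ((ContinuousLinearMap.proj i : (ι → ℂ) →L[ℂ] ℂ).analyticAt _).fun_comp hY
    have h2 : AnalyticAt ℂ (fun z => fderiv ℂ Y 0 z i) 0 :=
      ((ContinuousLinearMap.proj i : (ι → ℂ) →L[ℂ] ℂ).comp (fderiv ℂ Y 0)).analyticAt _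
    exact h1.sub h2
  have hf0 : ∀ i, f i 0 = 0 := fun i => by simp [f, hY0]
  have hfd : ∀ i, HasFDerivAt (f i) (0 : (ι → ℂ) →L[ℂ] ℂ) 0 := fun i => by
    have h1 := (hasFDerivAt_pi'.1 hY.differentiableAt.hasFDerivAt) i
    have h2 := h1.sub ((ContinuousLinearMap.proj i : (ι → ℂ) →L[ℂ] ℂ).comp
      (fderiv ℂ Y 0)).hasFDerivAt
    rw [sub_self] at h2
    exact h2
  choose A hA1 hA2 hA3 hA4 using fun i => exists_extension (κ := ι) (hfa i)
  -- The conjugacy is sought as `ψ = ρ x + eulerInv a g`, with `g` the unknown and the homothety `ρ`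
  -- the parameter.
  let e : (ι → Wiener ι) × ℂ →L[ℂ] (ι → Wiener ι) := ContinuousLinearMap.pi fun i =>
    (ContinuousLinearMap.snd ℂ _ ℂ).smulRight (Wiener.X i) +
      (eulerInv a).comp ((ContinuousLinearMap.proj i).comp (ContinuousLinearMap.fst ℂ _ ℂ))
  have he : ∀ p i, e p i = p.2 • Wiener.X i + eulerInv a (p.1 i) := fun p i => by simp [e]
  let H : (ι → Wiener ι) × ℂ → ι → Wiener ι := fun p i => highPart (A i (e p))
  have hH : HasStrictFDerivAt H (0 : (ι → Wiener ι) × ℂ →L[ℂ] (ι → Wiener ι)) 0 := by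
    refine hasStrictFDerivAt_pi'.2 fun i => ?_
    have h1 := hA3 i (hfd i)
    rw [← map_zero e] at h1
    have h2 := highPart.hasStrictFDerivAt.comp (0 : (ι → Wiener ι) × ℂ)
      (h1.comp (0 : (ι → Wiener ι) × ℂ) e.hasStrictFDerivAt)
    convert h2 using 1
    ext <;> simp
  have hH0 : H 0 = 0 := by
    funext i
    simp only [H, map_zero, hA2 i (hf0 i), Pi.zero_apply]
  -- Cancelling the linear terms in `Dψ(az + Bz) = Y(ψ)` leaves `g + nilpotentOp a B g = f(ψ)`,
  -- where `f` is the part of `Y` of order at least two. The right side has zero derivative at the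
  -- origin, and the left side is invertible because `B` is small.
  let L : (ι → Wiener ι) × ℂ →L[ℂ] (ι → Wiener ι) :=
    (ContinuousLinearMap.id ℂ _ + nilpotentOp a B).comp (ContinuousLinearMap.fst ℂ _ ℂ)
  have hΦ : HasStrictFDerivAt (fun p => L p - H p) (L - 0) 0 := L.hasStrictFDerivAt.sub hH
  have hsurj : ∀ w : ι → Wiener ι, ∃ u, (L - 0) (u, (0 : ℂ)) = w := by
    intro w
    have hu : IsUnit (1 - -(nilpotentOp a B)) := isUnit_one_sub_of_norm_lt_one (by
      rw [norm_neg]; exact (norm_nilpotentOp_le a B).trans_lt hB)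
    refine ⟨Ring.inverse (1 - -(nilpotentOp a B)) w, ?_⟩
    have := DFunLike.congr_fun (Ring.mul_inverse_cancel _ hu) w
    rw [sub_neg_eq_add] at this ⊢
    rw [sub_zero]
    exact this
  have hQ : ∀ᶠ p in 𝓝 (0 : (ι → Wiener ι) × ℂ), ∀ i, ∀ z : ι → ℂ, ‖z‖ ≤ 1 →
      ev z (A i (e p)) = f i (fun k => ev z (e p k)) := by
    refine eventually_all.2 fun i => ?_
    have := e.continuous.tendsto 0
    rw [map_zero] at this
    exact this.eventually (hA4 i)
  have hsol := eventually_exists_of_surj hΦ (by simp [hH0]) hsurj hQ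
  obtain ⟨ρ, ⟨g, hg, hgQ⟩, hρ⟩ := ((hsol.filter_mono nhdsWithin_le_nhds).and
    (self_mem_nhdsWithin (s := {(0 : ℂ)}ᶜ))).exists
  have hρ0 : ρ ≠ 0 := hρ
  have hgi : ∀ i, g i + ((∑ j, ∑ k, B j k • (Wiener.X k * derivEulerInv a j (g i))) -
      ∑ k, B i k • eulerInv a (g k)) = highPart (A i (e (g, ρ))) := fun i => by
    have := congrFun (sub_eq_zero.1 hg) i
    rw [← nilpotentOp_apply]
    exact this
  -- All terms of the equation other than `g` are fixed by `highPart`, hence so is `g`.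
  have hghigh : ∀ i, highPart (g i) = g i := fun i => by
    have h1 := congrArg highPart (hgi i)
    rw [highPart_highPart, ← hgi i] at h1
    simp only [map_add, map_sub, map_sum, map_smul, highPart_eulerInv,
      highPart_X_mul_derivEulerInv] at h1
    exact add_right_cancel h1
  let ψ : (ι → ℂ) → ι → ℂ := fun z i => ev z (e (g, ρ) i)
  have hψi : ∀ z : ι → ℂ, ‖z‖ ≤ 1 → ∀ i, ψ z i = ρ * z i + ev z (eulerInv a (g i)) :=
    fun z hz i => by simp only [ψ, he, map_add, map_smul, ev_X hz, smul_eq_mul]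
  have hψ0 : ψ 0 = 0 := by
    funext i
    rw [hψi 0 (by simp), ev_zero_eulerInv]
    simp
  have hψd : ∀ z : ι → ℂ, ‖z‖ < 1 → ∀ v i, fderiv ℂ ψ z v i =
      ρ * v i + fderiv ℂ ev z v (eulerInv a (g i)) := by
    intro z hz v i
    have h1 := hasFDerivAt_pi.2 fun i => hasFDerivAt_ev_apply hz (e (g, ρ) i)
    rw [show fderiv ℂ ψ z = _ from h1.fderiv]
    change fderiv ℂ ev z v (e (g, ρ) i) = _
    rw [he, map_add, map_smul, smul_eq_mul, Wiener.X, fderiv_ev_mono hz, Finset.sum_eq_single i (fun j _ hj => by simp [hj]) (by simp),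
      ← add_zero (Pi.single i 1 : ι → ℕ), bshift_mono_add, ← one_def, ev_one hz.le]
    simp
  have hψa : ∀ z : ι → ℂ, ‖z‖ < 1 → AnalyticAt ℂ ψ z := fun z hz =>
    AnalyticAt.pi fun i => analyticAt_ev_apply hz _
  have hψd0 : fderiv ℂ ψ 0 = ρ • ContinuousLinearMap.id ℂ _ := by
    refine ContinuousLinearMap.ext fun v => funext fun i => ?_
    have h0 : fderiv ℂ ev 0 v (eulerInv a (g i)) = 0 := by
      have key : (fderiv ℂ ev 0 v).comp (eulerInv a) = (0 : Wiener ι →L[ℂ] ℂ) :=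
        ext_mono fun α => by
          rw [ContinuousLinearMap.comp_apply, eulerInv_mono, map_smul, fderiv_ev_mono (by simp)]
          by_cases h : 2 ≤ ∑ i, α i
          · rw [Finset.sum_eq_zero, smul_zero]
            · rfl
            intro j _
            rw [← coeffL_zero_eq_ev, coeffL_bshift, add_zero, coeffL_mono, if_neg]
            · simp
            · rintro rfl
              simp at h
          · rw [eulerCoeff_of_lt h, zero_smul]; rfl
      exact DFunLike.congr_fun key (g i)
    rw [hψd 0 (by simp), h0]
    simp
  refine ⟨ψ, ρ, hρ0, hψa 0 (by simp), hψ0, hψd0, ?_⟩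
  filter_upwards [eventually_norm_lt_one] with z hz
  funext i
  -- The projection in the equation changes nothing: `f ∘ ψ` vanishes to order two, since `f` does
  -- and `ψ` fixes the origin.
  have hfh : highPart (A i (e (g, ρ))) = A i (e (g, ρ)) := by
    refine highPart_eq_self ?_ fun j => ?_
    · rw [hgQ i 0 (by simp)]
      change f i (ψ 0) = 0
      rw [hψ0, hf0]
    · have h1 := (hasFDerivAt_ev_apply (z := (0 : ι → ℂ)) (by simp) (A i (e (g, ρ))))
      have h2 : HasFDerivAt (fun w => f i (ψ w)) ((0 : (ι → ℂ) →L[ℂ] ℂ).comp (fderiv ℂ ψ 0)) 0 := by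
        have h3 := hfd i
        rw [← hψ0] at h3
        exact h3.comp (0 : ι → ℂ) (hψa 0 (by simp)).differentiableAt.hasFDerivAt
      have h4 : (fun w => ev w (A i (e (g, ρ)))) =ᶠ[𝓝 0] fun w => f i (ψ w) :=
        eventually_norm_lt_one.mono fun w hw => hgQ i w hw.le
      have h5 := DFunLike.congr_fun (h1.unique (h2.congr_of_eventuallyEq h4)) (Pi.single j 1)
      simpa using h5
  have h6 := congrArg (ev z) (hgi i)
  rw [hfh, hgQ i z hz.le] at h6
  simp only [map_add, map_sub, map_sum, map_smul, ev_mul hz.le, ev_X hz.le, smul_eq_mul] at h6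
  rw [hψd z hz, fderiv_ev_eulerInv hz ha, hghigh]
  have h7 : Y (ψ z) i = f i (ψ z) + (a * ψ z i + ∑ k, B i k * ψ z k) := by
    simp only [f, hYB]; ring
  have h8 : f i (ψ z) = f i (fun k => ev z (e (g, ρ) k)) := rfl
  have h9 : ∑ k, B i k * ψ z k =
      ρ * ∑ k, B i k * z k + ∑ k, B i k * ev z (eulerInv a (g k)) := by
    rw [Finset.mul_sum, ← Finset.sum_add_distrib]
    refine Finset.sum_congr rfl fun k _ => ?_
    rw [hψi z hz.le k]
    ring
  rw [h7, h8, ← h6, h9, hψi z hz.le i]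
  ring

/-- A nilpotent endomorphism is conjugate to endomorphisms with arbitrarily small coefficients. -/
theorem exists_conj_small {m : ℕ} {B : (Fin m → ℂ) →ₗ[ℂ] (Fin m → ℂ)} (hB : IsNilpotent B)
    {ε : ℝ} (hε : 0 < ε) :
    ∃ S : (Fin m → ℂ) ≃L[ℂ] (Fin m → ℂ),
      ∀ i j, ‖S.symm (B (S (Pi.single j 1))) i‖ ≤ ε := by
  obtain ⟨r, hr⟩ := hB
  let e := (WithLp.linearEquiv 2 ℂ (Fin m → ℂ))
  -- `J` realizes the adapted norm with square `∑ ε^(-2j) ‖B^j v‖²`. Applying `B` shifts the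
  -- summands by one place and gains `ε`, the last summand disappearing as `B ^ r = 0`.
  let J : (Fin m → ℂ) →ₗ[ℂ] PiLp 2 fun _ : Fin (r + 1) => EuclideanSpace ℂ (Fin m) :=
    (WithLp.linearEquiv 2 ℂ (Fin (r + 1) → EuclideanSpace ℂ (Fin m))).symm.toLinearMap ∘ₗ
      LinearMap.pi fun j => ((ε⁻¹ : ℝ) : ℂ) ^ (j : ℕ) • (e.symm.toLinearMap ∘ₗ B ^ (j : ℕ))
  have hJ : ∀ v j, J v j = ((ε⁻¹ : ℝ) : ℂ) ^ (j : ℕ) • e.symm ((B ^ (j : ℕ)) v) := fun v j => rfl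
  have hJinj : Function.Injective J := by
    intro v w hvw
    have h := congrArg (fun x => x 0) hvw
    simp only [hJ] at h
    simpa using h
  have hJB : ∀ v, ‖J (B v)‖ ≤ ε * ‖J v‖ := by
    intro v
    refine le_of_sq_le_sq ?_ (by positivity)
    rw [mul_pow, PiLp.norm_sq_eq_of_L2, PiLp.norm_sq_eq_of_L2, Fin.sum_univ_castSucc,
      Fin.sum_univ_succ, mul_add, Finset.mul_sum]
    have h0 : J (B v) (Fin.last r) = 0 := by
      rw [hJ, Fin.val_last, hr]; simp
    rw [h0, norm_zero, zero_pow two_ne_zero, add_zero]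
    refine le_add_of_nonneg_of_le (by positivity) (Finset.sum_le_sum fun j _ => le_of_eq ?_)
    rw [hJ, hJ, Fin.val_castSucc, Fin.val_succ, norm_smul, norm_smul, ← Module.End.mul_apply,
      ← pow_succ, pow_succ' (((ε⁻¹ : ℝ) : ℂ)), norm_mul, Complex.norm_real, norm_inv,
      Real.norm_of_nonneg hε.le]
    field_simp
  let W := LinearMap.range J
  have hW : Module.finrank ℂ W = m := by
    rw [LinearMap.finrank_range_of_inj hJinj]; simp
  -- In a basis orthonormal for the adapted norm, matrix entries are bounded by the operator norm,
  -- which is at most `ε`.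
  let b : OrthonormalBasis (Fin m) ℂ W := (stdOrthonormalBasis ℂ W).reindex (finCongr hW)
  let S : (Fin m → ℂ) ≃ₗ[ℂ] (Fin m → ℂ) :=
    (e.symm.trans b.repr.toLinearEquiv.symm).trans (LinearEquiv.ofInjective J hJinj).symm
  refine ⟨S.toContinuousLinearEquiv, fun i j => ?_⟩
  change ‖b.repr (LinearEquiv.ofInjective J hJinj (B (S (Pi.single j 1)))) i‖ ≤ ε
  refine (PiLp.norm_apply_le _ i).trans ?_
  rw [LinearIsometryEquiv.norm_map]
  change ‖J (B (S (Pi.single j 1)))‖ ≤ ε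
  refine (hJB _).trans ?_
  have h1 : (LinearEquiv.ofInjective J hJinj) (S (Pi.single j 1)) =
      b.repr.symm (e.symm (Pi.single j 1)) :=
    (LinearEquiv.ofInjective J hJinj).apply_symm_apply _
  have h2 : ‖J (S (Pi.single j 1))‖ = 1 := by
    change ‖((LinearEquiv.ofInjective J hJinj) (S (Pi.single j 1)))‖ = 1
    rw [h1, LinearIsometryEquiv.norm_map]
    change ‖EuclideanSpace.single j (1 : ℂ)‖ = 1
    simp
  rw [h2, mul_one]

/-- **Poincaré linearization theorem** for a vector field whose linear part has a single nonzero
eigenvalue. -/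
theorem exists_linearization {m : ℕ} {Y : (Fin m → ℂ) → Fin m → ℂ} (hY : AnalyticAt ℂ Y 0)
    (hY0 : Y 0 = 0) {a : ℂ} (ha : a ≠ 0)
    (hnil : IsNilpotent ((fderiv ℂ Y 0 : (Fin m → ℂ) →ₗ[ℂ] (Fin m → ℂ)) - a • LinearMap.id)) :
    ∃ (ψ : (Fin m → ℂ) → Fin m → ℂ) (T : (Fin m → ℂ) ≃L[ℂ] (Fin m → ℂ))
      (B : (Fin m → ℂ) →L[ℂ] (Fin m → ℂ)), AnalyticAt ℂ ψ 0 ∧ ψ 0 = 0 ∧ fderiv ℂ ψ 0 = T ∧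
      IsNilpotent B ∧ ∀ᶠ z in 𝓝 0, fderiv ℂ ψ z (a • z + B z) = Y (ψ z) := by
  obtain ⟨ε, hε, hε1⟩ : ∃ ε : ℝ, 0 < ε ∧ (∑ _j : Fin m, ∑ _k : Fin m, ε) * (3 / ‖a‖) < 1 := by
    have ha' := norm_pos_iff.2 ha
    have h0 : Tendsto (fun ε : ℝ => (∑ _j : Fin m, ∑ _k : Fin m, ε) * (3 / ‖a‖)) (𝓝[>] 0) (𝓝 0) := by
      have : Continuous fun ε : ℝ => (∑ _j : Fin m, ∑ _k : Fin m, ε) * (3 / ‖a‖) := by fun_prop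
      have h := this.tendsto 0
      simp only [Finset.sum_const_zero, zero_mul] at h
      exact h.mono_left nhdsWithin_le_nhds
    obtain ⟨ε, h1, h2⟩ := ((h0.eventually (gt_mem_nhds one_pos)).and self_mem_nhdsWithin).exists
    exact ⟨ε, h2, h1⟩
  set N := (fderiv ℂ Y 0 : (Fin m → ℂ) →ₗ[ℂ] (Fin m → ℂ)) - a • LinearMap.id with hN
  obtain ⟨S, hS⟩ := exists_conj_small hnil hε
  let BL : (Fin m → ℂ) →L[ℂ] (Fin m → ℂ) :=
    S.symm.toContinuousLinearMap.comp ((LinearMap.toContinuousLinearMap N).comp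
      S.toContinuousLinearMap)
  have hBL : ∀ z, BL z = S.symm (N (S z)) := fun z => rfl
  have hBLsum : ∀ z i, BL z i = ∑ k, BL (Pi.single k 1) i * z k := by
    intro z i
    conv_lhs => rw [← Finset.univ_sum_single z]
    rw [map_sum, Finset.sum_apply]
    refine Finset.sum_congr rfl fun k _ => ?_
    have : (Pi.single k (z k) : Fin m → ℂ) = z k • Pi.single k 1 := by
      rw [← Pi.single_smul]; simp
    rw [this, map_smul]
    simp [mul_comm]
  have hBLnil : IsNilpotent BL := by
    obtain ⟨r, hr⟩ := hnil
    refine ⟨r, ?_⟩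
    have h : ∀ k z, (BL ^ k) z = S.symm ((N ^ k) (S z)) := by
      intro k
      induction k with
      | zero => intro z; simp
      | succ k ih =>
        intro z
        rw [pow_succ, mul_apply_eq_comp, ih, hBL, pow_succ, Module.End.mul_apply]
        simp
    refine ContinuousLinearMap.ext fun z => ?_
    rw [h, hr]
    simp
  have hSY : HasFDerivAt (fun z => S.symm (Y (S z)))
      (S.symm.toContinuousLinearMap.comp ((fderiv ℂ Y 0).comp S.toContinuousLinearMap)) 0 := by
    have h1 : HasFDerivAt Y (fderiv ℂ Y 0) (S 0) := by
      rw [map_zero]; exact hY.differentiableAt.hasFDerivAt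
    exact S.symm.toContinuousLinearMap.hasFDerivAt.comp (0 : Fin m → ℂ)
      (h1.comp (0 : Fin m → ℂ) S.toContinuousLinearMap.hasFDerivAt)
  have hSYa : AnalyticAt ℂ (fun z => S.symm (Y (S z))) 0 := by
    have h1 : AnalyticAt ℂ Y (S 0) := by rwa [map_zero]
    exact (S.symm.toContinuousLinearMap.analyticAt _).fun_comp
      (h1.fun_comp (S.toContinuousLinearMap.analyticAt _))
  obtain ⟨ψ, ρ, hρ, hψa, hψ0, hψd, hψ⟩ := exists_linearization_of_small hSYa
    (by simp [hY0]) ha (B := fun i k => BL (Pi.single k 1) i) (by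
      refine lt_of_le_of_lt ?_ hε1
      refine mul_le_mul_of_nonneg_right ?_ (by positivity)
      exact Finset.sum_le_sum fun i _ => Finset.sum_le_sum fun j _ => hS i j) (by
      intro z i
      rw [hSY.fderiv, ← hBLsum, hBL, hN]
      simp)
  have hψ' : ∀ z, DifferentiableAt ℂ ψ z → HasFDerivAt (fun z => S (ψ z))
      (S.toContinuousLinearMap.comp (fderiv ℂ ψ z)) z := fun z hz =>
    S.toContinuousLinearMap.hasFDerivAt.comp z hz.hasFDerivAt
  -- The derivative at 0 is `ρ S`: the linear conjugation making the nilpotent part small, after the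
  -- homothety of the small case.
  refine ⟨fun z => S (ψ z), (ContinuousLinearEquiv.smulLeft (Units.mk0 ρ hρ)).trans S, BL,
    (S.toContinuousLinearMap.analyticAt _).fun_comp hψa, by simp [hψ0], ?_, hBLnil, ?_⟩
  · rw [(hψ' 0 hψa.differentiableAt).fderiv, hψd]
    ext z i
    simp [Units.smul_def]
  · filter_upwards [hψ, hψa.eventually_analyticAt] with z hz hza
    rw [(hψ' z hza.differentiableAt).fderiv, ContinuousLinearMap.comp_apply]
    have h1 : a • z + BL z = fun i => a * z i + ∑ k, BL (Pi.single k 1) i * z k := by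
      funext i
      rw [← hBLsum]
      simp
    rw [h1, hz]
    simp

/-! ### Koszul exactness on bivectors, with bounded homotopies and under perturbation. -/

section Koszul

variable {𝒜 : Type*} [NormedCommRing 𝒜] [NormedAlgebra ℂ 𝒜] {m : ℕ}

/-- The exterior product of a vector and a bivector. -/
def wedgeBi (X : Fin m → 𝒜) (B : Fin m → Fin m → 𝒜) (i j k : Fin m) : 𝒜 :=
  X i * B j k + X j * B k i + X k * B i j

/-- The operator `a ↦ a - f D(a)`. -/
def remOp (f : 𝒜) (D : 𝒜 →L[ℂ] 𝒜) : 𝒜 →L[ℂ] 𝒜 :=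
  ContinuousLinearMap.id ℂ 𝒜 - (ContinuousLinearMap.mul ℂ 𝒜 f).comp D

lemma remOp_apply (f : 𝒜) (D : 𝒜 →L[ℂ] 𝒜) (a : 𝒜) : remOp f D a = a - f * D a := rfl

/-- Homotopy operator of the Koszul complex from bivectors to vectors. -/
def koszulS (P g1 g2 : Fin m → 𝒜) (f1 : 𝒜) (D1 D2 : 𝒜 →L[ℂ] 𝒜) :
    (Fin m → Fin m → 𝒜) →L[ℂ] (Fin m → 𝒜) where
  toFun B j := D1 (∑ i, g1 i * B i j -
    P j * D2 (remOp f1 D1 (∑ k, g2 k * ∑ i, g1 i * B i k)))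
  map_add' A B := by
    funext j
    simp only [Pi.add_apply, mul_add, Finset.sum_add_distrib, map_add, map_sub]
    ring
  map_smul' c B := by
    funext j
    simp only [Pi.smul_apply, mul_smul_comm, ← Finset.smul_sum, map_smul, ← smul_sub,
      RingHom.id_apply]
  cont := by fun_prop

/-- Homotopy operator of the Koszul complex from trivectors to bivectors. -/
def koszulH (P g1 g2 g3 : Fin m → 𝒜) (f1 f2 : 𝒜) (D1 D2 D3 : 𝒜 →L[ℂ] 𝒜) :
    (Fin m → Fin m → Fin m → 𝒜) →L[ℂ] (Fin m → Fin m → 𝒜) where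
  toFun G j k :=
    let G1 := fun j k => ∑ i, g1 i * G i j k
    let r := -D3 (remOp f2 D2 (remOp f1 D1 (∑ j, ∑ k, g3 j * (g2 k * G1 j k))))
    let ρ := fun j => D2 (remOp f1 D1 (P j * r + ∑ k, g2 k * G1 j k))
    D1 (P j * ρ k - P k * ρ j + G1 j k)
  map_add' A B := by
    funext j k
    simp only [Pi.add_apply, mul_add, Finset.sum_add_distrib, map_add, neg_add]
    simp only [← map_add]
    congr 1
    ring
  map_smul' c B := by
    funext j k
    simp only [Pi.smul_apply, mul_smul_comm, ← Finset.smul_sum, map_smul, ← smul_sub, ← smul_neg,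
      ← smul_add, RingHom.id_apply]
  cont := by fun_prop

/-- The ideal generated by `P` contains `f1, f2, f3`, a regular sequence made explicit by the left
inverses `Di`. Depth three gives exactness on bivectors, and the usual chase stays bounded and
linear: `remOp f D` is the projection with kernel the multiples of `f`, and each division is one
application of some `Di`. Since `wedgeBi P B` is not assumed to vanish, its effect is collected in
`koszulH`. -/
theorem koszul_homotopy {P g1 g2 g3 : Fin m → 𝒜} {f1 f2 f3 : 𝒜} {D1 D2 D3 : 𝒜 →L[ℂ] 𝒜}
    (h1 : ∑ i, g1 i * P i = f1) (h2 : ∑ i, g2 i * P i = f2) (h3 : ∑ i, g3 i * P i = f3)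
    (hD1 : ∀ a, D1 (f1 * a) = a) (hD2 : ∀ a, D2 (f2 * a) = a) (hD3 : ∀ a, D3 (f3 * a) = a)
    (h12 : ∀ a, D1 (f2 * a) = f2 * D1 a) (h13 : ∀ a, D1 (f3 * a) = f3 * D1 a)
    (h23 : ∀ a, D2 (f3 * a) = f3 * D2 a) {B : Fin m → Fin m → 𝒜} (hB : ∀ i j, B i j = -B j i)
    (j k : Fin m) :
    B j k = P j * koszulS P g1 g2 f1 D1 D2 B k - P k * koszulS P g1 g2 f1 D1 D2 B j +
      koszulH P g1 g2 g3 f1 f2 D1 D2 D3 (wedgeBi P B) j k := by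
  set R1 := remOp f1 D1 with hR1
  set R2 := remOp f2 D2 with hR2
  have R1f1 : ∀ a, R1 (f1 * a) = 0 := fun a => by rw [remOp_apply, hD1, sub_self]
  have R1f2 : ∀ a, R1 (f2 * a) = f2 * R1 a := fun a => by
    rw [remOp_apply, remOp_apply, h12]; ring
  have R1f3 : ∀ a, R1 (f3 * a) = f3 * R1 a := fun a => by
    rw [remOp_apply, remOp_apply, h13]; ring
  have R2f2 : ∀ a, R2 (f2 * a) = 0 := fun a => by rw [remOp_apply, hD2, sub_self]
  have R2f3 : ∀ a, R2 (f3 * a) = f3 * R2 a := fun a => by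
    rw [remOp_apply, remOp_apply, h23]; ring
  set c : Fin m → 𝒜 := fun k => ∑ i, g1 i * B i k with hc
  set G1 : Fin m → Fin m → 𝒜 := fun j k => ∑ i, g1 i * wedgeBi P B i j k with hG1
  set e : 𝒜 := ∑ k, g2 k * c k with he
  -- Contracting the trivector `P ∧ B` with `g1` gives `f1 B - P ∧ c`, so `B` is known modulo `f1`
  -- once `c` is understood; the next two identities contract again with `g2` and `g3`.
  have e1 : ∀ j k, G1 j k = f1 * B j k - P j * c k + P k * c j := by
    intro j k
    have : ∀ i, g1 i * wedgeBi P B i j k =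
        g1 i * P i * B j k - P j * (g1 i * B i k) + P k * (g1 i * B i j) := by
      intro i
      rw [wedgeBi, hB k i]
      ring
    simp only [hG1, this, Finset.sum_add_distrib, Finset.sum_sub_distrib, ← Finset.sum_mul, h1, hc,
      Finset.mul_sum]
  have e2 : ∀ j, f2 * c j = P j * e - f1 * ∑ k, g2 k * B j k + ∑ k, g2 k * G1 j k := by
    intro j
    have h : ∀ k, g2 k * G1 j k = f1 * (g2 k * B j k) - P j * (g2 k * c k) + g2 k * P k * c j := by
      intro k; rw [e1]; ring
    simp only [h, Finset.sum_add_distrib, Finset.sum_sub_distrib, ← Finset.sum_mul,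
      ← Finset.mul_sum, h2, he]
    ring
  have e3 : f3 * e = f2 * (∑ j, g3 j * c j) + f1 * (∑ j, g3 j * ∑ k, g2 k * B j k) -
      ∑ j, ∑ k, g3 j * (g2 k * G1 j k) := by
    have h : ∀ j, g3 j * P j * e = f2 * (g3 j * c j) + f1 * (g3 j * ∑ k, g2 k * B j k) -
        g3 j * ∑ k, g2 k * G1 j k := by
      intro j
      have := e2 j
      linear_combination -(g3 j) * this
    rw [← h3, Finset.sum_mul, Finset.sum_congr rfl fun j _ => h j]
    simp only [Finset.sum_add_distrib, Finset.sum_sub_distrib, ← Finset.mul_sum]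
  set r := -D3 (R2 (R1 (∑ j, ∑ k, g3 j * (g2 k * G1 j k)))) with hr
  -- Modulo `f1` and `f2`, the product `f3 * e` is a contraction of `P ∧ B`. As `f3` commutes with
  -- both remainders and can be cancelled by `D3`, the remainder of `e` depends on `P ∧ B` alone.
  have e4 : R2 (R1 e) = r := by
    have h : f3 * R2 (R1 e) = -R2 (R1 (∑ j, ∑ k, g3 j * (g2 k * G1 j k))) := by
      rw [← R2f3, ← R1f3, e3, map_sub, map_add, R1f1, R1f2, add_zero, map_sub, R2f2, zero_sub]
    rw [hr, ← map_neg, ← h, hD3]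
  set v := D2 (R1 e) with hv
  set ρ : Fin m → 𝒜 := fun j => D2 (R1 (P j * r + ∑ k, g2 k * G1 j k)) with hρ
  have e5 : e = f1 * D1 e + f2 * v + r := by
    rw [← e4, remOp_apply f2 D2, hv, remOp_apply f1 D1]; ring
  -- With `e` divided by `f1` and `f2`, the same cancellation with `f2` shows that `c - v P` is a
  -- multiple of `f1` up to `P ∧ B`; its quotient is the vector `koszulS`.
  have e6 : ∀ j, R1 (c j - P j * v) = ρ j := by
    intro j
    have h : f2 * (c j - P j * v) =
        f1 * (P j * D1 e - ∑ k, g2 k * B j k) + (P j * r + ∑ k, g2 k * G1 j k) := by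
      linear_combination e2 j + P j * e5
    have h' : f2 * R1 (c j - P j * v) = R1 (P j * r + ∑ k, g2 k * G1 j k) := by
      rw [← R1f2, h, map_add, R1f1, zero_add]
    simp only [hρ]
    rw [← h', hD2]
  have e7 : ∀ j, c j - P j * v = f1 * koszulS P g1 g2 f1 D1 D2 B j + ρ j := by
    intro j
    rw [← e6 j, remOp_apply f1 D1]
    change _ = f1 * D1 (c j - P j * v) + _
    ring
  have e8 : f1 * B j k = f1 * (P j * koszulS P g1 g2 f1 D1 D2 B k -
      P k * koszulS P g1 g2 f1 D1 D2 B j) + (P j * ρ k - P k * ρ j + G1 j k) := by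
    linear_combination -e1 j k + P j * e7 k - P k * e7 j
  have e9 := congrArg D1 e8
  rw [map_add, hD1, hD1] at e9
  exact e9

/-- Subtracting `(P + E) ∧ S B` preserves antisymmetry and `(P + E) ∧ B = 0`. Under this condition
`P ∧ B = -E ∧ B` is small, so the homotopy formula makes the difference at most half of `B`.
Iterating, `B` is the sum of the subtracted terms. -/
theorem koszul_exact_of_perturbation [CompleteSpace 𝒜] {P : Fin m → 𝒜}
    {S : (Fin m → Fin m → 𝒜) →L[ℂ] (Fin m → 𝒜)}
    {H : (Fin m → Fin m → Fin m → 𝒜) →L[ℂ] (Fin m → Fin m → 𝒜)}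
    (hSH : ∀ B : Fin m → Fin m → 𝒜, (∀ i j, B i j = -B j i) → ∀ j k,
      B j k = P j * S B k - P k * S B j + H (wedgeBi P B) j k) :
    ∃ ε : ℝ, 0 < ε ∧ ∀ E : Fin m → 𝒜, (∀ j, ‖E j‖ ≤ ε) → ∀ B : Fin m → Fin m → 𝒜,
      (∀ i j, B i j = -B j i) → (∀ i j k, wedgeBi (P + E) B i j k = 0) →
      ∃ a : Fin m → 𝒜, ∀ j k, B j k = (P + E) j * a k - (P + E) k * a j := by
  -- Chosen so that `ε (3 ‖H‖ + 2 ‖S‖) ≤ 1/2`: three terms in the wedge with a bivector, two in the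
  -- wedge with a vector; the 1 keeps the denominator positive.
  refine ⟨1 / (2 * (3 * ‖H‖ + 2 * ‖S‖ + 1)), by positivity, fun E hE B0 hB0 hw0 => ?_⟩
  set ε := 1 / (2 * (3 * ‖H‖ + 2 * ‖S‖ + 1)) with hε
  have hε0 : 0 < ε := by positivity
  have hε1 : ε * (3 * ‖H‖ + 2 * ‖S‖) ≤ 1 / 2 := by
    rw [hε, div_mul_eq_mul_div, one_mul, div_le_div_iff₀ (by positivity) two_pos]
    linarith
  let Q : (Fin m → Fin m → 𝒜) → Fin m → Fin m → 𝒜 := fun B j k =>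
    B j k - ((P + E) j * S B k - (P + E) k * S B j)
  have hQ : ∀ n, (∀ i j, Q^[n] B0 i j = -Q^[n] B0 j i) ∧
      (∀ i j k, wedgeBi (P + E) (Q^[n] B0) i j k = 0) ∧ ‖Q^[n] B0‖ ≤ (1 / 2) ^ n * ‖B0‖ := by
    intro n
    induction n with
    | zero => exact ⟨hB0, hw0, by simp⟩
    | succ n ih =>
      obtain ⟨ih1, ih2, ih3⟩ := ih
      rw [Function.iterate_succ_apply']
      set B := Q^[n] B0
      refine ⟨fun i j => ?_, fun i j k => ?_, ?_⟩
      · simp only [Q]; rw [ih1 i j]; ring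
      · have := ih2 i j k
        simp only [Q, wedgeBi] at this ⊢
        linear_combination this
      · have hwE : wedgeBi P B = -wedgeBi E B := by
          funext i j k
          have := ih2 i j k
          simp only [wedgeBi, Pi.add_apply, Pi.neg_apply] at this ⊢
          linear_combination this
        have hQB : ∀ j k, Q B j k = -(H (wedgeBi E B) j k) - (E j * S B k - E k * S B j) := by
          intro j k
          have := hSH B ih1 j k
          rw [hwE, map_neg] at this
          simp only [Q, Pi.add_apply, Pi.neg_apply] at this ⊢
          linear_combination this
        have hEB : ∀ (i : Fin m) (b : 𝒜) (M : ℝ), ‖b‖ ≤ M → ‖E i * b‖ ≤ ε * M := fun i b M hb =>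
          (norm_mul_le _ _).trans (mul_le_mul (hE i) hb (norm_nonneg _) hε0.le)
        have hBn : ∀ i j, ‖B i j‖ ≤ ‖B‖ := fun i j =>
          (norm_le_pi_norm (B i) j).trans (norm_le_pi_norm B i)
        have hwn : ‖wedgeBi E B‖ ≤ 3 * (ε * ‖B‖) := by
          refine (pi_norm_le_iff_of_nonneg (by positivity)).2 fun i =>
            (pi_norm_le_iff_of_nonneg (by positivity)).2 fun j =>
            (pi_norm_le_iff_of_nonneg (by positivity)).2 fun k => ?_
          have h1 := hEB i _ _ (hBn j k)
          have h2 := hEB j _ _ (hBn k i)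
          have h3 := hEB k _ _ (hBn i j)
          exact (norm_add₃_le).trans (by linarith)
        have hSn : ∀ k, ‖S B k‖ ≤ ‖S‖ * ‖B‖ := fun k => (norm_le_pi_norm _ k).trans (S.le_opNorm B)
        have hQn : ‖Q B‖ ≤ ε * (3 * ‖H‖ + 2 * ‖S‖) * ‖B‖ := by
          refine (pi_norm_le_iff_of_nonneg (by positivity)).2 fun j =>
            (pi_norm_le_iff_of_nonneg (by positivity)).2 fun k => ?_
          rw [hQB]
          have h1 : ‖H (wedgeBi E B) j k‖ ≤ ‖H‖ * (3 * (ε * ‖B‖)) :=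
            (norm_le_pi_norm _ k).trans ((norm_le_pi_norm _ j).trans ((H.le_opNorm _).trans
              (mul_le_mul_of_nonneg_left hwn (norm_nonneg _))))
          have h2 := hEB j _ _ (hSn k)
          have h3 := hEB k _ _ (hSn j)
          refine (norm_sub_le _ _).trans ?_
          rw [norm_neg]
          have h4 := norm_sub_le (E j * S B k) (E k * S B j)
          nlinarith
        calc ‖Q B‖ ≤ 1 / 2 * ‖B‖ := hQn.trans (mul_le_mul_of_nonneg_right hε1 (norm_nonneg _))
          _ ≤ 1 / 2 * ((1 / 2) ^ n * ‖B0‖) := by gcongr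
          _ = _ := by ring
  have hgeo : Tendsto (fun n : ℕ => (1 / 2 : ℝ) ^ n * ‖B0‖) atTop (𝓝 0) := by
    simpa using (tendsto_pow_atTop_nhds_zero_of_lt_one (by norm_num : (0 : ℝ) ≤ 1 / 2)
      (by norm_num)).mul_const ‖B0‖
  have hQ0 : Tendsto (fun n => Q^[n] B0) atTop (𝓝 0) :=
    squeeze_zero_norm (fun n => (hQ n).2.2) hgeo
  have hsum : Summable fun n => S (Q^[n] B0) := by
    refine Summable.of_norm_bounded (g := fun n => ‖S‖ * ((1 / 2) ^ n * ‖B0‖)) ?_ fun n => ?_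
    · exact ((summable_geometric_two).mul_right _).mul_left _
    · exact (S.le_opNorm _).trans (mul_le_mul_of_nonneg_left (hQ n).2.2 (norm_nonneg _))
  refine ⟨∑' n, S (Q^[n] B0), fun j k => ?_⟩
  have hs : ∀ k, HasSum (fun n => S (Q^[n] B0) k) ((∑' n, S (Q^[n] B0)) k) := fun k =>
    hsum.hasSum.mapL (ContinuousLinearMap.proj k : (Fin m → 𝒜) →L[ℂ] 𝒜)
  have h1 := (((hs k).mul_left ((P + E) j)).sub ((hs j).mul_left ((P + E) k))).tendsto_sum_nat
  refine tendsto_nhds_unique ?_ h1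
  have h2 : ∀ n, ∑ i ∈ Finset.range n,
      ((P + E) j * S (Q^[i] B0) k - (P + E) k * S (Q^[i] B0) j) = B0 j k - Q^[n] B0 j k := by
    intro n
    have : ∀ i, (P + E) j * S (Q^[i] B0) k - (P + E) k * S (Q^[i] B0) j =
        Q^[i] B0 j k - Q^[i + 1] B0 j k := by
      intro i
      rw [Function.iterate_succ_apply']
      simp only [Q]
      ring
    rw [Finset.sum_congr rfl fun i _ => this i, Finset.sum_range_sub']
    rfl
  simp only [h2]
  have h3 : Tendsto (fun n => Q^[n] B0 j k) atTop (𝓝 0) := by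
    have := (tendsto_pi_nhds.1 ((tendsto_pi_nhds.1 hQ0) j)) k
    simpa using this
  simpa using tendsto_const_nhds.sub h3

end Koszul

/-! ### Division by vector fields with isolated zero. -/

/-- Homogeneous polynomials without common zero outside the origin generate an ideal which contains
a power of each variable. -/
theorem exists_pow_eq_sum {m : ℕ} (P : Fin m → MvPolynomial (Fin m) ℂ)
    (hP : ∀ x : Fin m → ℂ, (∀ j, MvPolynomial.eval x (P j) = 0) → x = 0) :
    ∃ (K : ℕ) (g : Fin m → Fin m → MvPolynomial (Fin m) ℂ),
      ∀ i, ∑ j, g i j * P j = MvPolynomial.X i ^ K := by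
  have h1 : ∀ i, ∃ K, MvPolynomial.X i ^ K ∈ Ideal.span (Set.range P) := by
    intro i
    have h2 : (MvPolynomial.X i : MvPolynomial (Fin m) ℂ) ∈ (Ideal.span (Set.range P)).radical := by
      rw [← MvPolynomial.vanishingIdeal_zeroLocus_eq_radical (K := ℂ),
        MvPolynomial.mem_vanishingIdeal_iff]
      intro x hx
      rw [MvPolynomial.mem_zeroLocus_iff] at hx
      have hx0 : x = 0 := hP x fun j => by
        have := hx (P j) (Ideal.subset_span ⟨j, rfl⟩)
        rwa [MvPolynomial.aeval_eq_eval] at this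
      simp [hx0]
    exact h2
  choose k hk using h1
  have h2 : ∀ i, MvPolynomial.X i ^ (∑ j, k j) ∈ Ideal.span (Set.range P) := by
    intro i
    rw [← Finset.add_sum_erase _ _ (Finset.mem_univ i), pow_add]
    exact Ideal.mul_mem_right _ _ (hk i)
  have h3 : ∀ i, ∃ g : Fin m → MvPolynomial (Fin m) ℂ,
      ∑ j, g j * P j = MvPolynomial.X i ^ (∑ j, k j) := by
    intro i
    obtain ⟨g, hg⟩ := Ideal.mem_span_range_iff_exists_fun.1 (h2 i)
    exact ⟨g, hg⟩
  choose g hg using h3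
  exact ⟨_, g, hg⟩

lemma eval_smul_of_isHomogeneous {σ : Type*} {d : ℕ} {p : MvPolynomial σ ℂ}
    (hp : p.IsHomogeneous d) (c : ℂ) (x : σ → ℂ) :
    MvPolynomial.eval (c • x) p = c ^ d * MvPolynomial.eval x p := by
  rw [MvPolynomial.eval_eq, MvPolynomial.eval_eq, Finset.mul_sum]
  refine Finset.sum_congr rfl fun e he => ?_
  have h := hp (MvPolynomial.mem_support_iff.1 he)
  rw [Finsupp.weight_apply, Finsupp.sum] at h
  simp only [Pi.one_apply, smul_eq_mul, mul_one] at h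
  simp only [Pi.smul_apply, smul_eq_mul, mul_pow, Finset.prod_mul_distrib]
  rw [Finset.prod_pow_eq_pow_sum, h]
  ring

namespace Wiener

variable {κ : Type*} [Fintype κ] [DecidableEq κ]

lemma bshift_pow_X_pow_mul (i : κ) (n : ℕ) (f : Wiener κ) :
    (bshift i ^ n) (Wiener.X i ^ n * f) = f := by
  induction n with
  | zero => simp
  | succ n ih =>
    rw [pow_succ, mul_apply_eq_comp, pow_succ', mul_assoc, bshift_X_mul, ih]

lemma bshift_X_pow_mul_of_ne {i j : κ} (hij : i ≠ j) (n : ℕ) (f : Wiener κ) :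
    bshift i (Wiener.X j ^ n * f) = Wiener.X j ^ n * bshift i f := by
  induction n with
  | zero => simp
  | succ n ih => rw [pow_succ', mul_assoc, bshift_X_mul_of_ne hij, ih, mul_assoc]

lemma bshift_pow_X_pow_mul_of_ne {i j : κ} (hij : i ≠ j) (n k : ℕ) (f : Wiener κ) :
    (bshift i ^ k) (Wiener.X j ^ n * f) = Wiener.X j ^ n * (bshift i ^ k) f := by
  induction k generalizing f with
  | zero => simp
  | succ k ih =>
    rw [pow_succ, mul_apply_eq_comp, bshift_X_pow_mul_of_ne hij, ih, mul_apply_eq_comp]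

/-- Perturbations of a polynomial vector field with isolated zero have an exact Koszul complex. -/
theorem koszul_exact {m : ℕ} (hm : 3 ≤ m) {x : Fin m → κ} (hx : Function.Injective x)
    (P : Fin m → MvPolynomial (Fin m) ℂ)
    (hP : ∀ x : Fin m → ℂ, (∀ j, MvPolynomial.eval x (P j) = 0) → x = 0) :
    ∃ ε : ℝ, 0 < ε ∧ ∀ E : Fin m → Wiener κ, (∀ j, ‖E j‖ ≤ ε) →
      ∀ B : Fin m → Fin m → Wiener κ, (∀ i j, B i j = -B j i) →
      (∀ i j k, wedgeBi ((fun j => MvPolynomial.aeval (fun i => Wiener.X (x i)) (P j)) + E) B i j k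
        = 0) →
      ∃ a : Fin m → Wiener κ, ∀ j k,
        B j k = (MvPolynomial.aeval (fun i => Wiener.X (x i)) (P j) + E j) * a k -
          (MvPolynomial.aeval (fun i => Wiener.X (x i)) (P k) + E k) * a j := by
  obtain ⟨K, g, hg⟩ := exists_pow_eq_sum P hP
  let i1 : Fin m := ⟨0, by omega⟩
  let i2 : Fin m := ⟨1, by omega⟩
  let i3 : Fin m := ⟨2, by omega⟩
  have hG : ∀ i, ∑ j, MvPolynomial.aeval (fun i => (Wiener.X (x i) : Wiener κ)) (g i j) *
      MvPolynomial.aeval (fun i => Wiener.X (x i)) (P j) = Wiener.X (x i) ^ K := by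
    intro i
    have := congrArg (MvPolynomial.aeval (fun i => (Wiener.X (x i) : Wiener κ))) (hg i)
    simpa using this
  have hne : ∀ i j : Fin m, i ≠ j → x i ≠ x j := fun i j h => hx.ne h
  -- The regular sequence consists of the `K`-th powers of three of the variables, divided out by
  -- `K`-fold backward shifts; this is where `3 ≤ m` enters.
  exact koszul_exact_of_perturbation fun B hB j k =>
    koszul_homotopy (hG i1) (hG i2) (hG i3) (D1 := bshift (x i1) ^ K) (D2 := bshift (x i2) ^ K)
      (D3 := bshift (x i3) ^ K)
      (bshift_pow_X_pow_mul _ _) (bshift_pow_X_pow_mul _ _) (bshift_pow_X_pow_mul _ _)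
      (bshift_pow_X_pow_mul_of_ne (hne _ _ (by simp [i1, i2])) _ _)
      (bshift_pow_X_pow_mul_of_ne (hne _ _ (by simp [i1, i3])) _ _)
      (bshift_pow_X_pow_mul_of_ne (hne _ _ (by simp [i2, i3])) _ _) hB j k

lemma ev_aeval {m : ℕ} {z : κ → ℂ} (hz : ‖z‖ ≤ 1) (x : Fin m → κ) (p : MvPolynomial (Fin m) ℂ) :
    ev z (MvPolynomial.aeval (fun i => Wiener.X (x i)) p) =
      MvPolynomial.eval (fun i => z (x i)) p := by
  change evHom z hz (MvPolynomial.aeval (fun i => Wiener.X (x i)) p) = _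
  rw [← MvPolynomial.aeval_eq_eval, ← AlgHom.comp_apply, MvPolynomial.comp_aeval]
  have : (fun i => evHom z hz (Wiener.X (x i))) = fun i => z (x i) := funext fun i => ev_X hz (x i)
  rw [this]

/-- The substitution `x_τ ↦ δ x_τ`. -/
def dilate (τ : κ) (δ : ℂ) : Wiener κ →L[ℂ] Wiener κ := diag fun α => δ ^ α τ

lemma norm_dilate_coeff {τ : κ} {δ : ℂ} (hδ : ‖δ‖ ≤ 1) (α : κ → ℕ) : ‖δ ^ α τ‖ ≤ 1 := by
  rw [norm_pow]; exact pow_le_one₀ (norm_nonneg _) hδ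

lemma norm_dilate_le (τ : κ) {δ : ℂ} (hδ : ‖δ‖ ≤ 1) (f : Wiener κ) : ‖dilate τ δ f‖ ≤ ‖f‖ := by
  have h : ‖dilate τ δ‖ ≤ 1 := norm_diag_le (norm_dilate_coeff hδ)
  simpa using ((dilate τ δ).le_opNorm f).trans (mul_le_mul_of_nonneg_right h (norm_nonneg f))

lemma norm_update_mul_le {z : κ → ℂ} (τ : κ) {δ : ℂ} (hδ : ‖δ‖ ≤ 1) :
    ‖Function.update z τ (δ * z τ)‖ ≤ ‖z‖ := by
  refine (pi_norm_le_iff_of_nonneg (norm_nonneg _)).2 fun i => ?_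
  by_cases hi : i = τ
  · subst hi
    rw [Function.update_self, norm_mul]
    exact (mul_le_of_le_one_left (norm_nonneg _) hδ).trans (norm_le_pi_norm z i)
  · rw [Function.update_of_ne hi]; exact norm_le_pi_norm z i

lemma ev_dilate {z : κ → ℂ} (hz : ‖z‖ ≤ 1) (τ : κ) {δ : ℂ} (hδ : ‖δ‖ ≤ 1) (f : Wiener κ) :
    ev z (dilate τ δ f) = ev (Function.update z τ (δ * z τ)) f := by
  have key : (ev z).comp (dilate τ δ) = ev (Function.update z τ (δ * z τ)) := ext_mono fun α => by
    rw [ContinuousLinearMap.comp_apply, dilate, diag_mono (norm_dilate_coeff hδ), map_smul,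
      ev_mono hz, ev_mono ((norm_update_mul_le τ hδ).trans hz), smul_eq_mul,
      ← Finset.mul_prod_erase _ _ (Finset.mem_univ τ),
      ← Finset.mul_prod_erase _ _ (Finset.mem_univ τ), Function.update_self, mul_pow, mul_assoc]
    congr 2
    refine Finset.prod_congr rfl fun i hi => ?_
    rw [Function.update_of_ne (Finset.ne_of_mem_erase hi)]
  exact DFunLike.congr_fun key f

end Wiener

open Wiener in
/-- **Division theorem** with parameters: if `X` is a germ of holomorphic vector field in the
variables `x`, which for `z_τ = 0` is a homogeneous polynomial vector field with isolated zero, and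
`B` is a germ of holomorphic field of bivectors with `X ∧ B = 0`, then `B = X ∧ a`. -/
theorem exists_koszul_division {κ : Type*} [Fintype κ] [DecidableEq κ] {m d : ℕ} (hm : 3 ≤ m)
    {x : Fin m → κ} (hx : Function.Injective x) {τ : κ} (hτ : ∀ i, x i ≠ τ)
    (P : Fin m → MvPolynomial (Fin m) ℂ) (hPd : ∀ j, (P j).IsHomogeneous d)
    (hP : ∀ x : Fin m → ℂ, (∀ j, MvPolynomial.eval x (P j) = 0) → x = 0)
    {X : (κ → ℂ) → Fin m → ℂ} (hX : AnalyticAt ℂ X 0)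
    (hXP : ∀ᶠ z in 𝓝 0, z τ = 0 → ∀ j, X z j = MvPolynomial.eval (fun i => z (x i)) (P j))
    {B : (κ → ℂ) → Fin m → Fin m → ℂ} (hB : AnalyticAt ℂ B 0)
    (hBa : ∀ᶠ z in 𝓝 0, ∀ i j, B z i j = -B z j i)
    (hXB : ∀ᶠ z in 𝓝 0, ∀ i j k, wedgeBi (X z) (B z) i j k = 0) :
    ∃ a : (κ → ℂ) → Fin m → ℂ, AnalyticAt ℂ a 0 ∧
      ∀ᶠ z in 𝓝 0, ∀ j k, B z j k = X z j * a z k - X z k * a z j := by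
  have hXj : ∀ j, AnalyticAt ℂ (fun z => X z j) 0 := fun j =>
    ((ContinuousLinearMap.proj j : (Fin m → ℂ) →L[ℂ] ℂ).analyticAt _).fun_comp hX
  have hBjk : ∀ j k, AnalyticAt ℂ (fun z => B z j k) 0 := fun j k =>
    (((ContinuousLinearMap.proj k : (Fin m → ℂ) →L[ℂ] ℂ).comp
      (ContinuousLinearMap.proj j : (Fin m → Fin m → ℂ) →L[ℂ] (Fin m → ℂ))).analyticAt _).fun_comp hB
  have hex : ∀ᶠ ρ in 𝓝 (0 : ℂ), (∀ j, ∃ a : Wiener κ, ∀ z : κ → ℂ, ‖z‖ ≤ 1 → ev z a = X (ρ • z) j) ∧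
      ∀ j k, ∃ a : Wiener κ, ∀ z : κ → ℂ, ‖z‖ ≤ 1 → ev z a = B (ρ • z) j k :=
    (eventually_all.2 fun j => exists_ev_eq (hXj j)).and
      (eventually_all.2 fun j => eventually_all.2 fun k => exists_ev_eq (hBjk j k))
  obtain ⟨ρ, ⟨hρX, hρB⟩, hρ⟩ := ((hex.filter_mono nhdsWithin_le_nhds).and
    (self_mem_nhdsWithin (s := {(0 : ℂ)}ᶜ))).exists
  have hρ0 : ρ ≠ 0 := hρ
  choose X' hX' using hρX
  choose B' hB' using hρB
  obtain ⟨ε, hε, hK⟩ := koszul_exact hm hx P hP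
  set p : Fin m → Wiener κ := fun j => MvPolynomial.aeval (fun i => Wiener.X (x i)) (P j) with hp
  -- After the homothety by `ρ`, homogeneity multiplies the leading field by `ρ ^ d`; dividing by it
  -- restores `P` on `z τ = 0`, so the remaining part of `Xs` is divisible by the variable `τ`.
  set Xs : Fin m → Wiener κ := fun j => (ρ ^ d)⁻¹ • X' j with hXs
  have hup : ∀ c : ℂ, Tendsto (fun z : κ → ℂ => Function.update z τ (c * z τ)) (𝓝 0) (𝓝 0) := by
    intro c
    have : Continuous fun z : κ → ℂ => Function.update z τ (c * z τ) := by fun_prop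
    have h2 := this.tendsto 0
    rwa [Pi.zero_apply, mul_zero,
      show Function.update (0 : κ → ℂ) τ (0 : ℂ) = 0 from Function.update_eq_self τ (0 : κ → ℂ)] at h2
  have hρt : Tendsto (fun z : κ → ℂ => ρ • z) (𝓝 0) (𝓝 0) := by
    have : Continuous fun z : κ → ℂ => ρ • z := by fun_prop
    simpa using this.tendsto 0
  have hEq : ∀ j, Xs j = p j + Wiener.X τ * bshift τ (Xs j) := by
    intro j
    refine eq_of_ev ?_
    filter_upwards [eventually_norm_lt_one, (hup 0).eventually (hρt.eventually hXP)] with z hz hz2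
    have hz' : ‖Function.update z τ (0 * z τ)‖ ≤ 1 :=
      (norm_update_mul_le τ (by simp)).trans hz.le
    rw [zero_mul] at hz' hz2
    rw [ev_bshift hz.le τ, map_add, ev_mul hz.le, ev_X hz.le, hXs]
    congr 1
    rw [map_smul, hX' _ _ hz', hz2 (by simp), hp, ev_aeval hz.le, smul_eq_mul]
    have h1 : (fun i => (ρ • Function.update z τ 0) (x i)) = ρ • fun i => z (x i) := by
      funext i
      simp [Function.update_of_ne (hτ i)]
    have h2 := eval_smul_of_isHomogeneous (hPd j) ρ fun i => z (x i)
    rw [h1, h2]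
    field_simp
  obtain ⟨M, hM0, hM⟩ : ∃ M : ℝ, 0 < M ∧ ∀ j, ‖bshift τ (Xs j)‖ ≤ M :=
    ⟨‖fun j => bshift τ (Xs j)‖ + 1, by positivity, fun j =>
      (norm_le_pi_norm (fun j => bshift τ (Xs j)) j).trans (by linarith)⟩
  obtain ⟨δ, hδ0, hδ1, hδε⟩ : ∃ δ : ℝ, 0 < δ ∧ δ ≤ 1 ∧ δ * M ≤ ε :=
    ⟨min 1 (ε / M), by positivity, min_le_left _ _, by
      calc _ ≤ ε / M * M := mul_le_mul_of_nonneg_right (min_le_right _ _) hM0.le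
        _ = ε := by field_simp⟩
  have hδn : ‖(δ : ℂ)‖ ≤ 1 := by rwa [Complex.norm_real, Real.norm_of_nonneg hδ0.le]
  -- Substituting `δ z τ` for `z τ` leaves `P` unchanged and multiplies the part divisible by `τ` by
  -- `δ`, which brings it below the tolerance `ε`.
  set E : Fin m → Wiener κ := fun j => (δ : ℂ) • (Wiener.X τ * dilate τ δ (bshift τ (Xs j))) with hE
  have hEn : ∀ j, ‖E j‖ ≤ ε := by
    intro j
    refine le_trans ?_ hδε
    rw [hE, norm_smul, Complex.norm_real, Real.norm_of_nonneg hδ0.le]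
    refine mul_le_mul_of_nonneg_left ?_ hδ0.le
    refine (norm_mul_le _ _).trans ?_
    rw [norm_X, one_mul]
    exact (norm_dilate_le τ hδn _).trans (hM j)
  have hevX : ∀ z : κ → ℂ, ‖z‖ ≤ 1 → ∀ j, ev z (p j + E j) =
      (ρ ^ d)⁻¹ * X (ρ • Function.update z τ (δ * z τ)) j := by
    intro z hz j
    have hz' := (norm_update_mul_le (z := z) τ hδn).trans hz
    rw [← hX' j _ hz', ← smul_eq_mul, ← map_smul]
    change _ = ev _ (Xs j)
    rw [hEq j, map_add, map_add, ev_mul hz', ev_X hz', hE, map_smul, ev_mul hz, ev_X hz,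
      ev_dilate hz τ hδn, hp, ev_aeval hz, ev_aeval hz', Function.update_self, smul_eq_mul]
    have h1 : (fun i => Function.update z τ (δ * z τ) (x i)) = fun i => z (x i) :=
      funext fun i => Function.update_of_ne (hτ i) _ _
    rw [h1]
    ring
  have hevB : ∀ z : κ → ℂ, ‖z‖ ≤ 1 → ∀ j k, ev z (dilate τ δ (B' j k)) =
      B (ρ • Function.update z τ (δ * z τ)) j k := by
    intro z hz j k
    rw [ev_dilate hz τ hδn, hB' _ _ _ ((norm_update_mul_le (z := z) τ hδn).trans hz)]
  obtain ⟨a, ha⟩ := hK E hEn (fun j k => dilate τ δ (B' j k))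
    (fun i j => eq_of_ev (by
      filter_upwards [eventually_norm_lt_one, (hup δ).eventually (hρt.eventually hBa)] with z hz hz2
      rw [map_neg, hevB z hz.le, hevB z hz.le]
      exact hz2 i j))
    (fun i j k => eq_of_ev (by
      filter_upwards [eventually_norm_lt_one, (hup δ).eventually (hρt.eventually hXB)] with z hz hz2
      have := hz2 i j k
      change ev z ((p i + E i) * _ + (p j + E j) * _ + (p k + E k) * _) = ev z 0
      simp only [wedgeBi] at this
      rw [map_zero, map_add, map_add, ev_mul hz.le, ev_mul hz.le, ev_mul hz.le, hevX z hz.le,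
        hevX z hz.le, hevX z hz.le, hevB z hz.le, hevB z hz.le, hevB z hz.le]
      linear_combination (ρ ^ d)⁻¹ * this))
  -- `s` undoes both the homothety by `ρ` and the dilation by `δ` of the variable `τ`.
  let s : (κ → ℂ) →L[ℂ] (κ → ℂ) := ContinuousLinearMap.pi fun i =>
    (if i = τ then ρ⁻¹ * (δ : ℂ)⁻¹ else ρ⁻¹) • ContinuousLinearMap.proj i
  have hs : ∀ z, ρ • Function.update (s z) τ (δ * s z τ) = z := by
    intro z
    funext i
    have hδ' : (δ : ℂ) ≠ 0 := by exact_mod_cast hδ0.ne'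
    by_cases hi : i = τ
    · subst hi
      simp [s]
      field_simp
    · simp [s, hi, hρ0]
  have hst : Tendsto s (𝓝 0) (𝓝 0) := by
    have := s.continuous.tendsto 0
    rwa [map_zero] at this
  -- The division was carried out for `X` divided by `ρ ^ d`, so the quotient absorbs this factor.
  refine ⟨fun z j => (ρ ^ d)⁻¹ * ev (s z) (a j), ?_, ?_⟩
  · refine AnalyticAt.pi fun j => analyticAt_const.mul ?_
    have h1 : AnalyticAt ℂ (fun w => ev w (a j)) (s 0) := by
      rw [map_zero]; exact analyticAt_ev_apply (by simp) _
    exact h1.fun_comp (s.analyticAt 0)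
  · filter_upwards [hst.eventually eventually_norm_lt_one] with z hz j k
    have h1 := congrArg (ev (s z)) (ha j k)
    rw [hevB _ hz.le, hs, map_sub, ev_mul hz.le, ev_mul hz.le] at h1
    change _ = ev (s z) (p j + E j) * _ - ev (s z) (p k + E k) * _ at h1
    rw [hevX _ hz.le, hevX _ hz.le, hs] at h1
    rw [h1]
    ring

/-! ### Contraction and exterior multiplication of alternating forms. -/

section AlternatingAlgebra

variable {E F : Type*} [NormedAddCommGroup E] [NormedSpace ℂ E]
  [NormedAddCommGroup F] [NormedSpace ℂ F]

lemma apply_eq_zero_of_mem_formKernel {q : ℕ} {α : E [⋀^Fin q]→L[ℂ] ℂ} {w : Fin q → E} {i : Fin q}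
    (h : w i ∈ formKernel α) : α w = 0 := by
  have := h w i
  rwa [Function.update_eq_self] at this

lemma mem_formKernel_iff {q : ℕ} {α : E [⋀^Fin (q + 1)]→L[ℂ] ℂ} {v : E} :
    v ∈ formKernel α ↔ α.curryLeft v = 0 := by
  constructor
  · intro h
    ext w
    rw [ContinuousAlternatingMap.curryLeft_apply_apply]
    exact apply_eq_zero_of_mem_formKernel (i := 0) (by simpa using h)
  · intro h w i
    rw [← Fin.insertNth_removeNth, ContinuousAlternatingMap.map_insertNth,
      ← ContinuousAlternatingMap.curryLeft_apply_apply, h]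
    simp

/-- The exterior product of a linear form and an alternating form. -/
def extMul {q : ℕ} (g : E →L[ℂ] ℂ) : (E [⋀^Fin q]→L[ℂ] ℂ) →L[ℂ] E [⋀^Fin (q + 1)]→L[ℂ] ℂ :=
  ContinuousAlternatingMap.alternatizeUncurryFinCLM ℂ E ℂ ∘L ContinuousLinearMap.smulRightL ℂ E _ g

lemma extMul_apply {q : ℕ} (g : E →L[ℂ] ℂ) (α : E [⋀^Fin q]→L[ℂ] ℂ) :
    extMul g α = ContinuousAlternatingMap.alternatizeUncurryFin (g.smulRight α) := rfl

lemma extMul_apply_apply {q : ℕ} (g : E →L[ℂ] ℂ) (α : E [⋀^Fin q]→L[ℂ] ℂ) (v : Fin (q + 1) → E) :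
    extMul g α v = ∑ i : Fin (q + 1), (-1) ^ (i : ℕ) * (g (v i) * α (i.removeNth v)) := by
  rw [extMul_apply, ContinuousAlternatingMap.alternatizeUncurryFin_apply]
  refine Finset.sum_congr rfl fun i _ => ?_
  simp [zsmul_eq_mul]

lemma curryLeft_extMul {q : ℕ} (g : E →L[ℂ] ℂ) (α : E [⋀^Fin (q + 1)]→L[ℂ] ℂ) (v : E) :
    (extMul g α).curryLeft v = g v • α - extMul g (α.curryLeft v) := by
  ext w
  change extMul g α (Matrix.vecCons v w) = g v * α w - extMul g (α.curryLeft v) w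
  rw [extMul_apply_apply, extMul_apply_apply, Fin.sum_univ_succ, sub_eq_add_neg,
    ← Finset.sum_neg_distrib]
  congr 1
  · simp [Matrix.vecCons]
  · refine Finset.sum_congr rfl fun i _ => ?_
    have : i.succ.removeNth (Matrix.vecCons v w) = Matrix.vecCons v (i.removeNth w) := by
      funext j
      refine Fin.cases ?_ (fun j => ?_) j
      · simp [Fin.removeNth]
      · simp [Fin.removeNth]
    rw [this, ContinuousAlternatingMap.curryLeft_apply_apply]
    simp [pow_succ]

lemma extMul_add {q : ℕ} (g h : E →L[ℂ] ℂ) (α : E [⋀^Fin q]→L[ℂ] ℂ) :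
    extMul (g + h) α = extMul g α + extMul h α := by
  ext w
  simp only [ContinuousAlternatingMap.add_apply, extMul_apply_apply, add_apply, add_mul, mul_add,
    Finset.sum_add_distrib]

/-- Alternating twice an expression symmetric in the first two slots gives zero, and `g ⊗ g ⊗ α` is
such an expression. -/
lemma extMul_self {q : ℕ} (g : E →L[ℂ] ℂ) (α : E [⋀^Fin q]→L[ℂ] ℂ) :
    extMul g (extMul g α) = 0 := by
  rw [← ContinuousAlternatingMap.alternatizeUncurryFin_alternatizeUncurryFinCLM_comp_of_symmetric
    (f := g.smulRight (g.smulRight α)) (fun x y => by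
      simp only [ContinuousLinearMap.smulRight_apply, smul_apply]
      rw [smul_comm])]
  rw [extMul_apply]
  congr 1
  ext x : 1
  simp [extMul_apply, ← ContinuousAlternatingMap.alternatizeUncurryFinCLM_apply]

lemma extMul_extMul_swap {q : ℕ} (g h : E →L[ℂ] ℂ) (α : E [⋀^Fin q]→L[ℂ] ℂ) :
    extMul g (extMul h α) = -extMul h (extMul g α) := by
  have h1 := extMul_self (g + h) α
  rw [extMul_add, extMul_add, map_add, map_add, extMul_self, extMul_self, zero_add, add_zero] at h1
  exact eq_neg_of_add_eq_zero_left h1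

end AlternatingAlgebra

/-! ### Forms on `Fin m → ℂ` and the vectors and bivectors dual to them. -/

section Coordinates

variable {m : ℕ}

/-- The coordinate form `dx_j`. -/
def dx (j : Fin m) : (Fin m → ℂ) →L[ℂ] ℂ := ContinuousLinearMap.proj j

/-- The vectors of the standard basis. -/
def stdVec (j : Fin m) : Fin m → ℂ := Pi.single j 1

lemma dx_apply (j : Fin m) (v : Fin m → ℂ) : dx j v = v j := rfl

lemma volForm_apply (v : Fin m → Fin m → ℂ) : volForm m v = Matrix.det (Matrix.of v) := rfl

lemma volForm_stdVec : volForm m stdVec = 1 := by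
  rw [volForm_apply, ← Matrix.det_one (n := Fin m) (R := ℂ)]
  congr 1
  ext i j
  simp [stdVec, Matrix.one_apply, Pi.single_apply, eq_comm]

lemma sum_dx_smulRight {F : Type*} [NormedAddCommGroup F] [NormedSpace ℂ F]
    (f : (Fin m → ℂ) →L[ℂ] F) : ∑ j, (dx j).smulRight (f (stdVec j)) = f := by
  ext v
  rw [sum_apply]
  conv_rhs => rw [pi_eq_sum_univ' v, map_sum]
  refine Finset.sum_congr rfl fun j _ => ?_
  rw [map_smul]
  rfl

/-- Wedging back the contractions with a basis counts the degree of the form. By the antiderivation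
rule, the opposite order in the next lemma counts the codegree. -/
lemma sum_extMul_curryLeft {q : ℕ} (α : (Fin m → ℂ) [⋀^Fin (q + 1)]→L[ℂ] ℂ) :
    ∑ j, extMul (dx j) (α.curryLeft (stdVec j)) = ((q : ℂ) + 1) • α := by
  have h := ContinuousAlternatingMap.alternatizeUncurryFin_curryLeft α
  rw [← sum_dx_smulRight α.curryLeft, ← ContinuousAlternatingMap.alternatizeUncurryFinCLM_apply,
    map_sum] at h
  calc _ = (q + 1) • α := h
    _ = _ := by rw [← Nat.cast_smul_eq_nsmul ℂ]; push_cast; rfl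

lemma sum_curryLeft_extMul {q : ℕ} (α : (Fin m → ℂ) [⋀^Fin (q + 1)]→L[ℂ] ℂ) :
    ∑ j, (extMul (dx j) α).curryLeft (stdVec j) = ((m : ℂ) - (q + 1)) • α := by
  simp only [curryLeft_extMul, Finset.sum_sub_distrib, sum_extMul_curryLeft, dx_apply]
  rw [← Finset.sum_smul]
  refine Eq.trans ?_ (sub_smul _ _ _).symm
  simp [stdVec]

lemma eq_smul_volForm (γ : (Fin m → ℂ) [⋀^Fin m]→L[ℂ] ℂ) : γ = γ stdVec • volForm m := by
  have h := AlternatingMap.eq_smul_basis_det (Pi.basisFun ℂ (Fin m)) γ.toAlternatingMap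
  ext v
  have h2 := DFunLike.congr_fun h v
  have h3 : ⇑(Pi.basisFun ℂ (Fin m)) = stdVec := by
    funext i; simp [stdVec]
  rw [Pi.basisFun_det, h3] at h2
  exact h2

lemma eq_zero_of_lt_degree {q : ℕ} (hq : m < q) (γ : (Fin m → ℂ) [⋀^Fin q]→L[ℂ] ℂ) : γ = 0 := by
  ext v
  refine γ.toAlternatingMap.map_linearDependent v fun h => ?_
  have := h.fintype_card_le_finrank
  simp at this
  omega

/-- The components of the vector `X` such that `i_X ν = θ`. -/
def vecOf {q : ℕ} (j : Fin (q + 1)) : ((Fin (q + 1) → ℂ) [⋀^Fin q]→L[ℂ] ℂ) →L[ℂ] ℂ :=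
  ContinuousAlternatingMap.apply ℂ (Fin (q + 1) → ℂ) ℂ stdVec ∘L extMul (dx j)

lemma extMul_dx_eq {q : ℕ} (j : Fin (q + 1)) (θ : (Fin (q + 1) → ℂ) [⋀^Fin q]→L[ℂ] ℂ) :
    extMul (dx j) θ = vecOf j θ • volForm (q + 1) := eq_smul_volForm _

/-- The components of the bivector `B` such that `i_B ν = 2 β`. -/
def bivecOf {q : ℕ} (j k : Fin (q + 2)) : ((Fin (q + 2) → ℂ) [⋀^Fin q]→L[ℂ] ℂ) →L[ℂ] ℂ :=
  vecOf j ∘L extMul (dx k)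

lemma extMul_dx_extMul_dx_eq {q : ℕ} (j k : Fin (q + 2)) (β : (Fin (q + 2) → ℂ) [⋀^Fin q]→L[ℂ] ℂ) :
    extMul (dx j) (extMul (dx k) β) = bivecOf j k β • volForm (q + 2) := extMul_dx_eq _ _

lemma sum_smul_stdVec (v : Fin m → ℂ) : ∑ j, v j • stdVec j = v := by
  conv_rhs => rw [pi_eq_sum_univ' v]
  rfl

lemma curryLeft_smul_apply {q : ℕ} (c : ℂ) (α : (Fin m → ℂ) [⋀^Fin (q + 1)]→L[ℂ] ℂ)
    (v : Fin m → ℂ) : (c • α).curryLeft v = c • α.curryLeft v := rfl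

/-- The codegree of a `(q + 1)`-form in dimension `q + 2` is one, so contracting after wedging
returns `θ` itself. -/
lemma curryLeft_vecOf {q : ℕ} (θ : (Fin (q + 2) → ℂ) [⋀^Fin (q + 1)]→L[ℂ] ℂ) :
    (volForm (q + 2)).curryLeft (fun j => vecOf j θ) = θ := by
  have h := sum_curryLeft_extMul θ
  simp only [extMul_dx_eq, curryLeft_smul_apply, ← map_smul] at h
  rw [← map_sum, sum_smul_stdVec] at h
  rw [h]
  push_cast
  rw [show ((q : ℂ) + 2) - (q + 1) = 1 by ring, one_smul]

lemma vecOf_curryLeft {q : ℕ} (X : Fin (q + 1) → ℂ) (j : Fin (q + 1)) :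
    vecOf j ((volForm (q + 1)).curryLeft X) = X j := by
  have h1 : extMul (dx j) (volForm (q + 1)) = 0 := eq_zero_of_lt_degree (Nat.lt_succ_self _) _
  have h := curryLeft_extMul (dx j) (volForm (q + 1)) X
  rw [h1, extMul_dx_eq] at h
  have h2 := DFunLike.congr_fun h stdVec
  change 0 = X j * volForm (q + 1) stdVec - _ * volForm (q + 1) stdVec at h2
  rw [volForm_stdVec] at h2
  linear_combination h2

lemma curryLeft_volForm_injective {q : ℕ} : Function.Injective (volForm (q + 1)).curryLeft := by
  intro X Y h
  funext j
  rw [← vecOf_curryLeft X, h, vecOf_curryLeft]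

lemma bivecOf_swap {q : ℕ} (j k : Fin (q + 2)) (β : (Fin (q + 2) → ℂ) [⋀^Fin q]→L[ℂ] ℂ) :
    bivecOf j k β = -bivecOf k j β := by
  change extMul (dx j) (extMul (dx k) β) stdVec = -(extMul (dx k) (extMul (dx j) β) stdVec)
  rw [extMul_extMul_swap]
  rfl

/-- Two wedge-and-contract rounds: the inner one acts on a form of codegree one, the outer one on a
form of codegree two, which produces the factor 2. -/
lemma sum_bivecOf {q : ℕ} (β : (Fin (q + 2) → ℂ) [⋀^Fin q]→L[ℂ] ℂ) (hq : 1 ≤ q) :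
    ∑ k, ∑ j, bivecOf j k β • ((volForm (q + 2)).curryLeft (stdVec j)).curryLeft (stdVec k) =
      (2 : ℂ) • β := by
  obtain ⟨q, rfl⟩ : ∃ r, q = r + 1 := ⟨q - 1, by omega⟩
  have h2 : ∀ k, ∑ j, bivecOf j k β • (volForm (q + 1 + 2)).curryLeft (stdVec j) =
      extMul (dx k) β := by
    intro k
    have h := sum_curryLeft_extMul (extMul (dx k) β)
    simp only [extMul_dx_extMul_dx_eq, curryLeft_smul_apply] at h
    rw [h]
    push_cast
    rw [show ((q : ℂ) + 1 + 2) - (q + 1 + 1) = 1 by ring, one_smul]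
  have h3 := sum_curryLeft_extMul β
  rw [show ((q + 1 + 2 : ℕ) : ℂ) - (q + 1) = 2 by push_cast; ring] at h3
  rw [← h3]
  refine Finset.sum_congr rfl fun k _ => ?_
  rw [← h2 k]
  ext v
  simp

/-- The form `dx_i ∧ dx_j ∧ dx_k ∧ β` has degree `q + 3` in dimension `q + 2` and is zero.
Contracting it with `X`, which annihilates `β`, leaves precisely the component of `X ∧ B`. -/
lemma wedgeBi_bivecOf {q : ℕ} {β : (Fin (q + 2) → ℂ) [⋀^Fin q]→L[ℂ] ℂ} (hq : 1 ≤ q)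
    {X : Fin (q + 2) → ℂ} (hX : X ∈ formKernel β) (i j k : Fin (q + 2)) :
    wedgeBi X (fun j k => bivecOf j k β) i j k = 0 := by
  obtain ⟨q, rfl⟩ : ∃ r, q = r + 1 := ⟨q - 1, by omega⟩
  rw [mem_formKernel_iff] at hX
  have h0 : extMul (dx i) (extMul (dx j) (extMul (dx k) β)) = 0 :=
    eq_zero_of_lt_degree (Nat.lt_succ_self _) _
  have h := curryLeft_extMul (dx i) (extMul (dx j) (extMul (dx k) β)) X
  rw [h0, curryLeft_extMul, curryLeft_extMul, hX, map_zero, sub_zero, map_sub, map_smul, map_smul,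
    map_smul] at h
  have h2 := DFunLike.congr_fun h stdVec
  change 0 = X i * bivecOf j k β - (X j * bivecOf i k β - X k * bivecOf i j β) at h2
  rw [wedgeBi, bivecOf_swap k i]
  linear_combination -h2

/-- Division of a form annihilated by `X`. -/
lemma eq_curryLeft_of_bivecOf {q : ℕ} {β : (Fin (q + 2) → ℂ) [⋀^Fin q]→L[ℂ] ℂ} (hq : 1 ≤ q)
    {X a : Fin (q + 2) → ℂ} (h : ∀ j k, bivecOf j k β = X j * a k - X k * a j) :
    β = ((volForm (q + 2)).curryLeft X).curryLeft a := by
  have h1 := sum_bivecOf β hq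
  simp only [h] at h1
  have hν : ∀ v w : Fin (q + 2) → ℂ, ((volForm (q + 2)).curryLeft v).curryLeft w =
      -((volForm (q + 2)).curryLeft w).curryLeft v := by
    intro v w
    ext u
    change volForm (q + 2) (Matrix.vecCons v (Matrix.vecCons w u)) =
      -volForm (q + 2) (Matrix.vecCons w (Matrix.vecCons v u))
    have h := (volForm (q + 2)).toAlternatingMap.map_swap (Matrix.vecCons w (Matrix.vecCons v u))
      (show (0 : Fin (q + 2)) ≠ 1 by simp)
    refine Eq.trans ?_ h
    change volForm (q + 2) _ = volForm (q + 2) _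
    congr 1
    funext i
    refine Fin.cases ?_ (fun i => ?_) i
    · simp
    · refine Fin.cases ?_ (fun i => ?_) i
      · simp
      · change _ = Matrix.vecCons w (Matrix.vecCons v u) (Equiv.swap 0 1 i.succ.succ)
        rw [Equiv.swap_apply_of_ne_of_ne (Fin.succ_ne_zero _) (by simp [Fin.ext_iff])]
        simp
  have h2 : ∀ v w : Fin (q + 2) → ℂ, ((volForm (q + 2)).curryLeft v).curryLeft w =
      ∑ k, ∑ j, (v j * w k) •
        ((volForm (q + 2)).curryLeft (stdVec j)).curryLeft (stdVec k) := by
    intro v w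
    conv_lhs => rw [← sum_smul_stdVec v, ← sum_smul_stdVec w]
    simp only [map_sum, map_smul]
    refine Finset.sum_congr rfl fun k _ => ?_
    ext u
    simp [Finset.mul_sum, mul_left_comm, mul_assoc]
  have h3 : (2 : ℂ) • β = ((volForm (q + 2)).curryLeft X).curryLeft a -
      ((volForm (q + 2)).curryLeft a).curryLeft X := by
    rw [← h1, h2 X a, h2 a X]
    ext u
    simp [sub_mul, Finset.sum_sub_distrib, mul_comm]
  rw [hν a X, sub_neg_eq_add, ← two_smul ℂ] at h3
  exact smul_right_injective _ (two_ne_zero) h3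

end Coordinates

/-! ### Kernels of decomposable forms. -/

section Decomposable

variable {E F : Type*} [NormedAddCommGroup E] [NormedSpace ℂ E]
  [NormedAddCommGroup F] [NormedSpace ℂ F]

/-- The arguments are exchanged one at a time, each exchange altering the value by a term with an
argument in the kernel. -/
lemma apply_congr_of_sub_mem_formKernel {q : ℕ} {α : E [⋀^Fin q]→L[ℂ] ℂ} {v v' : Fin q → E}
    (h : ∀ i, v i - v' i ∈ formKernel α) : α v = α v' := by
  have key : ∀ s : Finset (Fin q), α (s.piecewise v' v) = α v := by
    intro s
    induction s using Finset.induction_on with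
    | empty => simp
    | insert i s hi ih =>
      rw [← ih, Finset.piecewise_insert]
      have h1 : s.piecewise v' v = Function.update (s.piecewise v' v) i (v' i + (v i - v' i)) := by
        rw [add_sub_cancel]
        conv_lhs => rw [← Function.update_eq_self i (s.piecewise v' v)]
        rw [Finset.piecewise_eq_of_notMem _ _ _ hi]
      conv_rhs => rw [h1]
      rw [α.map_update_add, h i _ i, add_zero]
  have := key Finset.univ
  rw [Finset.piecewise_univ] at this
  exact this.symm

lemma wedgeLin_apply {q : ℕ} (ω : Fin q → (E →L[ℂ] ℂ)) (v : Fin q → E) :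
    wedgeLin ω v = Matrix.det (Matrix.of fun i j => ω j (v i)) := rfl

/-- The vectors `w i` are dual to the linear forms `ω j`. -/
def IsDualTo {q : ℕ} (w : Fin q → E) (ω : Fin q → (E →L[ℂ] ℂ)) : Prop :=
  ∀ i j, ω j (w i) = if i = j then 1 else 0

/-- At a family where the product does not vanish the matrix `ω j (v i)` is invertible; its inverse
recombines the family into a dual one. -/
lemma exists_isDualTo {q : ℕ} {ω : Fin q → (E →L[ℂ] ℂ)} (h : wedgeLin ω ≠ 0) :
    ∃ w, IsDualTo w ω := by
  obtain ⟨v, hv⟩ : ∃ v, wedgeLin ω v ≠ 0 := by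
    by_contra! hc
    exact h (ContinuousAlternatingMap.ext hc)
  rw [wedgeLin_apply] at hv
  set M : Matrix (Fin q) (Fin q) ℂ := Matrix.of fun i j => ω j (v i) with hM
  refine ⟨fun i => ∑ k, M⁻¹ i k • v k, fun i j => ?_⟩
  have h1 : M⁻¹ * M = 1 := Matrix.nonsing_inv_mul _ (isUnit_iff_ne_zero.2 hv)
  have h2 := congrFun (congrFun h1 i) j
  rw [Matrix.mul_apply, Matrix.one_apply] at h2
  rw [map_sum, ← h2]
  refine Finset.sum_congr rfl fun k _ => ?_
  rw [map_smul, hM]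
  rfl

namespace IsDualTo

variable {q : ℕ} {w : Fin q → E} {ω : Fin q → (E →L[ℂ] ℂ)}

lemma wedgeLin_apply_eq_one (h : IsDualTo w ω) : wedgeLin ω w = 1 := by
  rw [wedgeLin_apply, ← Matrix.det_one (n := Fin q) (R := ℂ)]
  congr 1
  ext i j
  simp [h i j, Matrix.one_apply]

lemma wedgeLin_update (h : IsDualTo w ω) (i : Fin q) (v : E) :
    wedgeLin ω (Function.update w i v) = ω i v := by
  have h1 : Matrix.cramer (1 : Matrix (Fin q) (Fin q) ℂ).transpose (fun j => ω j v) i = ω i v := by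
    rw [Matrix.transpose_one, Matrix.cramer_one]; rfl
  rw [Matrix.cramer_transpose_apply] at h1
  rw [← h1, wedgeLin_apply]
  congr 1
  ext k j
  by_cases hk : k = i
  · subst hk; simp
  · simp [hk, h k j, Matrix.one_apply]

end IsDualTo

lemma mem_formKernel_wedgeLin_of_forall {q : ℕ} {ω : Fin q → (E →L[ℂ] ℂ)} {v : E}
    (h : ∀ j, ω j v = 0) : v ∈ formKernel (wedgeLin ω) := by
  intro w i
  rw [wedgeLin_apply]
  exact Matrix.det_eq_zero_of_row_eq_zero i fun j => by simp [h j]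

namespace IsDualTo

variable {q : ℕ} {w : Fin q → E} {ω : Fin q → (E →L[ℂ] ℂ)}

lemma mem_formKernel_iff (h : IsDualTo w ω) {v : E} :
    v ∈ formKernel (wedgeLin ω) ↔ ∀ j, ω j v = 0 :=
  ⟨fun hv j => by rw [← h.wedgeLin_update]; exact hv w j, mem_formKernel_wedgeLin_of_forall⟩

lemma sub_sum_apply (h : IsDualTo w ω) (v : E) (j : Fin q) : ω j (v - ∑ i, ω i v • w i) = 0 := by
  rw [map_sub, map_sum]
  simp [h _ j]

lemma finrank_formKernel [FiniteDimensional ℂ E] (h : IsDualTo w ω) :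
    Module.finrank ℂ (formKernel (wedgeLin ω)) + q = Module.finrank ℂ E := by
  let f : E →ₗ[ℂ] (Fin q → ℂ) := LinearMap.pi fun j => (ω j : E →ₗ[ℂ] ℂ)
  have h1 : formKernel (wedgeLin ω) = LinearMap.ker f := by
    ext v
    rw [h.mem_formKernel_iff, LinearMap.mem_ker, funext_iff]
    rfl
  have h2 : LinearMap.range f = ⊤ := by
    rw [LinearMap.range_eq_top]
    intro c
    refine ⟨∑ i, c i • w i, ?_⟩
    funext j
    change ω j _ = _
    simp [h _ j]
  have h3 := LinearMap.finrank_range_add_finrank_ker f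
  rw [h2, finrank_top, Module.finrank_fin_fun] at h3
  rw [h1, add_comm, h3]

/-- A form annihilated by the common kernel of the `ω j` is a multiple of their product. -/
lemma eq_smul_wedgeLin (h : IsDualTo w ω) {α : E [⋀^Fin q]→L[ℂ] ℂ}
    (hα : ∀ v, (∀ j, ω j v = 0) → v ∈ formKernel α) : α = α w • wedgeLin ω := by
  ext v
  have h1 : α v = α fun i => ∑ j, ω j (v i) • w j :=
    apply_congr_of_sub_mem_formKernel fun i => hα _ fun j => h.sub_sum_apply _ _
  let T : (Fin q → ℂ) →L[ℂ] E := ∑ j, (dx j).smulRight (w j)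
  have hT : ∀ c, T c = ∑ j, c j • w j := fun c => by
    rw [sum_apply]; rfl
  have h2 := DFunLike.congr_fun (eq_smul_volForm (α.compContinuousLinearMap T))
    (fun i j => ω j (v i))
  have h3 : (fun i => T (stdVec i)) = w := by
    funext i
    rw [hT]
    simp [stdVec, Pi.single_apply]
  have h4 : (α.compContinuousLinearMap T) stdVec = α w := by
    rw [← h3]; rfl
  rw [h4] at h2
  rw [h1]
  refine Eq.trans ?_ h2
  change _ = α fun i => T fun j => ω j (v i)
  simp only [hT]

/-- Such a form is a pull-back from `Fin q → ℂ`, where every form of degree greater than `q` is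
zero. -/
lemma eq_zero_of_lt_degree (h : IsDualTo w ω) {p : ℕ} (hp : q < p) {α : E [⋀^Fin p]→L[ℂ] ℂ}
    (hα : ∀ v, (∀ j, ω j v = 0) → v ∈ formKernel α) : α = 0 := by
  ext v
  have h1 : α v = α fun i => ∑ j, ω j (v i) • w j :=
    apply_congr_of_sub_mem_formKernel fun i => hα _ fun j => h.sub_sum_apply _ _
  let T : (Fin q → ℂ) →L[ℂ] E := ∑ j, (dx j).smulRight (w j)
  have hT : ∀ c, T c = ∑ j, c j • w j := fun c => by
    rw [sum_apply]; rfl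
  have h2 := DFunLike.congr_fun (NGK.eq_zero_of_lt_degree hp (α.compContinuousLinearMap T))
    (fun i j => ω j (v i))
  rw [h1]
  refine Eq.trans ?_ h2
  change _ = α fun i => T fun j => ω j (v i)
  simp only [hT]

end IsDualTo

end Decomposable

/-! ### Linear algebra of forms restricting to `i_X ν`. -/

section Rotational

variable {q : ℕ} {W : Type*} [NormedAddCommGroup W] [NormedSpace ℂ W] [FiniteDimensional ℂ W]

/-- Since `dx_k ∧ i_X ν = X_k ν`, wedging with `dx_k` and contracting with `u` turns the hypothesis
into `X_k u = u_k X`. -/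
lemma exists_smul_eq_of_curryLeft_curryLeft_eq_zero {X u : Fin (q + 2) → ℂ} (hX : X ≠ 0)
    (h : ((volForm (q + 2)).curryLeft X).curryLeft u = 0) : ∃ c : ℂ, u = c • X := by
  have key : ∀ j k, u j * X k - u k * X j = 0 := by
    intro j k
    have h0 : extMul (dx k) (volForm (q + 2)) = 0 := eq_zero_of_lt_degree (Nat.lt_succ_self _) _
    have h1 := curryLeft_extMul (dx k) (volForm (q + 2)) X
    rw [h0] at h1
    have h2 : extMul (dx k) ((volForm (q + 2)).curryLeft X) = X k • volForm (q + 2) := by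
      have h3 : (0 : (Fin (q + 2) → ℂ) [⋀^Fin (q + 2)]→L[ℂ] ℂ) = _ := h1
      exact (sub_eq_zero.1 h3.symm).symm
    have h4 := curryLeft_extMul (dx k) ((volForm (q + 2)).curryLeft X) u
    rw [h, map_zero, sub_zero, h2] at h4
    have h5 : (volForm (q + 1 + 1)).curryLeft (X k • u) = (volForm (q + 1 + 1)).curryLeft (u k • X) := by
      rw [map_smul, map_smul]; exact h4
    have := congrFun (curryLeft_volForm_injective h5) j
    simp only [Pi.smul_apply, smul_eq_mul] at this
    linear_combination this
  obtain ⟨k, hk⟩ : ∃ k, X k ≠ 0 := by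
    by_contra! hc
    exact hX (funext hc)
  refine ⟨u k / X k, funext fun j => ?_⟩
  simp only [Pi.smul_apply, smul_eq_mul]
  field_simp
  linear_combination key j k

/-- A form of corank at least `dim E - q - 1` whose restriction to a subspace is `i_X ν ≠ 0` is
determined by its restriction. -/
lemma rotational_mem_formKernel {θ : W [⋀^Fin (q + 1)]→L[ℂ] ℂ}
    {ι : (Fin (q + 2) → ℂ) →L[ℂ] W} (hι : Function.Injective ι)
    (hθ : Module.finrank ℂ W ≤ Module.finrank ℂ (formKernel θ) + (q + 1)) {X : Fin (q + 2) → ℂ}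
    (hX : X ≠ 0) (hX' : θ.compContinuousLinearMap ι = (volForm (q + 2)).curryLeft X) :
    ι X ∈ formKernel θ ∧
      ∀ V, (θ.curryLeft V).compContinuousLinearMap ι = 0 → V ∈ formKernel θ := by
  set K := formKernel θ with hK
  let L : Submodule ℂ W := LinearMap.range (ι : (Fin (q + 2) → ℂ) →ₗ[ℂ] W)
  have hL : Module.finrank ℂ L = q + 2 := by
    rw [LinearMap.finrank_range_of_inj hι, Module.finrank_fin_fun]
  have hcurry : ∀ u, (θ.curryLeft (ι u)).compContinuousLinearMap ι =
      ((volForm (q + 2)).curryLeft X).curryLeft u := fun u => by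
    rw [← hX', ContinuousAlternatingMap.curryLeft_compContinuousLinearMap]
  have hzero : (0 : W [⋀^Fin q]→L[ℂ] ℂ).compContinuousLinearMap ι = 0 := rfl
  have hpar : ∀ u : Fin (q + 2) → ℂ, ι u ∈ K → ∃ c : ℂ, u = c • X := by
    intro u hu
    rw [hK, mem_formKernel_iff] at hu
    refine exists_smul_eq_of_curryLeft_curryLeft_eq_zero hX ?_
    rw [← hcurry, hu, hzero]
  have hsum := Submodule.finrank_sup_add_finrank_inf_eq K L
  have hXK : ι X ∈ K := by
    have h1 : Module.finrank ℂ ↥(K ⊔ L) ≤ Module.finrank ℂ W := Submodule.finrank_le _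
    -- The kernel has codimension at most `q + 1` while `L` has dimension `q + 2`, so they meet; by
    -- `hpar` they meet only along `X`.
    have h2 : K ⊓ L ≠ ⊥ := by
      intro hbot
      rw [hbot, finrank_bot] at hsum
      omega
    obtain ⟨u, hu, hu0⟩ := Submodule.exists_mem_ne_zero_of_ne_bot h2
    obtain ⟨huK, u, rfl⟩ := hu
    obtain ⟨c, rfl⟩ := hpar u huK
    have hc : c ≠ 0 := by
      rintro rfl
      simp at hu0
    have h3 := K.smul_mem c⁻¹ huK
    simpa [smul_smul, hc] using h3
  refine ⟨hXK, fun V hV => ?_⟩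
  have hinf : Module.finrank ℂ ↥(K ⊓ L) ≤ 1 := by
    have h1 : K ⊓ L ≤ Submodule.span ℂ {ι X} := by
      rintro _ ⟨huK, u, rfl⟩
      obtain ⟨c, rfl⟩ := hpar u huK
      exact Submodule.mem_span_singleton.2 ⟨c, by simp⟩
    exact (Submodule.finrank_mono h1).trans
      (finrank_span_singleton (by simpa using hι.ne hX)).le
  -- The intersection being at most a line, the sum fills `W`. Modulo the kernel, `V` is then a
  -- vector `c` of the first factor, and vanishing of the restricted contraction forces `c` to be
  -- parallel to `X`.
  have htop : K ⊔ L = ⊤ := by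
    apply Submodule.eq_top_of_finrank_eq
    have h1 : Module.finrank ℂ ↥(K ⊔ L) ≤ Module.finrank ℂ W := Submodule.finrank_le _
    omega
  obtain ⟨k, hk, _, ⟨c, rfl⟩, rfl⟩ := Submodule.mem_sup.1 (htop ▸ Submodule.mem_top : V ∈ K ⊔ L)
  have hk' := hk
  rw [hK, mem_formKernel_iff] at hk'
  rw [map_add, hk', zero_add] at hV
  obtain ⟨r, rfl⟩ := exists_smul_eq_of_curryLeft_curryLeft_eq_zero hX ((hcurry c).symm.trans hV)
  refine K.add_mem hk ?_
  have := K.smul_mem r hXK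
  simpa using this

end Rotational

/-! ### Pointwise consequences of integrability. -/

section Frobenius

variable {E F : Type*} [NormedAddCommGroup E] [NormedSpace ℂ E]
  [NormedAddCommGroup F] [NormedSpace ℂ F]

lemma mem_range_sumCongrHom_of_inr {ι κ : Type*} [Finite ι] [Finite κ] {σ : Equiv.Perm (ι ⊕ κ)}
    (h : ∀ j, ∀ i, σ (Sum.inr j) ≠ Sum.inl i) : σ ∈ (Equiv.Perm.sumCongrHom ι κ).range := by
  rw [← Subgroup.inv_mem_iff]
  refine Equiv.Perm.mem_sumCongrHom_range_of_perm_mapsTo_inl ?_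
  rintro _ ⟨i, rfl⟩
  rcases hx : σ⁻¹ (Sum.inl i) with i' | j
  · exact ⟨i', rfl⟩
  · exact absurd (Equiv.Perm.inv_eq_iff_eq.1 hx).symm (h j i)

/-- In the sum over permutations, every term feeding some `u i` to `β` vanishes. Each remaining
permutation preserves the two blocks and contributes the same product, the signs cancelling, so a
positive multiple of that product is zero. -/
lemma mul_eq_zero_of_wedge_eq_zero {k l : ℕ} {α : E [⋀^Fin k]→L[ℂ] ℂ} {β : E [⋀^Fin l]→L[ℂ] ℂ}
    (h : wedge α β = 0) {u : Fin k → E} (hu : ∀ i, u i ∈ formKernel β) (w : Fin l → E) :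
    α u * β w = 0 := by
  classical
  have h1 := MultilinearMap.domCoprod_alternization_eq α.toAlternatingMap β.toAlternatingMap
  have h2 := congrArg (LinearMap.mul' ℂ ℂ) (DFunLike.congr_fun h1 (Sum.elim u w))
  have h3 : LinearMap.mul' ℂ ℂ ((α.toAlternatingMap.domCoprod β.toAlternatingMap) (Sum.elim u w)) = 0 :=
    DFunLike.congr_fun h (Sum.elim u w)
  rw [AlternatingMap.smul_apply, map_nsmul, h3, smul_zero, MultilinearMap.alternatization_apply,
    map_sum] at h2
  have h4 : ∀ σ : Equiv.Perm (Fin k ⊕ Fin l), LinearMap.mul' ℂ ℂ (Equiv.Perm.sign σ •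
      (MultilinearMap.domDomCongr σ (MultilinearMap.domCoprod
        (α.toAlternatingMap : MultilinearMap ℂ (fun _ : Fin k => E) ℂ)
        (β.toAlternatingMap : MultilinearMap ℂ (fun _ : Fin l => E) ℂ))) (Sum.elim u w)) =
      if σ ∈ (Equiv.Perm.sumCongrHom (Fin k) (Fin l)).range then α u * β w else 0 := by
    intro σ
    have h5 : (MultilinearMap.domDomCongr σ (MultilinearMap.domCoprod
        (α.toAlternatingMap : MultilinearMap ℂ (fun _ : Fin k => E) ℂ)
        (β.toAlternatingMap : MultilinearMap ℂ (fun _ : Fin l => E) ℂ))) (Sum.elim u w) =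
        TensorProduct.tmul ℂ (α fun i => Sum.elim u w (σ (Sum.inl i)))
          (β fun i => Sum.elim u w (σ (Sum.inr i))) := rfl
    rw [h5]
    split_ifs with hσ
    · obtain ⟨⟨a, b⟩, rfl⟩ := hσ
      have h6 : (α fun i => Sum.elim u w ((Equiv.Perm.sumCongrHom (Fin k) (Fin l)) (a, b)
          (Sum.inl i))) = (Equiv.Perm.sign a : ℤ) * α u := by
        have := α.toAlternatingMap.map_perm u a
        rw [Units.smul_def, zsmul_eq_mul] at this
        exact this
      have h7 : (β fun i => Sum.elim u w ((Equiv.Perm.sumCongrHom (Fin k) (Fin l)) (a, b)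
          (Sum.inr i))) = (Equiv.Perm.sign b : ℤ) * β w := by
        have := β.toAlternatingMap.map_perm w b
        rw [Units.smul_def, zsmul_eq_mul] at this
        exact this
      rw [h6, h7, Units.smul_def, map_zsmul, LinearMap.mul'_apply, zsmul_eq_mul]
      have h8 : Equiv.Perm.sign ((Equiv.Perm.sumCongrHom (Fin k) (Fin l)) (a, b)) =
          Equiv.Perm.sign a * Equiv.Perm.sign b := Equiv.Perm.sign_sumCongr a b
      rw [h8]
      have h9 : ((Equiv.Perm.sign a : ℤ) : ℂ) * ((Equiv.Perm.sign a : ℤ) : ℂ) = 1 := by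
        rw [← Int.cast_mul, ← Units.val_mul, Int.units_mul_self, Units.val_one, Int.cast_one]
      have h10 : ((Equiv.Perm.sign b : ℤ) : ℂ) * ((Equiv.Perm.sign b : ℤ) : ℂ) = 1 := by
        rw [← Int.cast_mul, ← Units.val_mul, Int.units_mul_self, Units.val_one, Int.cast_one]
      push_cast
      calc _ = (((Equiv.Perm.sign a : ℤ) : ℂ) * ((Equiv.Perm.sign a : ℤ) : ℂ)) *
            (((Equiv.Perm.sign b : ℤ) : ℂ) * ((Equiv.Perm.sign b : ℤ) : ℂ)) * (α u * β w) := by ring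
        _ = _ := by rw [h9, h10, one_mul, one_mul]
    · have h6 : ∃ j i, σ (Sum.inr j) = Sum.inl i := by
        by_contra! hc
        exact hσ (mem_range_sumCongrHom_of_inr hc)
      obtain ⟨j, i, hji⟩ := h6
      have h7 : (β fun i => Sum.elim u w (σ (Sum.inr i))) = 0 :=
        apply_eq_zero_of_mem_formKernel (i := j) (by rw [hji]; exact hu i)
      rw [h7]
      simp
  rw [Finset.sum_congr rfl fun σ _ => h4 σ, ← Finset.sum_filter, Finset.sum_const, smul_eq_zero] at h2
  refine h2.resolve_left ?_
  rw [Finset.card_eq_zero, ← ne_eq, ← Finset.nonempty_iff_ne_empty]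
  exact ⟨1, Finset.mem_filter.2 ⟨Finset.mem_univ _, Subgroup.one_mem _⟩⟩

lemma det_update_of_kernel {r : ℕ} {ω : Fin (r + 1) → (E →L[ℂ] ℂ)} {b : Fin (r + 1) → E}
    (hb : ∀ j, ω j (b 0) = 0) (l : Fin (r + 1)) (c : Fin (r + 1) → ℂ) :
    volForm (r + 1) (Function.update (fun j i => ω j (b i)) l c) =
      (-1) ^ (l : ℕ) * c 0 * Matrix.det (Matrix.of fun j i : Fin r => ω (l.succAbove j) (b i.succ)) := by
  rw [volForm_apply, Matrix.det_succ_column_zero, Finset.sum_eq_single l]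
  · congr 2
    · simp
    · ext j i
      simp
  · intro j _ hj
    simp [hj, hb]
  · simp

lemma fderiv_wedgeLin_apply {q : ℕ} {η : E → E [⋀^Fin q]→L[ℂ] ℂ} {ω : Fin q → E → (E →L[ℂ] ℂ)}
    {p : E} (hη : DifferentiableAt ℂ η p) (hω : ∀ j, DifferentiableAt ℂ (ω j) p)
    (h : ∀ᶠ x in 𝓝 p, η x = wedgeLin fun j => ω j x) (a : E) (b : Fin q → E) :
    fderiv ℂ η p a b = ∑ l, volForm q
      (Function.update (fun j i => ω j p (b i)) l fun i => fderiv ℂ (ω l) p a (b i)) := by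
  have h1 : fderiv ℂ η p a b = fderiv ℂ (fun x => η x b) p a :=
    (fderiv_continuousAlternatingMap_apply_const_apply hη b a).symm
  have h2 : (fun x => η x b) =ᶠ[𝓝 p] fun x => volForm q fun j i => ω j x (b i) := by
    filter_upwards [h] with x hx
    rw [hx, wedgeLin_apply, volForm_apply, ← Matrix.det_transpose]
    rfl
  have h3 : HasFDerivAt (fun x => fun j i => ω j x (b i))
      (ContinuousLinearMap.pi fun j => ContinuousLinearMap.pi fun i =>
        (fderiv ℂ (ω j) p).flip (b i)) p := by
    refine hasFDerivAt_pi.2 fun j => hasFDerivAt_pi.2 fun i => ?_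
    have := (hω j).hasFDerivAt.clm_apply (hasFDerivAt_const (b i) p)
    simpa using this
  have h4 := ((volForm q).hasFDerivAt (fun j i => ω j p (b i))).comp p h3
  rw [h1, h2.fderiv_eq]
  refine (DFunLike.congr_fun h4.fderiv a).trans ?_
  rw [ContinuousLinearMap.comp_apply, ContinuousMultilinearMap.linearDeriv_apply]
  rfl

/-- By the Leibniz rule one row of the determinant is differentiated. A derivative along some `w i`
leaves both `u` and `u'` as arguments, which give zero in all other rows; the derivatives along `u`
and `u'` cancel by `hs`. -/
lemma extDeriv_apply_eq_zero_of_kernel {r : ℕ} {η : E → E [⋀^Fin (r + 1)]→L[ℂ] ℂ}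
    {ω : Fin (r + 1) → E → (E →L[ℂ] ℂ)}
    {p : E} (hη : DifferentiableAt ℂ η p) (hω : ∀ j, DifferentiableAt ℂ (ω j) p)
    (h : ∀ᶠ x in 𝓝 p, η x = wedgeLin fun j => ω j x) {u u' : E} (hu : ∀ j, ω j p u = 0)
    (hu' : ∀ j, ω j p u' = 0) (hs : ∀ j, fderiv ℂ (ω j) p u u' = fderiv ℂ (ω j) p u' u)
    (w : Fin r → E) :
    extDeriv η p (Matrix.vecCons u (Matrix.vecCons u' w)) = 0 := by
  rw [extDeriv, ContinuousAlternatingMap.alternatizeUncurryFin_apply, Fin.sum_univ_succ,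
    Fin.sum_univ_succ, ← add_assoc]
  have h1 : ∀ i : Fin r, fderiv ℂ η p (Matrix.vecCons u (Matrix.vecCons u' w) i.succ.succ)
      (i.succ.succ.removeNth (Matrix.vecCons u (Matrix.vecCons u' w))) = 0 := by
    intro i
    rw [fderiv_wedgeLin_apply hη hω h]
    refine Finset.sum_eq_zero fun l _ => ?_
    rw [det_update_of_kernel (fun j => ?_)]
    · cases r with
      | zero => exact i.elim0
      | succ r =>
        rw [Matrix.det_eq_zero_of_column_eq_zero (0 : Fin (r + 1)) fun j => ?_, mul_zero]
        have : i.succ.succ.removeNth (Matrix.vecCons u (Matrix.vecCons u' w)) (Fin.succ 0) = u' := by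
          simp [Fin.removeNth, Fin.succ_succAbove_one]
        rw [Matrix.of_apply, this, hu']
    · have : i.succ.succ.removeNth (Matrix.vecCons u (Matrix.vecCons u' w)) 0 = u := by
        simp [Fin.removeNth]
      rw [this, hu]
  rw [Finset.sum_eq_zero fun i _ => by rw [h1 i, smul_zero], add_zero]
  have e0 : (0 : Fin (r + 2)).removeNth (Matrix.vecCons u (Matrix.vecCons u' w)) =
      Matrix.vecCons u' w := rfl
  have e1 : (Fin.succ 0 : Fin (r + 2)).removeNth (Matrix.vecCons u (Matrix.vecCons u' w)) =
      Matrix.vecCons u w := by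
    funext i
    refine Fin.cases ?_ (fun i => ?_) i
    · simp [Fin.removeNth]
    · simp [Fin.removeNth]
  rw [e0, e1, fderiv_wedgeLin_apply hη hω h, fderiv_wedgeLin_apply hη hω h]
  simp only [Fin.val_zero, pow_zero, one_smul, Fin.val_succ, zero_add, pow_one, neg_smul,
    Matrix.cons_val_zero, Matrix.cons_val_succ]
  rw [← sub_eq_add_neg, sub_eq_zero]
  refine Finset.sum_congr rfl fun l _ => ?_
  rw [det_update_of_kernel (by simpa using hu'), det_update_of_kernel (by simpa using hu)]
  simp [hs l]

/-- **Frobenius condition**, pointwise consequences: for an integrable `q`-form, the kernel of `dη`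
has codimension at most `q + 1`, and it is contained in the kernel of `η` unless `dη = 0`. -/
theorem formKernel_extDeriv_of_integrable [FiniteDimensional ℂ E] {q : ℕ} (hq : 1 ≤ q)
    {η : E → E [⋀^Fin q]→L[ℂ] ℂ} {ω : Fin q → E → (E →L[ℂ] ℂ)}
    {p : E} (hη : DifferentiableAt ℂ η p) (hω : ∀ j, DifferentiableAt ℂ (ω j) p)
    (h : ∀ᶠ x in 𝓝 p, η x = wedgeLin fun j => ω j x)
    (hw : ∀ j, wedge (extDeriv (oneForm (ω j)) p) (η p) = 0) (h0 : η p ≠ 0) :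
    Module.finrank ℂ E ≤ Module.finrank ℂ (formKernel (extDeriv η p)) + (q + 1) ∧
      (extDeriv η p ≠ 0 → formKernel (extDeriv η p) ≤ formKernel (η p)) := by
  obtain ⟨r, rfl⟩ : ∃ r, q = r + 1 := ⟨q - 1, by omega⟩
  have hp := h.self_of_nhds
  obtain ⟨w, hdual⟩ := exists_isDualTo (hp ▸ h0)
  set K := formKernel (η p) with hK
  have hmem : ∀ v, v ∈ K ↔ ∀ j, ω j p v = 0 := fun v => by
    rw [hK, hp]; exact hdual.mem_formKernel_iff
  have hηw : η p w = 1 := by rw [hp]; exact hdual.wedgeLin_apply_eq_one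
  -- This is `dω_j (u, u') = 0`, obtained by evaluating `dω_j ∧ η = 0` on `u`, `u'` and a dual
  -- family, on which `η` equals 1.
  have hsymm : ∀ u ∈ K, ∀ u' ∈ K, ∀ j, fderiv ℂ (ω j) p u u' = fderiv ℂ (ω j) p u' u := by
    intro u hu u' hu' j
    have h1 := mul_eq_zero_of_wedge_eq_zero (hw j) (u := ![u, u'])
      (fun i => by fin_cases i <;> assumption) w
    rw [hηw, mul_one, extDeriv, ContinuousAlternatingMap.alternatizeUncurryFin_apply,
      Fin.sum_univ_two] at h1
    have h2 : ∀ v : Fin 1 → E, ∀ a, fderiv ℂ (oneForm (ω j)) p a v = fderiv ℂ (ω j) p a (v 0) := by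
      intro v a
      have hdiff : DifferentiableAt ℂ (oneForm (ω j)) p :=
        (ContinuousAlternatingMap.ofSubsingletonLIE (𝕜 := ℂ) (E := E) (F := ℂ) (0 : Fin 1)).differentiableAt.comp p (hω j)
      rw [← fderiv_continuousAlternatingMap_apply_const_apply hdiff]
      change fderiv ℂ (fun x => ω j x (v 0)) p a = _
      rw [fderiv_clm_apply (hω j) (differentiableAt_const _)]
      simp
    rw [h2, h2] at h1
    simp [Fin.removeNth] at h1
    linear_combination h1
  have hd : ∀ u ∈ K, ∀ u' ∈ K, ((extDeriv η p).curryLeft u).curryLeft u' = 0 := by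
    intro u hu u' hu'
    ext v
    exact extDeriv_apply_eq_zero_of_kernel hη hω h ((hmem u).1 hu) ((hmem u').1 hu')
      (hsymm u hu u' hu') v
  -- For `u` in the kernel of `η`, the contraction `i_u dη` is again annihilated by that kernel and
  -- has degree `q`, hence is a multiple of `η`. The factor is the linear form `lam`, whose kernel,
  -- of codimension at most `q + 1` in `E`, annihilates `dη`.
  have hc : ∀ u ∈ K, (extDeriv η p).curryLeft u = (extDeriv η p).curryLeft u w • η p := by
    intro u hu
    rw [hp]
    refine hdual.eq_smul_wedgeLin fun v hv => ?_
    rw [mem_formKernel_iff]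
    exact hd u hu v ((hmem v).2 hv)
  let lam : K →ₗ[ℂ] ℂ :=
    { toFun := fun u => (extDeriv η p).curryLeft u w
      map_add' := fun a b => by simp
      map_smul' := fun a b => by simp }
  constructor
  · have h1 := hdual.finrank_formKernel
    rw [← hp, ← hK] at h1
    have h2 := LinearMap.finrank_range_add_finrank_ker lam
    have h3 : Module.finrank ℂ (LinearMap.range lam) ≤ 1 := by
      simpa using Submodule.finrank_le (LinearMap.range lam)
    have h4 : Module.finrank ℂ (LinearMap.ker lam) ≤ Module.finrank ℂ (formKernel (extDeriv η p)) := by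
      rw [← Submodule.finrank_map_subtype_eq]
      refine Submodule.finrank_mono ?_
      rintro _ ⟨u, hu, rfl⟩
      rw [mem_formKernel_iff, K.subtype_apply, hc u u.2]
      have : (extDeriv η p).curryLeft u w = 0 := hu
      rw [this]
      exact zero_smul ℂ _
    omega
  · intro hne v hv
    -- If `lam` vanishes, the kernel of `η` annihilates the `(q + 1)`-form `dη`, which must then be
    -- zero. Otherwise `η` is a multiple of some `i_u dη` and inherits its kernel.
    by_cases hlam : lam = 0
    · refine absurd ?_ hne
      refine hdual.eq_zero_of_lt_degree (Nat.lt_succ_self _) fun u hu => ?_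
      have h1 := (hmem u).2 hu
      rw [mem_formKernel_iff, hc u h1]
      have : (extDeriv η p).curryLeft u w = 0 := DFunLike.congr_fun hlam ⟨u, h1⟩
      rw [this]
      exact zero_smul ℂ _
    · obtain ⟨u, hu⟩ : ∃ u, lam u ≠ 0 := by
        by_contra! hcon
        exact hlam (LinearMap.ext hcon)
      have h1 := hc u u.2
      have h2 : η p = (lam u)⁻¹ • (extDeriv η p).curryLeft u := by
        rw [h1]
        exact (inv_smul_smul₀ hu _).symm
      intro b i
      rw [h2, ContinuousAlternatingMap.smul_apply, ContinuousAlternatingMap.curryLeft_apply_apply]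
      have : Matrix.vecCons (u : E) (Function.update b i v) =
          Function.update (Matrix.vecCons (u : E) b) i.succ v := by
        funext k
        refine Fin.cases ?_ (fun k => ?_) k
        · simp [Function.update_of_ne (Fin.succ_ne_zero i).symm]
        · by_cases hk : k = i
          · subst hk; simp
          · simp [hk]
      rw [this, hv, smul_zero]

end Frobenius

/-! ### Analyticity and integrability of pull-backs. -/

section Pullback

variable {E F G : Type*} [NormedAddCommGroup E] [NormedSpace ℂ E]
  [NormedAddCommGroup F] [NormedSpace ℂ F] [NormedAddCommGroup G] [NormedSpace ℂ G]

/-- The projection of multilinear maps onto alternating maps. -/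
def altProj (E : Type*) [NormedAddCommGroup E] [NormedSpace ℂ E] (q : ℕ) :
    ContinuousMultilinearMap ℂ (fun _ : Fin q => E) ℂ →L[ℂ] E [⋀^Fin q]→L[ℂ] ℂ :=
  ((q.factorial : ℂ)⁻¹) • LinearMap.mkContinuous
    { toFun := ContinuousMultilinearMap.alternatization
      map_add' := map_add _
      map_smul' := fun c f => by
        ext v
        simp only [ContinuousMultilinearMap.alternatization_apply_apply,
          smul_apply, ContinuousAlternatingMap.smul_apply, Finset.smul_sum,
          RingHom.id_apply]
        exact Finset.sum_congr rfl fun σ _ => smul_comm _ _ _ }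
    (Fintype.card (Equiv.Perm (Fin q))) fun f => by
      refine ContinuousAlternatingMap.opNorm_le_bound _ (by positivity) fun v => ?_
      change ‖ContinuousMultilinearMap.alternatization f v‖ ≤ _
      rw [ContinuousMultilinearMap.alternatization_apply_apply]
      refine (norm_sum_le _ _).trans ?_
      rw [mul_assoc, ← nsmul_eq_mul]
      refine Finset.sum_le_card_nsmul _ _ _ fun σ _ => ?_
      rw [Units.smul_def, norm_isUnit_zsmul _ (Units.isUnit _)]
      refine (f.le_opNorm _).trans (le_of_eq ?_)
      congr 1
      exact Equiv.prod_comp σ fun i => ‖v i‖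

lemma altProj_coe {q : ℕ} (α : E [⋀^Fin q]→L[ℂ] ℂ) :
    altProj E q α.toContinuousMultilinearMap = α := by
  ext v
  change ((q.factorial : ℂ)⁻¹) •
    ContinuousMultilinearMap.alternatization α.toContinuousMultilinearMap v = _
  rw [ContinuousMultilinearMap.alternatization_apply_apply]
  have h : ∀ σ : Equiv.Perm (Fin q), Equiv.Perm.sign σ • α.toContinuousMultilinearMap (v ∘ σ) = α v := by
    intro σ
    change Equiv.Perm.sign σ • α.toAlternatingMap (v ∘ σ) = _
    rw [AlternatingMap.map_perm, smul_smul, Int.units_mul_self, one_smul]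
    rfl
  rw [Finset.sum_congr rfl fun σ _ => h σ, Finset.sum_const, Finset.card_univ, Fintype.card_perm,
    Fintype.card_fin, ← Nat.cast_smul_eq_nsmul ℂ, smul_smul,
    inv_mul_cancel₀ (by exact_mod_cast Nat.factorial_ne_zero q), one_smul]

/-- Composition is analytic for multilinear maps; the bounded projection `altProj` brings the result
back to alternating maps. -/
lemma analyticAt_compContinuousLinearMap {q : ℕ} {α : G → F [⋀^Fin q]→L[ℂ] ℂ} {g : G → E →L[ℂ] F}
    {x : G} (hα : AnalyticAt ℂ α x) (hg : AnalyticAt ℂ g x) :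
    AnalyticAt ℂ (fun y => (α y).compContinuousLinearMap (g y)) x := by
  have h1 : AnalyticAt ℂ (fun y => (α y).toContinuousMultilinearMap) x :=
    ((ContinuousAlternatingMap.toContinuousMultilinearMapCLM ℂ (𝕜 := ℂ) (E := F) (F := ℂ)
      (ι := Fin q)).analyticAt _).comp hα
  have h2 : AnalyticAt ℂ (fun y => ((fun _ : Fin q => g y), (α y).toContinuousMultilinearMap)) x :=
    (AnalyticAt.pi fun _ => hg).prod h1
  have h3 : AnalyticAt ℂ (fun y =>
      (α y).toContinuousMultilinearMap.compContinuousLinearMap fun _ => g y) x :=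
    AnalyticAt.fun_comp (f := fun y => ((fun _ : Fin q => g y), (α y).toContinuousMultilinearMap))
      (g := fun p => p.2.compContinuousLinearMap p.1)
      ContinuousMultilinearMap.analyticAt_uncurry_compContinuousLinearMap h2
  have h4 := ((altProj E q).analyticAt _).fun_comp h3
  refine h4.congr (Eventually.of_forall fun y => ?_)
  exact altProj_coe ((α y).compContinuousLinearMap (g y))

lemma analyticAt_pullback {q : ℕ} {f : E → F} {ω : F → F [⋀^Fin q]→L[ℂ] ℂ} {x : E}
    [CompleteSpace F] (hω : AnalyticAt ℂ ω (f x)) (hf : AnalyticAt ℂ f x) :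
    AnalyticAt ℂ (pullback f ω) x :=
  analyticAt_compContinuousLinearMap (hω.comp hf) hf.fderiv

lemma analyticAt_extDeriv {q : ℕ} {ω : E → E [⋀^Fin q]→L[ℂ] ℂ} {x : E} (hω : AnalyticAt ℂ ω x) :
    AnalyticAt ℂ (extDeriv ω) x :=
  ((ContinuousAlternatingMap.alternatizeUncurryFinCLM ℂ E ℂ).analyticAt _).fun_comp hω.fderiv

lemma extDeriv_pullback_apply {q : ℕ} {f : E → F} {ω : F → F [⋀^Fin q]→L[ℂ] ℂ} {x : E}
    [CompleteSpace F] (hω : AnalyticAt ℂ ω (f x)) (hf : AnalyticAt ℂ f x) :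
    extDeriv (pullback f ω) x = pullback f (extDeriv ω) x :=
  extDeriv_pullback hω.differentiableAt (hf.contDiffAt (n := 2)) (by simp)

lemma extDeriv_extDeriv_of_analyticAt {q : ℕ} {ω : E → E [⋀^Fin q]→L[ℂ] ℂ} {x : E}
    (hω : AnalyticAt ℂ ω x) [CompleteSpace E] : extDeriv (extDeriv ω) x = 0 :=
  extDeriv_extDeriv_apply (hω.contDiffAt (n := 2)) (by simp)

lemma pullback_comp {q : ℕ} {f : E → F} {g : G → E} {ω : F → F [⋀^Fin q]→L[ℂ] ℂ} {x : G}
    (hf : DifferentiableAt ℂ f (g x)) (hg : DifferentiableAt ℂ g x) :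
    pullback (f ∘ g) ω x = pullback g (pullback f ω) x := by
  ext v
  rw [pullback, pullback, pullback, fderiv_comp x hf hg]
  rfl

lemma pullback_congr {q : ℕ} {f f' : E → F} {ω : F → F [⋀^Fin q]→L[ℂ] ℂ} {x : E}
    (h : f =ᶠ[𝓝 x] f') : pullback f ω x = pullback f' ω x := by
  rw [pullback, pullback, h.fderiv_eq, h.eq_of_nhds]

/-- Up to the nonzero factorials, the exterior product is a full alternatization, and this visibly
commutes with composition. -/
lemma wedge_comp_eq_zero {k l : ℕ} {α : F [⋀^Fin k]→L[ℂ] ℂ} {β : F [⋀^Fin l]→L[ℂ] ℂ}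
    (h : wedge α β = 0) (g : E →L[ℂ] F) :
    wedge (α.compContinuousLinearMap g) (β.compContinuousLinearMap g) = 0 := by
  ext v
  have h1 := MultilinearMap.domCoprod_alternization_eq α.toAlternatingMap β.toAlternatingMap
  have h2 := MultilinearMap.domCoprod_alternization_eq
    (α.compContinuousLinearMap g).toAlternatingMap (β.compContinuousLinearMap g).toAlternatingMap
  have h3 := congrArg (LinearMap.mul' ℂ ℂ) (DFunLike.congr_fun h1 (g ∘ v))
  have h4 := congrArg (LinearMap.mul' ℂ ℂ) (DFunLike.congr_fun h2 v)
  have h5 : LinearMap.mul' ℂ ℂ ((α.toAlternatingMap.domCoprod β.toAlternatingMap) (g ∘ v)) = 0 :=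
    DFunLike.congr_fun h (g ∘ v)
  rw [AlternatingMap.smul_apply, map_nsmul, h5, smul_zero, MultilinearMap.alternatization_apply] at h3
  rw [AlternatingMap.smul_apply, map_nsmul, MultilinearMap.alternatization_apply] at h4
  have h6 := h4.symm.trans h3
  rw [smul_eq_zero] at h6
  exact h6.resolve_left (by positivity)

lemma _root_.NGK.IsIntegrable.pullback [CompleteSpace E] [CompleteSpace F] {q : ℕ} {f : E → F}
    {η : F → F [⋀^Fin q]→L[ℂ] ℂ} (hη : IsIntegrable η) (hf : AnalyticAt ℂ f 0) (hf0 : f 0 = 0) :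
    IsIntegrable (pullback f η) := by
  have hη0 : AnalyticAt ℂ η (f 0) := hf0 ▸ hη.1
  refine ⟨analyticAt_pullback hη0 hf, ?_⟩
  have ht : Tendsto f (𝓝 0) (𝓝 0) := by
    have := hf.continuousAt.tendsto
    rwa [hf0] at this
  filter_upwards [ht.eventually hη.2, hf.eventually_analyticAt] with p hp hfp hne
  have hne' : η (f p) ≠ 0 := by
    intro h
    apply hne
    rw [NGK.pullback, h]
    ext v
    rfl
  obtain ⟨ω, hω, hev⟩ := hp hne'
  refine ⟨fun i x => (ω i (f x)).comp (fderiv ℂ f x), fun i => ?_, ?_⟩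
  · exact ((ContinuousLinearMap.compL ℂ E F ℂ).analyticAt_bilinear _).fun_comp
      (((hω i).comp hfp).prod hfp.fderiv)
  · have hωe : ∀ᶠ y in 𝓝 (f p), ∀ i, AnalyticAt ℂ (ω i) y :=
      eventually_all.2 fun i => (hω i).eventually_analyticAt
    filter_upwards [hfp.continuousAt.eventually hev, hfp.continuousAt.eventually hωe,
      hfp.eventually_analyticAt] with x hx hωx hfx
    constructor
    · rw [NGK.pullback, hx.1]
      rfl
    · intro i
      have h1 : AnalyticAt ℂ (oneForm (ω i)) (f x) :=
        ((ContinuousAlternatingMap.ofSubsingletonLIE (𝕜 := ℂ) (E := F) (F := ℂ) (0 : Fin 1) :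
          (F →L[ℂ] ℂ) →L[ℂ] F [⋀^Fin 1]→L[ℂ] ℂ).analyticAt _).comp (hωx i)
      have h2 : oneForm (fun x => (ω i (f x)).comp (fderiv ℂ f x)) = NGK.pullback f (oneForm (ω i)) := by
        funext y
        ext v
        rfl
      rw [h2, extDeriv_pullback_apply h1 hfx]
      exact wedge_comp_eq_zero (hx.2 i) _

end Pullback

/-! ### Coordinate expansion of forms and polynomial maps. -/

section Expansion

variable {m q : ℕ}

lemma wedgeLin_proj_stdVec (σ τ : Fin q ↪o Fin m) :
    wedgeLin (fun i => ContinuousLinearMap.proj (R := ℂ) (φ := fun _ : Fin m => ℂ) (σ i))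
      (fun i => stdVec (τ i)) = if σ = τ then 1 else 0 := by
  rw [wedgeLin_apply]
  split_ifs with h
  · subst h
    rw [← Matrix.det_one (n := Fin q) (R := ℂ)]
    congr 1
    ext i j
    simp [stdVec, Matrix.one_apply, Pi.single_apply, eq_comm]
  · have h1 : ∃ l, ∀ i, τ i ≠ σ l := by
      by_contra! hc
      apply h
      have h2 : Set.range σ ⊆ Set.range τ := by
        rintro _ ⟨l, rfl⟩
        obtain ⟨i, hi⟩ := hc l
        exact ⟨i, hi⟩
      have h3 : Set.range σ = Set.range τ := by
        refine Set.eq_of_subset_of_ncard_le h2 ?_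
        rw [← Set.image_univ, ← Set.image_univ, Set.ncard_image_of_injective _ σ.injective,
          Set.ncard_image_of_injective _ τ.injective]
      exact OrderEmbedding.range_inj.1 h3
    obtain ⟨l, hl⟩ := h1
    refine Matrix.det_eq_zero_of_column_eq_zero l fun i => ?_
    simp [stdVec, Ne.symm (hl i)]

/-- It suffices to compare values on families of distinct basis vectors. Sorting the indices changes
both sides by the same sign and reduces to increasing families, where only one summand survives. -/
lemma eq_sum_wedgeLin (β : (Fin m → ℂ) [⋀^Fin q]→L[ℂ] ℂ) :
    β = ∑ σ : Fin q ↪o Fin m, β (fun i => stdVec (σ i)) •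
      wedgeLin (fun i => ContinuousLinearMap.proj (R := ℂ) (φ := fun _ : Fin m => ℂ) (σ i)) := by
  apply ContinuousAlternatingMap.toAlternatingMap_injective
  refine Module.Basis.ext_alternating (Pi.basisFun ℂ (Fin m)) fun v hv => ?_
  have hb : ∀ i, Pi.basisFun ℂ (Fin m) i = stdVec i := fun i => by simp [stdVec]
  simp only [hb]
  have hs : StrictMono (v ∘ Tuple.sort v) :=
    (Tuple.monotone_sort v).strictMono_of_injective (hv.comp (Tuple.sort v).injective)
  let τ : Fin q ↪o Fin m := OrderEmbedding.ofStrictMono _ hs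
  set γ := ∑ σ : Fin q ↪o Fin m, β (fun i => stdVec (σ i)) •
      wedgeLin (fun i => ContinuousLinearMap.proj (R := ℂ) (φ := fun _ : Fin m => ℂ) (σ i)) with hγ
  have h1 : β (fun i => stdVec (τ i)) = γ fun i => stdVec (τ i) := by
    rw [hγ, ContinuousAlternatingMap.sum_apply]
    simp only [ContinuousAlternatingMap.smul_apply, wedgeLin_proj_stdVec]
    simp
  have h2 := β.toAlternatingMap.map_perm (fun i => stdVec (v i)) (Tuple.sort v)
  have h3 := γ.toAlternatingMap.map_perm (fun i => stdVec (v i)) (Tuple.sort v)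
  have h4 := h2.symm.trans (h1.trans h3)
  exact smul_left_cancel _ h4

/-- Alternating forms with polynomial coefficients. -/
lemma polyForm_eq_of_forall {A : (Fin q ↪o Fin m) → MvPolynomial (Fin m) ℂ} {x : Fin m → ℂ}
    {β : (Fin m → ℂ) [⋀^Fin q]→L[ℂ] ℂ}
    (h : ∀ σ, MvPolynomial.eval x (A σ) = β fun i => stdVec (σ i)) : polyForm A x = β := by
  conv_rhs => rw [eq_sum_wedgeLin β]
  simp only [polyForm, h]

end Expansion

/-- A homogeneous polynomial map is given by homogeneous polynomials. -/
lemma exists_mvPolynomial_eq {m d : ℕ} (p : ContinuousMultilinearMap ℂ (fun _ : Fin d => Fin m → ℂ) ℂ) :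
    ∃ P : MvPolynomial (Fin m) ℂ, P.IsHomogeneous d ∧ ∀ x, MvPolynomial.eval x P = p fun _ => x := by
  refine ⟨∑ f : Fin d → Fin m, MvPolynomial.C (p fun i => stdVec (f i)) *
    ∏ i, MvPolynomial.X (f i), ?_, fun x => ?_⟩
  · refine MvPolynomial.IsHomogeneous.sum _ _ _ fun f _ => ?_
    have h1 := MvPolynomial.IsHomogeneous.prod Finset.univ (fun i : Fin d => MvPolynomial.X (R := ℂ) (f i))
      (fun _ => 1) fun i _ => MvPolynomial.isHomogeneous_X _ _
    simpa using (MvPolynomial.isHomogeneous_C _ (p fun i => stdVec (f i))).mul h1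
  · conv_rhs => rw [← sum_smul_stdVec x]
    have h := p.toMultilinearMap.map_sum fun _ j => x j • stdVec j
    refine Eq.trans ?_ h.symm
    rw [map_sum]
    refine Finset.sum_congr rfl fun f _ => ?_
    have h2 := p.toMultilinearMap.map_smul_univ (fun i => x (f i)) fun i => stdVec (f i)
    refine Eq.trans ?_ h2.symm
    simp [mul_comm]

/-! ### One-parameter groups and equivariant germs. -/

section OneParameter

variable {E : Type*} [NormedAddCommGroup E] [NormedSpace ℂ E] [CompleteSpace E]

/-- The one-parameter group `e^{tA}`. -/
def expGrp (A : E →L[ℂ] E) (t : ℂ) : E →L[ℂ] E := NormedSpace.exp (t • A)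

lemma hasDerivAt_expGrp (A : E →L[ℂ] E) (t : ℂ) : HasDerivAt (expGrp A) (A * expGrp A t) t :=
  hasDerivAt_exp_smul_const' A t

lemma hasDerivAt_expGrp' (A : E →L[ℂ] E) (t : ℂ) : HasDerivAt (expGrp A) (expGrp A t * A) t :=
  hasDerivAt_exp_smul_const A t

lemma expGrp_zero (A : E →L[ℂ] E) : expGrp A 0 = 1 := by
  simp [expGrp]

lemma expGrp_neg_mul (A : E →L[ℂ] E) (t : ℂ) : expGrp A (-t) * expGrp A t = 1 := by
  let _ : NormedAlgebra ℚ (E →L[ℂ] E) := .restrictScalars ℚ ℂ _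
  rw [expGrp, expGrp, ← NormedSpace.exp_add_of_commute (((Commute.refl A).smul_left _).smul_right _),
    ← add_smul, neg_add_cancel, zero_smul, NormedSpace.exp_zero]

lemma expGrp_mul_neg (A : E →L[ℂ] E) (t : ℂ) : expGrp A t * expGrp A (-t) = 1 := by
  simpa using expGrp_neg_mul A (-t)

lemma expGrp_scalar_add (c : ℂ) (B : E →L[ℂ] E) (t : ℂ) :
    expGrp (c • 1 + B) t = Complex.exp (t * c) • expGrp B t := by
  let _ : NormedAlgebra ℚ (E →L[ℂ] E) := .restrictScalars ℚ ℂ _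
  rw [expGrp, expGrp, smul_add, NormedSpace.exp_add_of_commute
    ((((Commute.one_left B).smul_left c).smul_left t).smul_right t), smul_smul,
    ← Algebra.algebraMap_eq_smul_one, ← NormedSpace.algebraMap_exp_comm,
    Algebra.algebraMap_eq_smul_one, smul_mul_assoc, one_mul, Complex.exp_eq_exp_ℂ]

lemma expGrp_eq_sum {B : E →L[ℂ] E} {r : ℕ} (hB : B ^ r = 0) (t : ℂ) :
    expGrp B t = ∑ j ∈ Finset.range r, ((j.factorial : ℂ)⁻¹ * t ^ j) • B ^ j := by
  rw [expGrp, NormedSpace.exp_eq_tsum ℂ]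
  refine (tsum_eq_sum (s := Finset.range r) ?_).trans ?_
  · intro j hj
    rw [smul_pow, pow_eq_zero_of_le (by simpa using hj) hB, smul_zero, smul_zero]
  · refine Finset.sum_congr rfl fun j _ => ?_
    rw [smul_pow, smul_smul]

/-- For nilpotent `B` the exponential series is a polynomial in `t`; this growth is later beaten by
a scalar exponential. -/
lemma exists_norm_expGrp_le {B : E →L[ℂ] E} {r : ℕ} (hB : B ^ r = 0) :
    ∃ C : ℝ, 0 ≤ C ∧ ∀ t : ℂ, ‖expGrp B t‖ ≤ C * (1 + ‖t‖) ^ r := by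
  refine ⟨∑ j ∈ Finset.range r, ‖B ^ j‖, by positivity, fun t => ?_⟩
  rw [expGrp_eq_sum hB, Finset.sum_mul]
  refine norm_sum_le_of_le _ fun j hj => ?_
  rw [norm_smul, mul_comm]
  refine mul_le_mul_of_nonneg_left ?_ (norm_nonneg _)
  rw [norm_mul, norm_inv, norm_pow, Complex.norm_natCast]
  have h1 : ((j.factorial : ℝ))⁻¹ ≤ 1 := inv_le_one_of_one_le₀ (by exact_mod_cast j.factorial_pos)
  have h2 : ‖t‖ ^ j ≤ (1 + ‖t‖) ^ r :=
    (pow_le_pow_left₀ (norm_nonneg t) (by linarith) j).trans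
      (pow_le_pow_right₀ (by linarith [norm_nonneg t]) (Finset.mem_range.1 hj).le)
  calc _ ≤ 1 * (1 + ‖t‖) ^ r := mul_le_mul h1 h2 (by positivity) zero_le_one
    _ = _ := one_mul _

/-- A vector field `X` with `DX(z)(A z) = A' X(z)` is equivariant. -/
lemma eventually_equivariant {X : E → E} (hX : AnalyticAt ℂ X 0) {A A' : E →L[ℂ] E}
    (h : ∀ᶠ z in 𝓝 0, fderiv ℂ X z (A z) = A' (X z)) (t : ℂ) :
    ∀ᶠ z in 𝓝 0, X (expGrp A t z) = expGrp A' t (X z) := by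
  obtain ⟨δ, hδ, hball⟩ := Metric.eventually_nhds_iff_ball.1 (h.and hX.eventually_analyticAt)
  have hcont : Continuous (expGrp A) :=
    continuous_iff_continuousAt.2 fun s => (hasDerivAt_expGrp A s).continuousAt
  obtain ⟨M, hM⟩ := (isCompact_closedBall (0 : ℂ) (‖t‖ + 1)).exists_bound_of_continuousOn
    hcont.continuousOn
  have hM0 : 0 ≤ M := (norm_nonneg _).trans (hM 0 (by simp; positivity))
  filter_upwards [Metric.ball_mem_nhds (0 : E) (show 0 < δ / (M + 1) by positivity)] with z hz
  have hz' : ∀ s ∈ Metric.ball (0 : ℂ) (‖t‖ + 1), expGrp A s z ∈ Metric.ball (0 : E) δ := by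
    intro s hs
    rw [mem_ball_zero_iff] at hz ⊢
    calc ‖expGrp A s z‖ ≤ M * ‖z‖ := (expGrp A s).le_of_opNorm_le (hM s (Metric.ball_subset_closedBall hs)) z
      _ ≤ (M + 1) * ‖z‖ := mul_le_mul_of_nonneg_right (by linarith) (norm_nonneg _)
      _ < (M + 1) * (δ / (M + 1)) := mul_lt_mul_of_pos_left hz (by positivity)
      _ = δ := by field_simp
  -- The function `e^{-sA'} X(e^{sA} z)` has zero derivative. The neighbourhood of `z` was chosen so
  -- that the orbit stays in the domain for all `s` in a disc containing `t`.
  have hder : ∀ s ∈ Metric.ball (0 : ℂ) (‖t‖ + 1),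
      HasDerivAt (fun s => expGrp A' (-s) (X (expGrp A s z))) 0 s := by
    intro s hs
    obtain ⟨h1, h2⟩ := hball _ (hz' s hs)
    have d1 : HasDerivAt (fun s => expGrp A s z) ((A * expGrp A s) z) s := by
      simpa using (hasDerivAt_expGrp A s).clm_apply (hasDerivAt_const s z)
    have d2 : HasDerivAt (fun s => X (expGrp A s z)) (fderiv ℂ X (expGrp A s z) ((A * expGrp A s) z)) s :=
      h2.differentiableAt.hasFDerivAt.comp_hasDerivAt s d1
    have d3 : HasDerivAt (fun s => expGrp A' (-s)) (-(expGrp A' (-s) * A')) s := by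
      have := (hasDerivAt_expGrp' A' (-s)).scomp s (hasDerivAt_neg s)
      rw [neg_one_smul] at this
      exact this
    have d4 := d3.clm_apply d2
    convert d4 using 1
    rw [mul_apply_eq_comp, h1]
    simp
  have h0 : (0 : ℂ) ∈ Metric.ball (0 : ℂ) (‖t‖ + 1) := by simp; positivity
  have ht : t ∈ Metric.ball (0 : ℂ) (‖t‖ + 1) := by simp
  have hc := Metric.isOpen_ball.is_const_of_deriv_eq_zero
    (convex_ball (0 : ℂ) (‖t‖ + 1)).isPreconnected
    (fun s hs => (hder s hs).differentiableAt.differentiableWithinAt)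
    (fun s hs => (hder s hs).deriv) ht h0
  simp only [neg_zero, expGrp_zero, one_apply_eq_self] at hc
  have h3 := congrArg (expGrp A' t) hc
  rwa [← mul_apply_eq_comp, expGrp_mul_neg, one_apply_eq_self] at h3

/-- Linear maps preserve degrees, so uniqueness of the expansion on the diagonal splits the
equivariance into homogeneous parts. -/
lemma homogeneous_part_comm {X : E → E} {p : FormalMultilinearSeries ℂ E E}
    (hp : HasFPowerSeriesAt X p 0) {L M : E →L[ℂ] E} (h : ∀ᶠ z in 𝓝 0, X (L z) = M (X z)) (k : ℕ)
    (z : E) : (p k fun _ => L z) = M (p k fun _ => z) := by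
  have h1 : HasFPowerSeriesAt (X ∘ L) (p.compContinuousLinearMap L) 0 :=
    HasFPowerSeriesAt.compContinuousLinearMap (by rwa [map_zero])
  have h2 : HasFPowerSeriesAt (M ∘ X) (M.compFormalMultilinearSeries p) 0 := by
    obtain ⟨r, hr⟩ := hp
    exact ⟨r, M.comp_hasFPowerSeriesOnBall hr⟩
  have h3 : HasFPowerSeriesAt (0 : E → E) (p.compContinuousLinearMap L -
      M.compFormalMultilinearSeries p) 0 := by
    refine (h1.sub h2).congr ?_
    filter_upwards [h] with z hz
    simp [hz]
  have h4 := h3.apply_eq_zero k z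
  exact sub_eq_zero.1 h4

end OneParameter

/-! ### Rigidity of fields satisfying an Euler equation. -/

section Rigidity

variable {E : Type*} [NormedAddCommGroup E] [NormedSpace ℂ E] [CompleteSpace E]

/-- Taking `t = τ / c` and solving for `p(z)` gives `e^{-τ} e^{-tB} p(e^{tB} z)`: a polynomially
bounded quantity times `e^{-τ}`, which tends to 0 as `τ → ∞`. -/
lemma homogeneous_part_eq_zero {B : E →L[ℂ] E} {r : ℕ} (hB : B ^ r = 0) {k : ℕ}
    (p : ContinuousMultilinearMap ℂ (fun _ : Fin k => E) E) {c : ℂ} (hc : c ≠ 0) (z : E)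
    (h : ∀ t, (p fun _ => expGrp B t z) = Complex.exp (t * c) • expGrp B t (p fun _ => z)) :
    (p fun _ => z) = 0 := by
  obtain ⟨C, hC, hCb⟩ := exists_norm_expGrp_le hB
  set D : ℝ := 1 + ‖c‖⁻¹ with hD
  have hbound : ∀ τ : ℝ, 1 ≤ τ → ‖expGrp B (τ / c)‖ ≤ C * D ^ r * τ ^ r ∧
      ‖expGrp B (-(τ / c))‖ ≤ C * D ^ r * τ ^ r := by
    intro τ hτ
    have h1 : 1 + ‖(τ : ℂ) / c‖ ≤ D * τ := by
      rw [norm_div, Complex.norm_real, Real.norm_of_nonneg (by linarith), div_eq_mul_inv, hD]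
      nlinarith [inv_nonneg.2 (norm_nonneg c)]
    have h2 : C * (1 + ‖(τ : ℂ) / c‖) ^ r ≤ C * D ^ r * τ ^ r := by
      rw [mul_assoc, ← mul_pow]
      exact mul_le_mul_of_nonneg_left (pow_le_pow_left₀ (by positivity) h1 r) hC
    exact ⟨(hCb _).trans h2, (hCb _).trans (by rwa [norm_neg])⟩
  have key : ∀ τ : ℝ, 1 ≤ τ → ‖p fun _ => z‖ ≤
      (C * D ^ r * (‖p‖ * (C * D ^ r * ‖z‖) ^ k)) * (τ ^ (r + r * k) * Real.exp (-τ)) := by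
    intro τ hτ
    obtain ⟨h1, h2⟩ := hbound τ hτ
    have h3 := h (τ / c)
    rw [div_mul_cancel₀ _ hc] at h3
    have h4 : (p fun _ => z) = Complex.exp (-τ) • expGrp B (-(τ / c)) (p fun _ => expGrp B (τ / c) z) := by
      rw [h3, map_smul, ← mul_apply_eq_comp, expGrp_neg_mul, one_apply_eq_self, smul_smul,
        ← Complex.exp_add, neg_add_cancel, Complex.exp_zero, one_smul]
    have h5 : ‖Complex.exp (-(τ : ℂ))‖ = Real.exp (-τ) := by
      rw [Complex.norm_exp]; simp
    have hDp : 0 ≤ D := by positivity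
    have hτ0 : 0 ≤ τ := by linarith
    have h6 : ‖p fun _ => expGrp B (τ / c) z‖ ≤ ‖p‖ * (C * D ^ r * τ ^ r * ‖z‖) ^ k := by
      refine (p.le_opNorm _).trans ?_
      rw [Finset.prod_const, Finset.card_univ, Fintype.card_fin]
      refine mul_le_mul_of_nonneg_left (pow_le_pow_left₀ (norm_nonneg _) ?_ k) (norm_nonneg _)
      exact (expGrp B (τ / c)).le_of_opNorm_le h1 z
    calc ‖p fun _ => z‖ = Real.exp (-τ) *
          ‖expGrp B (-(τ / c)) (p fun _ => expGrp B (τ / c) z)‖ := by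
            conv_lhs => rw [h4]
            rw [norm_smul, h5]
      _ ≤ Real.exp (-τ) * (C * D ^ r * τ ^ r * (‖p‖ * (C * D ^ r * τ ^ r * ‖z‖) ^ k)) :=
          mul_le_mul_of_nonneg_left (((expGrp B _).le_of_opNorm_le h2 _).trans
            (mul_le_mul_of_nonneg_left h6 (by positivity))) (Real.exp_nonneg _)
      _ = _ := by rw [pow_add, pow_mul]; ring
  have hlim : Tendsto (fun τ : ℝ => (C * D ^ r * (‖p‖ * (C * D ^ r * ‖z‖) ^ k)) *
      (τ ^ (r + r * k) * Real.exp (-τ))) atTop (𝓝 0) := by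
    simpa using (Real.tendsto_pow_mul_exp_neg_atTop_nhds_zero (r + r * k)).const_mul
      (C * D ^ r * (‖p‖ * (C * D ^ r * ‖z‖) ^ k))
  have h0 : ‖p fun _ => z‖ ≤ 0 :=
    ge_of_tendsto hlim ((eventually_ge_atTop 1).mono key)
  exact norm_le_zero_iff.1 h0

/-- Let `B ^ r` be the last nonzero power. Then `ε ^ r e^{B/ε} v` tends to `B ^ r v / r!` as `ε →
0`, while its image under `p` is `ε ^ (rd - r)` times a bounded vector and tends to 0 because `d ≥
2`. So `p` vanishes at `B ^ r v / r!`, contradicting the isolated zero if `B ^ r v ≠ 0`. -/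
lemma eq_zero_of_homogeneous_equivariant {B : E →L[ℂ] E} (hB : IsNilpotent B) {d : ℕ} (hd : 2 ≤ d)
    (p : ContinuousMultilinearMap ℂ (fun _ : Fin d => E) E) (hp : ∀ z, (p fun _ => z) = 0 → z = 0)
    (h : ∀ t z, (p fun _ => expGrp B t z) = expGrp B t (p fun _ => z)) : B = 0 := by
  by_contra hB0
  obtain ⟨r, hr0, hr1, hr2⟩ : ∃ r, 1 ≤ r ∧ B ^ r ≠ 0 ∧ B ^ (r + 1) = 0 := by
    have hN : ∃ N, B ^ (N + 1) = 0 := by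
      obtain ⟨N, hN⟩ := hB
      exact ⟨N, pow_eq_zero_of_le (Nat.le_succ N) hN⟩
    classical
    refine ⟨Nat.find hN, ?_, ?_, Nat.find_spec hN⟩
    · by_contra! hc
      have h0 : Nat.find hN = 0 := by omega
      have := Nat.find_spec hN
      rw [h0, zero_add, pow_one] at this
      exact hB0 this
    · intro hc
      rcases Nat.eq_zero_or_pos (Nat.find hN) with h0 | h0
      · have := Nat.find_spec hN
        rw [h0, zero_add, pow_one] at this
        exact hB0 this
      · exact Nat.find_min hN (m := Nat.find hN - 1) (by omega) (by rwa [Nat.sub_add_cancel h0])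
  obtain ⟨v, hv⟩ : ∃ v, (B ^ r) v ≠ 0 := by
    by_contra! hc
    exact hr1 (ContinuousLinearMap.ext hc)
  -- `Q ε` is the polynomial `ε ^ r e^{B/ε}`, extended to `ε = 0` by its value `B ^ r / r!`.
  let Q : ℂ → E →L[ℂ] E := fun ε => ∑ j ∈ Finset.range (r + 1), ((j.factorial : ℂ)⁻¹ * ε ^ (r - j)) • B ^ j
  have hQ : ∀ ε : ℂ, ε ≠ 0 → Q ε = ε ^ r • expGrp B ε⁻¹ := by
    intro ε hε
    rw [expGrp_eq_sum hr2, Finset.smul_sum]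
    refine Finset.sum_congr rfl fun j hj => ?_
    rw [smul_smul]
    congr 1
    have hj' : j ≤ r := Nat.lt_succ_iff.1 (Finset.mem_range.1 hj)
    obtain ⟨i, rfl⟩ := Nat.exists_eq_add_of_le hj'
    rw [Nat.add_sub_cancel_left, pow_add, inv_pow]
    field_simp
  have hQ0 : Q 0 = (r.factorial : ℂ)⁻¹ • B ^ r := by
    change ∑ j ∈ Finset.range (r + 1), _ = _
    rw [Finset.sum_range_succ, Finset.sum_eq_zero, zero_add, Nat.sub_self, pow_zero, mul_one]
    intro j hj
    have : r - j ≠ 0 := by have := Finset.mem_range.1 hj; omega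
    rw [zero_pow this, mul_zero, zero_smul]
  have hQc : Continuous Q := by fun_prop
  have hfun : ∀ ε : ℂ, ε ≠ 0 → (p fun _ => Q ε v) = ε ^ (r * d - r) • Q ε (p fun _ => v) := by
    intro ε hε
    rw [hQ ε hε]
    have h1 : (p fun _ => (ε ^ r • expGrp B ε⁻¹) v) = (ε ^ r) ^ d • p fun _ => expGrp B ε⁻¹ v := by
      have := p.map_smul_univ (fun _ => ε ^ r) fun _ => expGrp B ε⁻¹ v
      simpa using this
    rw [h1, h, smul_apply, smul_smul, ← pow_add, ← pow_mul, Nat.sub_add_cancel (by nlinarith)]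
  have hlim1 : Tendsto (fun ε => p fun _ => Q ε v) (𝓝[≠] 0) (𝓝 (p fun _ => Q 0 v)) := by
    have : Continuous fun ε => p fun _ => Q ε v :=
      p.cont.comp (continuous_pi fun _ => hQc.clm_apply continuous_const)
    exact (this.tendsto 0).mono_left nhdsWithin_le_nhds
  have hlim2 : Tendsto (fun ε : ℂ => ε ^ (r * d - r) • Q ε (p fun _ => v)) (𝓝[≠] 0) (𝓝 0) := by
    have h1 : Continuous fun ε : ℂ => ε ^ (r * d - r) • Q ε (p fun _ => v) :=
      (continuous_pow _).smul (hQc.clm_apply continuous_const)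
    have h2 := (h1.tendsto 0).mono_left (nhdsWithin_le_nhds (s := {0}ᶜ))
    have h3 : r * d - r ≠ 0 := by
      have : r * 2 ≤ r * d := Nat.mul_le_mul_left r hd
      omega
    simpa [zero_pow h3] using h2
  have heq : (p fun _ => Q 0 v) = 0 := by
    refine tendsto_nhds_unique hlim1 (hlim2.congr' ?_)
    filter_upwards [self_mem_nhdsWithin] with ε hε
    exact (hfun ε hε).symm
  have h1 := hp _ heq
  rw [hQ0, smul_apply, smul_eq_zero] at h1
  exact hv (h1.resolve_left (inv_ne_zero (by exact_mod_cast r.factorial_ne_zero)))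

/-- A vector field with isolated zero and `DX(z)(az + Bz) = (d a + B) X(z)` is homogeneous of
degree `d`, and `B = 0`. -/
theorem homogeneous_of_euler {X : E → E} (hX : AnalyticAt ℂ X 0) {a : ℂ} (ha : a ≠ 0) {d : ℕ}
    (hd : 2 ≤ d) {B : E →L[ℂ] E} (hB : IsNilpotent B)
    (h : ∀ᶠ z in 𝓝 0, fderiv ℂ X z (a • z + B z) = (d * a) • X z + B (X z))
    (hiso : ∀ᶠ z in 𝓝[≠] 0, X z ≠ 0) :
    B = 0 ∧ ∃ p : ContinuousMultilinearMap ℂ (fun _ : Fin d => E) E,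
      (∀ z, (p fun _ => z) = 0 → z = 0) ∧ ∀ᶠ z in 𝓝 0, X z = p fun _ => z := by
  obtain ⟨p, hp⟩ := hX
  obtain ⟨r, hr⟩ := hB
  have h1 : ∀ t k z, Complex.exp (t * a) ^ k • (p k fun _ => expGrp B t z) =
      Complex.exp (t * (d * a)) • expGrp B t (p k fun _ => z) := by
    intro t k z
    have h2 := homogeneous_part_comm hp (eventually_equivariant (A := a • 1 + B)
      (A' := ((d : ℂ) * a) • 1 + B) ⟨p, hp⟩ (by simpa using h) t) k z
    rw [expGrp_scalar_add, expGrp_scalar_add, smul_apply] at h2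
    have := (p k).map_smul_univ (fun _ => Complex.exp (t * a)) fun _ => expGrp B t z
    rw [Finset.prod_const, Finset.card_univ, Fintype.card_fin] at this
    exact this.symm.trans h2
  have h2 : ∀ k t z, (p k fun _ => expGrp B t z) =
      Complex.exp (t * ((d - k) * a)) • expGrp B t (p k fun _ => z) := by
    intro k t z
    have h3 : Complex.exp (t * (d * a)) = Complex.exp (t * a) ^ k * Complex.exp (t * ((d - k) * a)) := by
      rw [← Complex.exp_nat_mul, ← Complex.exp_add]
      congr 1
      ring
    have h4 := h1 t k z
    rw [h3, mul_smul] at h4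
    exact smul_right_injective _ (pow_ne_zero k (Complex.exp_ne_zero _)) h4
  -- In degree `k` the equivariance has the exponent `(d - k) a`, nonzero unless `k = d`.
  have h3 : ∀ k, k ≠ d → ∀ z, (p k fun _ => z) = 0 := by
    intro k hk z
    refine homogeneous_part_eq_zero hr (p k) (c := (d - k) * a) (mul_ne_zero ?_ ha) z fun t => h2 k t z
    rw [sub_ne_zero]
    exact_mod_cast hk.symm
  have h4 : ∀ᶠ z in 𝓝 0, X z = p d fun _ => z := by
    filter_upwards [hp.eventually_hasSum] with z hz
    rw [zero_add] at hz
    exact hz.unique (hasSum_single d fun k hk => h3 k hk z)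
  -- A nonzero zero of the homogeneous part would give a whole line of zeros of `X` through the
  -- origin.
  have h5 : ∀ z, (p d fun _ => z) = 0 → z = 0 := by
    intro z hz
    by_contra hz0
    have ht : Tendsto (fun s : ℂ => s • z) (𝓝[≠] 0) (𝓝[≠] 0) := by
      refine tendsto_nhdsWithin_iff.2 ⟨?_, ?_⟩
      · have : Continuous fun s : ℂ => s • z := by fun_prop
        simpa using (this.tendsto 0).mono_left (nhdsWithin_le_nhds (s := {0}ᶜ))
      · filter_upwards [self_mem_nhdsWithin] with s hs
        exact smul_ne_zero hs hz0
    obtain ⟨s, hs1, hs2⟩ := (ht.eventually (hiso.and (h4.filter_mono nhdsWithin_le_nhds))).exists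
    apply hs1
    rw [hs2]
    have := (p d).map_smul_univ (fun _ => s) fun _ => z
    rw [this, hz, smul_zero]
  refine ⟨eq_zero_of_homogeneous_equivariant ⟨r, hr⟩ hd (p d) h5 fun t z => ?_, p d, h5, h4⟩
  simpa using h2 d t z

end Rigidity

/-! ### Cartan's formula and the Euler equation for the rotational. -/

section Lie

variable {E : Type*} [NormedAddCommGroup E] [NormedSpace ℂ E]

open ContinuousAlternatingMap (alternatizeUncurryFin)

/-- The linear map `v ↦ i_w (f v)`. -/
def contractRight {q : ℕ} (f : E →L[ℂ] E [⋀^Fin (q + 1)]→L[ℂ] ℂ) (w : E) :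
    E →L[ℂ] E [⋀^Fin q]→L[ℂ] ℂ :=
  (ContinuousLinearMap.apply ℂ (E [⋀^Fin q]→L[ℂ] ℂ) w ∘L
    (ContinuousAlternatingMap.curryLeftLI (𝕜 := ℂ) (E := E) (F := ℂ)).toContinuousLinearMap) ∘L f

lemma contractRight_apply {q : ℕ} (f : E →L[ℂ] E [⋀^Fin (q + 1)]→L[ℂ] ℂ) (w v : E) :
    contractRight f w v = (f v).curryLeft w := rfl

/-- Cartan's formula for a constant field `w`: the derivative along `w` equals `i_w d + d i_w`. -/
lemma curryLeft_alternatizeUncurryFin {q : ℕ} (f : E →L[ℂ] E [⋀^Fin (q + 1)]→L[ℂ] ℂ) (w : E) :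
    (alternatizeUncurryFin f).curryLeft w = f w - alternatizeUncurryFin (contractRight f w) := by
  ext u
  change alternatizeUncurryFin f (Matrix.vecCons w u) = f w u - alternatizeUncurryFin _ u
  rw [ContinuousAlternatingMap.alternatizeUncurryFin_apply,
    ContinuousAlternatingMap.alternatizeUncurryFin_apply, Fin.sum_univ_succ, sub_eq_add_neg,
    ← Finset.sum_neg_distrib]
  congr 1
  · simp [Matrix.vecCons]
  · refine Finset.sum_congr rfl fun i _ => ?_
    have : i.succ.removeNth (Matrix.vecCons w u) = Matrix.vecCons w (i.removeNth u) := by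
      funext j
      refine Fin.cases ?_ (fun j => ?_) j
      · simp [Fin.removeNth]
      · simp [Fin.removeNth]
    rw [this, contractRight_apply, ContinuousAlternatingMap.curryLeft_apply_apply]
    simp [pow_succ]

lemma curryLeft_curryLeft_swap {q : ℕ} (α : E [⋀^Fin (q + 2)]→L[ℂ] ℂ) (v w : E) :
    (α.curryLeft v).curryLeft w = -(α.curryLeft w).curryLeft v := by
  have h := α.curryLeft_same (v + w)
  rw [map_add, map_add] at h
  have h1 : ((α.curryLeft v + α.curryLeft w).curryLeft v +
      (α.curryLeft v + α.curryLeft w).curryLeft w) = (α.curryLeft w).curryLeft v +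
      (α.curryLeft v).curryLeft w := by
    rw [ContinuousAlternatingMap.curryLeft_add, add_apply, add_apply, α.curryLeft_same,
      α.curryLeft_same, zero_add, add_zero]
  rw [h1] at h
  exact eq_neg_of_add_eq_zero_right h

end Lie

section Trace

open ContinuousAlternatingMap (alternatizeUncurryFin)

variable {q : ℕ}

lemma isDualTo_stdVec {m : ℕ} : IsDualTo (stdVec (m := m)) dx := fun i j => by
  simp [dx_apply, stdVec, Pi.single_apply, eq_comm]

lemma wedgeLin_dx {m : ℕ} : wedgeLin (dx (m := m)) = volForm m := rfl

/-- The left side is `d(i_{Lz} ν)`, so the factor is the divergence of a linear field. On the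
standard basis the `i`-th term replaces the `i`-th vector by its image and yields a diagonal entry.
-/
lemma alternatizeUncurryFin_volForm (L : (Fin (q + 1) → ℂ) →L[ℂ] (Fin (q + 1) → ℂ)) :
    alternatizeUncurryFin ((volForm (q + 1)).curryLeft ∘L L) =
      LinearMap.trace ℂ _ (L : (Fin (q + 1) → ℂ) →ₗ[ℂ] (Fin (q + 1) → ℂ)) • volForm (q + 1) := by
  rw [eq_smul_volForm (alternatizeUncurryFin _)]
  congr 1
  rw [ContinuousAlternatingMap.alternatizeUncurryFin_apply,
    LinearMap.trace_eq_matrix_trace ℂ (Pi.basisFun ℂ (Fin (q + 1))), Matrix.trace]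
  refine Finset.sum_congr rfl fun i _ => ?_
  rw [ContinuousLinearMap.comp_apply, ContinuousAlternatingMap.curryLeft_apply_apply,
    ← ContinuousAlternatingMap.neg_one_pow_smul_map_insertNth, smul_smul, ← mul_pow]
  rw [neg_one_mul, neg_neg, one_pow, one_smul, Fin.insertNth_removeNth, ← wedgeLin_dx,
    isDualTo_stdVec.wedgeLin_update]
  simp [dx_apply, stdVec]

/-- The formula `L_{Az}(i_X ν) = i_{[Az, X]} ν + tr A i_X ν` together with Cartan's formula. -/
theorem lie_identity {X : (Fin (q + 2) → ℂ) → Fin (q + 2) → ℂ} {z : Fin (q + 2) → ℂ}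
    (hX : DifferentiableAt ℂ X z) (A : (Fin (q + 2) → ℂ) →L[ℂ] (Fin (q + 2) → ℂ))
    (hclosed : extDeriv (fun z => (volForm (q + 2)).curryLeft (X z)) z = 0)
    (h : extDeriv (fun z => ((volForm (q + 2)).curryLeft (X z)).curryLeft (A z)) z =
      (volForm (q + 2)).curryLeft (X z)) :
    fderiv ℂ X z (A z) = (1 - LinearMap.trace ℂ _
      (A : (Fin (q + 2) → ℂ) →ₗ[ℂ] (Fin (q + 2) → ℂ))) • X z + A (X z) := by
  set ν := volForm (q + 2) with hν
  have hθ : HasFDerivAt (fun z => ν.curryLeft (X z)) (ν.curryLeft ∘L fderiv ℂ X z) z :=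
    ν.curryLeft.hasFDerivAt.comp z hX.hasFDerivAt
  rw [extDeriv, hθ.fderiv] at hclosed
  let b : (Fin (q + 2) → ℂ) →L[ℂ] (Fin (q + 2) → ℂ) →L[ℂ] (Fin (q + 2) → ℂ) [⋀^Fin q]→L[ℂ] ℂ :=
    (ContinuousAlternatingMap.curryLeftLI (𝕜 := ℂ) (E := Fin (q + 2) → ℂ)
      (F := ℂ)).toContinuousLinearMap ∘L ν.curryLeft
  have hb : ∀ v w, b v w = (ν.curryLeft v).curryLeft w := fun v w => rfl
  have hζ := b.hasFDerivAt_of_bilinear hX.hasFDerivAt (A.hasFDerivAt (x := z))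
  have hζ2 : extDeriv (fun z => (ν.curryLeft (X z)).curryLeft (A z)) z =
      alternatizeUncurryFin ((ν.curryLeft (X z)).curryLeft ∘L A) +
        alternatizeUncurryFin (contractRight (ν.curryLeft ∘L fderiv ℂ X z) (A z)) := by
    rw [extDeriv, ← ContinuousAlternatingMap.alternatizeUncurryFin_add]
    congr 1
    refine hζ.fderiv.trans ?_
    ext v : 1
    rfl
  have h1 := curryLeft_alternatizeUncurryFin (ν.curryLeft ∘L fderiv ℂ X z) (A z)
  have h2 : alternatizeUncurryFin (contractRight (ν.curryLeft ∘L fderiv ℂ X z) (A z)) =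
      ν.curryLeft (fderiv ℂ X z (A z)) := by
    rw [hclosed] at h1
    exact (sub_eq_zero.1 h1.symm).symm
  -- Contracting `d(i_{Az} ν) = tr A ν` with the frozen vector `X z` computes the part of `dζ` in
  -- which only `A z` is differentiated.
  have h3 := curryLeft_alternatizeUncurryFin (ν.curryLeft ∘L A) (X z)
  have h4 : contractRight (ν.curryLeft ∘L A) (X z) = -((ν.curryLeft (X z)).curryLeft ∘L A) := by
    ext v : 1
    exact curryLeft_curryLeft_swap ν (A v) (X z)
  have h5 : alternatizeUncurryFin ((ν.curryLeft (X z)).curryLeft ∘L A) =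
      LinearMap.trace ℂ _ (A : (Fin (q + 2) → ℂ) →ₗ[ℂ] (Fin (q + 2) → ℂ)) • ν.curryLeft (X z) -
        ν.curryLeft (A (X z)) := by
    rw [h4, ← ContinuousAlternatingMap.alternatizeUncurryFinCLM_apply (-_), map_neg,
      ContinuousAlternatingMap.alternatizeUncurryFinCLM_apply, sub_neg_eq_add] at h3
    have h6 := alternatizeUncurryFin_volForm A
    rw [h6] at h3
    exact eq_sub_of_add_eq' h3.symm
  rw [hζ2, h2, h5, ← map_smul, ← map_sub, ← map_add] at h
  have h6 := curryLeft_volForm_injective h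
  funext j
  have h7 := congrFun h6 j
  simp only [Pi.add_apply, Pi.sub_apply, Pi.smul_apply, smul_eq_mul] at h7 ⊢
  linear_combination h7

end Trace

/-! ### The homogeneous model of a conic singularity. -/

lemma isNilpotent_sub_smul_of_charpoly {m : ℕ} {L : (Fin m → ℂ) →ₗ[ℂ] (Fin m → ℂ)} {a : ℂ}
    (h : L.charpoly = ∏ _i : Fin m, (Polynomial.X - Polynomial.C a)) :
    IsNilpotent (L - a • LinearMap.id) := by
  refine ⟨m, ?_⟩
  have h1 := L.aeval_self_charpoly
  rw [h, Finset.prod_const, Finset.card_univ, Fintype.card_fin, map_pow, map_sub,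
    Polynomial.aeval_X, Polynomial.aeval_C] at h1
  rw [← h1]
  rfl

lemma trace_smul_one_add_of_isNilpotent {m : ℕ} (a : ℂ) {B : (Fin m → ℂ) →L[ℂ] (Fin m → ℂ)}
    (hB : IsNilpotent B) :
    LinearMap.trace ℂ _ ((a • 1 + B : (Fin m → ℂ) →L[ℂ] (Fin m → ℂ)) :
      (Fin m → ℂ) →ₗ[ℂ] (Fin m → ℂ)) = m * a := by
  have h1 : IsNilpotent (B : (Fin m → ℂ) →ₗ[ℂ] (Fin m → ℂ)) := by
    obtain ⟨k, hk⟩ := hB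
    refine ⟨k, ?_⟩
    have : ∀ n : ℕ, (B : (Fin m → ℂ) →ₗ[ℂ] (Fin m → ℂ)) ^ n =
        ((B ^ n : (Fin m → ℂ) →L[ℂ] (Fin m → ℂ)) : (Fin m → ℂ) →ₗ[ℂ] (Fin m → ℂ)) := by
      intro n
      induction n with
      | zero => rfl
      | succ n ih => rw [pow_succ, ih, pow_succ]; rfl
    rw [this, hk]
    rfl
  have h2 := (LinearMap.isNilpotent_trace_of_isNilpotent h1).eq_zero
  have h3 : ((a • 1 + B : (Fin m → ℂ) →L[ℂ] (Fin m → ℂ)) : (Fin m → ℂ) →ₗ[ℂ] (Fin m → ℂ)) =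
      a • LinearMap.id + (B : (Fin m → ℂ) →ₗ[ℂ] (Fin m → ℂ)) := rfl
  rw [h3, map_add, map_smul, LinearMap.trace_id, h2, Module.finrank_fin_fun, add_zero, smul_eq_mul,
    mul_comm]

lemma eventually_isUnit_fderiv {E F : Type*} [NormedAddCommGroup E] [NormedSpace ℂ E]
    [NormedAddCommGroup F] [NormedSpace ℂ F] [CompleteSpace E] {f : E → F} {x : E}
    (hf : ContinuousAt (fderiv ℂ f) x) {T : E ≃L[ℂ] F} (hT : fderiv ℂ f x = T) :
    ∀ᶠ z in 𝓝 x, ∃ T' : E ≃L[ℂ] F, fderiv ℂ f z = T' := by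
  have h1 : Set.range ((↑) : (E ≃L[ℂ] F) → (E →L[ℂ] F)) ∈ 𝓝 (fderiv ℂ f x) := by
    rw [hT]; exact ContinuousLinearEquiv.nhds T
  filter_upwards [hf.eventually h1] with z hz
  obtain ⟨T', hT'⟩ := hz
  exact ⟨T', hT'.symm⟩

lemma compContinuousLinearMap_eq_zero_iff {E F : Type*} [NormedAddCommGroup E] [NormedSpace ℂ E]
    [NormedAddCommGroup F] [NormedSpace ℂ F] {q : ℕ} {α : F [⋀^Fin q]→L[ℂ] ℂ} {T : E →L[ℂ] F}
    (hT : Function.Surjective T) : α.compContinuousLinearMap T = 0 ↔ α = 0 := by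
  constructor
  · intro h
    ext v
    choose u hu using fun i => hT (v i)
    have h1 := DFunLike.congr_fun h u
    have h2 : v = fun i => T (u i) := funext fun i => (hu i).symm
    rw [h2]
    exact h1
  · rintro rfl
    ext v
    rfl

/-- An invertible derivative keeps nearby nonzero points away from 0 under `f`, so punctured
neighbourhoods correspond, and invertibility persists at nearby points. -/
lemma extDeriv_ne_zero_pullback {E F : Type*} [NormedAddCommGroup E] [NormedSpace ℂ E]
    [NormedAddCommGroup F] [NormedSpace ℂ F] [CompleteSpace E] [CompleteSpace F] {q : ℕ}
    {f : E → F} {ω : F → F [⋀^Fin q]→L[ℂ] ℂ} (hω : AnalyticAt ℂ ω 0) (hf : AnalyticAt ℂ f 0)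
    (hf0 : f 0 = 0) {T : E ≃L[ℂ] F} (hT : fderiv ℂ f 0 = T)
    (h : ∀ᶠ x in 𝓝[≠] 0, extDeriv ω x ≠ 0) : ∀ᶠ x in 𝓝[≠] 0, extDeriv (pullback f ω) x ≠ 0 := by
  have h1 : HasFDerivAt f (T : E →L[ℂ] F) 0 := hT ▸ hf.differentiableAt.hasFDerivAt
  have h2 := h1.tendsto_nhdsNE ⟨_, T.antilipschitz⟩
  rw [hf0] at h2
  have ht : Tendsto f (𝓝 0) (𝓝 0) := by
    have := hf.continuousAt.tendsto
    rwa [hf0] at this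
  filter_upwards [h2.eventually h,
    (eventually_isUnit_fderiv hf.fderiv.continuousAt hT).filter_mono nhdsWithin_le_nhds,
    hf.eventually_analyticAt.filter_mono nhdsWithin_le_nhds,
    (ht.eventually hω.eventually_analyticAt).filter_mono nhdsWithin_le_nhds] with x hx hTx hfx hωx
  obtain ⟨T', hT'⟩ := hTx
  rw [extDeriv_pullback_apply hωx hfx, pullback, hT', ne_eq,
    compContinuousLinearMap_eq_zero_iff T'.surjective]
  exact hx

/-- **Normal form of conic NGK singularities**: in suitable coordinates, the form is
`a · i_R i_X ν` with `X` a homogeneous polynomial vector field. -/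
theorem exists_homogeneous_model {q d : ℕ} (hd : 2 ≤ d)
    {ζ : (Fin (q + 2) → ℂ) → (Fin (q + 2) → ℂ) [⋀^Fin q]→L[ℂ] ℂ}
    (h : IsNGKOfType ζ (fun _ => 1) (d - 1)) :
    ∃ (ψ : (Fin (q + 2) → ℂ) → Fin (q + 2) → ℂ) (T : (Fin (q + 2) → ℂ) ≃L[ℂ] (Fin (q + 2) → ℂ))
      (a : ℂ) (P : Fin (q + 2) → MvPolynomial (Fin (q + 2)) ℂ),
      AnalyticAt ℂ ψ 0 ∧ ψ 0 = 0 ∧ fderiv ℂ ψ 0 = T ∧ (∀ j, (P j).IsHomogeneous d) ∧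
      (∀ x, (∀ j, MvPolynomial.eval x (P j) = 0) → x = 0) ∧
      ∀ᶠ x in 𝓝 0, extDeriv (pullback ψ ζ) x =
          (volForm (q + 2)).curryLeft (fun j => MvPolynomial.eval x (P j)) ∧
        pullback ψ ζ x =
          a • ((volForm (q + 2)).curryLeft (fun j => MvPolynomial.eval x (P j))).curryLeft x := by
  obtain ⟨-, -, -, X, Y, hNGK, hY, hY0, hζ, hchar⟩ := h
  set N : ℕ := d - 1 + ∑ _j : Fin (q + 2), 1 with hN
  have hN' : N = d - 1 + (q + 2) := by simp [hN]
  have hN0 : (N : ℂ) ≠ 0 := by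
    have : N ≠ 0 := by omega
    exact_mod_cast this
  set a : ℂ := (N : ℂ)⁻¹ with ha
  have ha0 : a ≠ 0 := inv_ne_zero hN0
  have hnil : IsNilpotent ((fderiv ℂ Y 0 : (Fin (q + 2) → ℂ) →ₗ[ℂ] (Fin (q + 2) → ℂ)) -
      a • LinearMap.id) := by
    apply isNilpotent_sub_smul_of_charpoly
    rw [hchar]
    refine Finset.prod_congr rfl fun i _ => ?_
    rw [Nat.cast_one, one_div]
  obtain ⟨ψ, T, B, hψ, hψ0, hT, hB, hlin⟩ := exists_linearization hY hY0 ha0 hnil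
  have hζa : AnalyticAt ℂ ζ 0 := hNGK.integrable.1
  have hζ1 : AnalyticAt ℂ (pullback ψ ζ) 0 := analyticAt_pullback (by rwa [hψ0]) hψ
  set ν := volForm (q + 2) with hν
  -- `X1` is the rotational of the pulled back form. It is not the transformed field `X`, since `ψ`
  -- need not preserve the volume form.
  set X1 : (Fin (q + 2) → ℂ) → Fin (q + 2) → ℂ :=
    fun z j => vecOf j (extDeriv (pullback ψ ζ) z) with hX1
  have hX1ν : ∀ z, ν.curryLeft (X1 z) = extDeriv (pullback ψ ζ) z := fun z => curryLeft_vecOf _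
  have hX1a : AnalyticAt ℂ X1 0 := AnalyticAt.pi fun j =>
    ((vecOf j).analyticAt _).fun_comp (analyticAt_extDeriv hζ1)
  set A : (Fin (q + 2) → ℂ) →L[ℂ] (Fin (q + 2) → ℂ) := a • 1 + B with hA
  have ht : Tendsto ψ (𝓝 0) (𝓝 0) := by
    have := hψ.continuousAt.tendsto
    rwa [hψ0] at this
  -- The relation `ζ = i_Y dζ` survives any change of coordinates, and `ψ` carries the linear field
  -- `A` to `Y`.
  have hζ2 : ∀ᶠ z in 𝓝 0, pullback ψ ζ z = (ν.curryLeft (X1 z)).curryLeft (A z) := by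
    filter_upwards [hlin, ht.eventually hζ, ht.eventually hNGK.rotational.2,
      hψ.eventually_analyticAt, ht.eventually hζa.eventually_analyticAt] with z h1 h2 h3 h4 h5
    rw [hX1ν, extDeriv_pullback_apply h5 h4, pullback, pullback, h2, h3,
      ContinuousAlternatingMap.curryLeft_compContinuousLinearMap]
    have : A z = a • z + B z := by simp [hA]
    rw [this, h1]
  have hEuler : ∀ᶠ z in 𝓝 0, fderiv ℂ X1 z (a • z + B z) = (d * a) • X1 z + B (X1 z) := by
    filter_upwards [hζ2.eventually_nhds, hX1a.eventually_analyticAt,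
      hζ1.eventually_analyticAt] with z h1 h2 h3
    have h4 : extDeriv (fun z => ν.curryLeft (X1 z)) z = 0 := by
      have : (fun z => ν.curryLeft (X1 z)) = extDeriv (pullback ψ ζ) := funext hX1ν
      rw [this]
      exact extDeriv_extDeriv_of_analyticAt h3
    have h5 : extDeriv (fun z => (ν.curryLeft (X1 z)).curryLeft (A z)) z = ν.curryLeft (X1 z) := by
      rw [hX1ν]
      exact (EventuallyEq.extDeriv_eq h1).symm
    have h6 := lie_identity h2.differentiableAt A h4 h5
    rw [hA, trace_smul_one_add_of_isNilpotent a hB] at h6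
    simp only [add_apply, smul_apply, one_apply_eq_self] at h6
    rw [h6, ← add_assoc, ← add_smul]
    congr 2
    -- The Euler factor is `1 - tr A + a = 1 - (q + 1) a`, which equals `d a` because `a N = 1` and
    -- `N = d - 1 + (q + 2)`.
    have h7 : (N : ℂ) = d - 1 + (q + 2) := by
      rw [hN']
      push_cast [Nat.cast_sub (by omega : 1 ≤ d)]
      ring
    have h8 : a * N = 1 := inv_mul_cancel₀ hN0
    rw [h7] at h8
    push_cast
    linear_combination -h8
  have hiso : ∀ᶠ z in 𝓝[≠] 0, X1 z ≠ 0 := by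
    filter_upwards [extDeriv_ne_zero_pullback hζa hψ hψ0 hT hNGK.isolated] with z hz h0
    apply hz
    rw [← hX1ν, h0, map_zero]
  obtain ⟨hB0, p, hp0, hp⟩ := homogeneous_of_euler hX1a ha0 hd hB hEuler hiso
  choose P hPd hP using fun j => exists_mvPolynomial_eq
    ((ContinuousLinearMap.proj j : (Fin (q + 2) → ℂ) →L[ℂ] ℂ).compContinuousMultilinearMap p)
  have hPp : ∀ x, (fun j => MvPolynomial.eval x (P j)) = p fun _ => x := fun x =>
    funext fun j => hP j x
  refine ⟨ψ, T, a, P, hψ, hψ0, hT, hPd, fun x hx => hp0 x ?_, ?_⟩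
  · rw [← hPp]; exact funext hx
  · filter_upwards [hp, hζ2] with z h1 h2
    rw [hPp, ← h1]
    refine ⟨(hX1ν z).symm, ?_⟩
    rw [h2, hA, hB0]
    simp

/-! ### Germs on a product, and kernels under surjections. -/

section Germs

variable {E F G : Type*} [NormedAddCommGroup E] [NormedSpace ℂ E]
  [NormedAddCommGroup F] [NormedSpace ℂ F] [NormedAddCommGroup G] [NormedSpace ℂ G]

/-- A germ of function on `E × ℂ` with vanishing derivative along `ℂ` is a function on `E`. -/
lemma eventually_eq_of_fderiv_snd_eq_zero [CompleteSpace F] {f : E × ℂ → F} (hf : AnalyticAt ℂ f 0)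
    (h : ∀ᶠ z in 𝓝 0, fderiv ℂ f z (0, 1) = 0) : ∀ᶠ z : E × ℂ in 𝓝 0, f z = f (z.1, 0) := by
  obtain ⟨r, hr, hball⟩ := Metric.eventually_nhds_iff_ball.1 (h.and hf.eventually_analyticAt)
  filter_upwards [Metric.ball_mem_nhds (0 : E × ℂ) hr] with z hz
  obtain ⟨p, t⟩ := z
  have hpt : ∀ s ∈ Metric.ball (0 : ℂ) r, (p, s) ∈ Metric.ball (0 : E × ℂ) r := by
    intro s hs
    rw [mem_ball_zero_iff] at hz hs ⊢
    rw [Prod.norm_mk, max_lt_iff] at hz ⊢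
    exact ⟨hz.1, hs⟩
  have ht : t ∈ Metric.ball (0 : ℂ) r := by
    rw [mem_ball_zero_iff] at hz ⊢
    exact (norm_snd_le (p, t)).trans_lt hz
  have hder : ∀ s ∈ Metric.ball (0 : ℂ) r, HasDerivAt (fun s => f (p, s)) 0 s := by
    intro s hs
    obtain ⟨h1, h2⟩ := hball _ (hpt s hs)
    have h3 : HasDerivAt (fun s : ℂ => (p, s)) ((0 : E), (1 : ℂ)) s :=
      (hasDerivAt_const s p).prodMk (hasDerivAt_id s)
    have h4 := h2.differentiableAt.hasFDerivAt.comp_hasDerivAt s h3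
    rwa [h1] at h4
  exact Metric.isOpen_ball.is_const_of_deriv_eq_zero (convex_ball (0 : ℂ) r).isPreconnected
    (fun s hs => (hder s hs).differentiableAt.differentiableWithinAt)
    (fun s hs => (hder s hs).deriv) ht (Metric.mem_ball_self hr)

lemma eventually_slice {p : E × ℂ → Prop} (h : ∀ᶠ z in 𝓝 0, p z) :
    ∀ᶠ ρ in 𝓝 (0 : ℂ), ∀ᶠ x in 𝓝 (0 : E), p (x, ρ) := by
  have h1 : Tendsto (fun ρ : ℂ => ((0 : E), ρ)) (𝓝 0) (𝓝 0) := by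
    have : Continuous fun ρ : ℂ => ((0 : E), ρ) := by fun_prop
    exact this.tendsto 0
  filter_upwards [h1.eventually h.eventually_nhds] with ρ hρ
  have h2 : Continuous fun x : E => (x, ρ) := by fun_prop
  exact (h2.tendsto 0).eventually hρ

lemma finrank_comap_of_surjective [FiniteDimensional ℂ E] [FiniteDimensional ℂ F] {T : E →ₗ[ℂ] F}
    (hT : Function.Surjective T) (K : Submodule ℂ F) :
    Module.finrank ℂ (K.comap T) + Module.finrank ℂ F = Module.finrank ℂ K + Module.finrank ℂ E := by
  have h1 := LinearMap.finrank_range_add_finrank_ker (K.mkQ ∘ₗ T)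
  have h2 := Submodule.finrank_quotient_add_finrank K
  have h3 : LinearMap.range (K.mkQ ∘ₗ T) = ⊤ :=
    LinearMap.range_eq_top.2 ((Submodule.mkQ_surjective K).comp hT)
  rw [h3, finrank_top, LinearMap.ker_comp, Submodule.ker_mkQ] at h1
  omega

lemma formKernel_comp_of_surjective {q : ℕ} {α : F [⋀^Fin q]→L[ℂ] ℂ} {T : E →L[ℂ] F}
    (hT : Function.Surjective T) :
    formKernel (α.compContinuousLinearMap T) = (formKernel α).comap (T : E →ₗ[ℂ] F) := by
  ext v
  constructor
  · intro h w i
    choose u hu using fun i => hT (w i)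
    have h1 := h u i
    change α (fun k => T (Function.update u i v k)) = 0 at h1
    convert h1 using 2
    funext k
    by_cases hk : k = i
    · subst hk; simp
    · simp [hk, hu]
  · intro h w i
    change α (fun k => T (Function.update w i v k)) = 0
    convert h (fun k => T (w k)) i using 2
    funext k
    by_cases hk : k = i
    · subst hk; simp
    · simp [hk]

lemma eval_zero_of_isHomogeneous {σ : Type*} {d : ℕ} (hd : d ≠ 0) {p : MvPolynomial σ ℂ}
    (hp : p.IsHomogeneous d) : MvPolynomial.eval (0 : σ → ℂ) p = 0 := by
  have := eval_smul_of_isHomogeneous hp 0 (0 : σ → ℂ)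
  rwa [zero_smul, zero_pow hd, zero_mul] at this

end Germs

/-- Division of forms annihilated by a vector field, with parameters in `W × ℂ`. -/
theorem exists_division {q k d : ℕ} (hq : 1 ≤ q) (P : Fin (q + 2) → MvPolynomial (Fin (q + 2)) ℂ)
    (hPd : ∀ j, (P j).IsHomogeneous d) (hP : ∀ x, (∀ j, MvPolynomial.eval x (P j) = 0) → x = 0)
    {X : ((Fin (q + 2) → ℂ) × (Fin k → ℂ)) × ℂ → Fin (q + 2) → ℂ} (hX : AnalyticAt ℂ X 0)
    (hXP : ∀ᶠ p in 𝓝 (0 : (Fin (q + 2) → ℂ) × (Fin k → ℂ)), ∀ j,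
      X (p, 0) j = MvPolynomial.eval p.1 (P j))
    {β : ((Fin (q + 2) → ℂ) × (Fin k → ℂ)) × ℂ → (Fin (q + 2) → ℂ) [⋀^Fin q]→L[ℂ] ℂ}
    (hβ : AnalyticAt ℂ β 0) (hXβ : ∀ᶠ z in 𝓝 0, X z ∈ formKernel (β z)) :
    ∃ a : ((Fin (q + 2) → ℂ) × (Fin k → ℂ)) × ℂ → Fin (q + 2) → ℂ, AnalyticAt ℂ a 0 ∧
      ∀ᶠ z in 𝓝 0, β z = ((volForm (q + 2)).curryLeft (X z)).curryLeft (a z) := by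
  let κ := (Fin (q + 2) ⊕ Fin k) ⊕ Unit
  let e : (κ → ℂ) →L[ℂ] ((Fin (q + 2) → ℂ) × (Fin k → ℂ)) × ℂ :=
    ((ContinuousLinearMap.pi fun i => ContinuousLinearMap.proj (Sum.inl (Sum.inl i))).prod
      (ContinuousLinearMap.pi fun i => ContinuousLinearMap.proj (Sum.inl (Sum.inr i)))).prod
      (ContinuousLinearMap.proj (Sum.inr ()))
  let e' : ((Fin (q + 2) → ℂ) × (Fin k → ℂ)) × ℂ →L[ℂ] (κ → ℂ) :=
    ContinuousLinearMap.pi (Sum.elim (Sum.elim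
      (fun i => ContinuousLinearMap.proj i ∘L ContinuousLinearMap.fst ℂ _ _ ∘L
        ContinuousLinearMap.fst ℂ _ _)
      (fun i => ContinuousLinearMap.proj i ∘L ContinuousLinearMap.snd ℂ _ _ ∘L
        ContinuousLinearMap.fst ℂ _ _))
      (fun _ => ContinuousLinearMap.snd ℂ _ _))
  have he' : ∀ z, e (e' z) = z := fun z => rfl
  have het : Tendsto e (𝓝 0) (𝓝 0) := by
    have := e.continuous.tendsto 0
    rwa [map_zero] at this
  have het' : Tendsto e' (𝓝 0) (𝓝 0) := by
    have := e'.continuous.tendsto 0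
    rwa [map_zero] at this
  have hfst : Tendsto (fun z => (e z).1) (𝓝 0) (𝓝 0) :=
    (continuous_fst.tendsto (0 : ((Fin (q + 2) → ℂ) × (Fin k → ℂ)) × ℂ)).comp het
  have hXe : AnalyticAt ℂ (fun z => X (e z)) 0 :=
    AnalyticAt.fun_comp (by rwa [map_zero]) (e.analyticAt 0)
  have hβe : AnalyticAt ℂ (fun z => β (e z)) 0 :=
    AnalyticAt.fun_comp (by rwa [map_zero]) (e.analyticAt 0)
  -- The deformation variable is the last coordinate of `E × ℂ`; the variables of `Fin k → ℂ` are
  -- inert parameters, as the field at time 0 does not involve them.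
  obtain ⟨a, ha, hdiv⟩ := exists_koszul_division (κ := κ) (m := q + 2) (by omega)
    (x := fun i => Sum.inl (Sum.inl i)) (fun i j h => Sum.inl_injective (Sum.inl_injective h)) (τ := Sum.inr ())
    (fun i => by simp) P hPd hP hXe (by
      filter_upwards [hfst.eventually hXP] with z hz hz0 j
      have : e z = ((e z).1, 0) := Prod.ext rfl hz0
      rw [this, hz]
      rfl)
    (B := fun z j l => bivecOf j l (β (e z)))
    (AnalyticAt.pi fun j => AnalyticAt.pi fun l => ((bivecOf j l).analyticAt _).fun_comp hβe)
    (Eventually.of_forall fun z i j => bivecOf_swap i j _)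
    ((het.eventually hXβ).mono fun z hz i j l => wedgeBi_bivecOf hq hz i j l)
  refine ⟨fun z => a (e' z), AnalyticAt.fun_comp (by rwa [map_zero]) (e'.analyticAt 0), ?_⟩
  filter_upwards [het'.eventually hdiv] with z hz
  rw [he'] at hz
  exact eq_curryLeft_of_bivecOf hq hz

/-! ### Density of generic points. -/

section Generic

variable {E F : Type*} [NormedAddCommGroup E] [NormedSpace ℂ E]
  [NormedAddCommGroup F] [NormedSpace ℂ F]

/-- By the identity theorem on a ball, a nonzero germ cannot vanish identically near any point close
to `x`; so its nonvanishing locus is dense there. -/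
lemma eventually_frequently_ne [CompleteSpace F] {f : E → F} {x : E} (hf : AnalyticAt ℂ f x)
    (hne : ¬ ∀ᶠ z in 𝓝 x, f z = 0) : ∀ᶠ z in 𝓝 x, ∃ᶠ w in 𝓝 z, f w ≠ 0 := by
  obtain ⟨r, hr, hball⟩ := Metric.eventually_nhds_iff_ball.1 hf.eventually_analyticAt
  filter_upwards [Metric.ball_mem_nhds x hr] with z hz hc
  refine hne ?_
  have h1 : f =ᶠ[𝓝 z] 0 := hc.mono fun w hw => not_not.1 hw
  have h2 := AnalyticOnNhd.eqOn_zero_of_preconnected_of_eventuallyEq_zero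
    hball (convex_ball x r).isPreconnected hz h1
  filter_upwards [Metric.ball_mem_nhds x hr] with w hw using h2 hw

lemma eventually_frequently_and_ne [CompleteSpace F] {p : E → Prop} {f : E → F} {x : E}
    (hp : ∀ᶠ z in 𝓝 x, ∃ᶠ w in 𝓝 z, p w) (hpo : ∀ᶠ z in 𝓝 x, p z → ∀ᶠ w in 𝓝 z, p w)
    (hf : AnalyticAt ℂ f x) (hne : ¬ ∀ᶠ z in 𝓝 x, f z = 0) :
    ∀ᶠ z in 𝓝 x, ∃ᶠ w in 𝓝 z, p w ∧ f w ≠ 0 := by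
  filter_upwards [hp, hpo.eventually_nhds, (eventually_frequently_ne hf hne).eventually_nhds]
    with z h1 h2 h3
  refine frequently_frequently_nhds.1 ((h1.and_eventually (h2.and h3)).mono fun w hw => ?_)
  exact (hw.2.2.and_eventually (hw.2.1 hw.1)).mono fun v hv => ⟨hv.2, hv.1⟩

lemma analyticAt_curryLeft {m : ℕ} {α : E → F [⋀^Fin (m + 1)]→L[ℂ] ℂ} {v : E → F} {x : E}
    (hα : AnalyticAt ℂ α x) (hv : AnalyticAt ℂ v x) :
    AnalyticAt ℂ (fun z => (α z).curryLeft (v z)) x := by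
  let L := (ContinuousAlternatingMap.curryLeftLI (𝕜 := ℂ) (E := F) (F := ℂ)
    (n := m)).toContinuousLinearMap
  have hL := @ContinuousLinearMap.analyticAt ℂ _ (F [⋀^Fin (m + 1)]→L[ℂ] ℂ) _ _
    (F →L[ℂ] F [⋀^Fin m]→L[ℂ] ℂ) _ _ L (α x)
  have h1 : AnalyticAt ℂ (fun z => (α z).curryLeft) x := AnalyticAt.comp (g := L) (f := α) hL hα
  exact ((ContinuousLinearMap.id ℂ (F →L[ℂ] F [⋀^Fin m]→L[ℂ] ℂ)).analyticAt_bilinear _).fun_comp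
    (h1.prod hv)

end Generic

/-! ### The deformation `(x, y, t) ↦ (x, t y)` and its transport field. -/

section Scaling

variable {V W : Type*} [NormedAddCommGroup V] [NormedSpace ℂ V]
  [NormedAddCommGroup W] [NormedSpace ℂ W]

/-- The map `(x, y, t) ↦ (x, t y)`. -/
def scaleSnd (z : (V × W) × ℂ) : V × W := (z.1.1, z.2 • z.1.2)

/-- The derivative of `scaleSnd`. -/
def scaleSndDeriv (z : (V × W) × ℂ) : (V × W) × ℂ →L[ℂ] V × W :=
  (ContinuousLinearMap.fst ℂ V W ∘L ContinuousLinearMap.fst ℂ (V × W) ℂ).prod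
    (z.2 • (ContinuousLinearMap.snd ℂ V W ∘L ContinuousLinearMap.fst ℂ (V × W) ℂ) +
      (ContinuousLinearMap.snd ℂ (V × W) ℂ).smulRight z.1.2)

lemma scaleSndDeriv_apply (z v : (V × W) × ℂ) :
    scaleSndDeriv z v = (v.1.1, z.2 • v.1.2 + v.2 • z.1.2) := rfl

lemma hasFDerivAt_scaleSnd (z : (V × W) × ℂ) : HasFDerivAt scaleSnd (scaleSndDeriv z) z := by
  refine HasFDerivAt.prodMk
    (ContinuousLinearMap.fst ℂ V W ∘L ContinuousLinearMap.fst ℂ (V × W) ℂ).hasFDerivAt ?_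
  exact (ContinuousLinearMap.snd ℂ (V × W) ℂ).hasFDerivAt.smul
    (ContinuousLinearMap.snd ℂ V W ∘L ContinuousLinearMap.fst ℂ (V × W) ℂ).hasFDerivAt

lemma analyticAt_scaleSnd (z : (V × W) × ℂ) : AnalyticAt ℂ scaleSnd z :=
  (analyticAt_fst.comp analyticAt_fst).prod
    (analyticAt_snd.smul (analyticAt_snd.comp analyticAt_fst))

lemma scaleSndDeriv_surjective {z : (V × W) × ℂ} (hz : z.2 ≠ 0) :
    Function.Surjective (scaleSndDeriv z) := fun v =>
  ⟨((v.1, z.2⁻¹ • v.2), 0), by simp [scaleSndDeriv_apply, smul_smul, hz]⟩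

lemma scaleSnd_zero : scaleSnd (0 : (V × W) × ℂ) = 0 := by
  simp [scaleSnd]

end Scaling

/-- The inclusion of the first factor. -/
def incl (V W : Type*) [NormedAddCommGroup V] [NormedSpace ℂ V]
    [NormedAddCommGroup W] [NormedSpace ℂ W] : V →L[ℂ] (V × W) × ℂ :=
  ContinuousLinearMap.inl ℂ (V × W) ℂ ∘L ContinuousLinearMap.inl ℂ V W

lemma incl_apply {V W : Type*} [NormedAddCommGroup V] [NormedSpace ℂ V]
    [NormedAddCommGroup W] [NormedSpace ℂ W] (v : V) : incl V W v = ((v, 0), 0) := rfl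

/-- At a generic point, the kernel of the pulled back derivative is contained in the kernel of the
pulled back form, and it is determined by the restriction to the first factor. -/
lemma kernel_pullback_scaleSnd {q k : ℕ} (hq : 1 ≤ q)
    {η : (Fin (q + 2) → ℂ) × (Fin k → ℂ) → ((Fin (q + 2) → ℂ) × (Fin k → ℂ)) [⋀^Fin q]→L[ℂ] ℂ}
    (hη : IsIntegrable η) :
    ∀ᶠ z in 𝓝 (0 : ((Fin (q + 2) → ℂ) × (Fin k → ℂ)) × ℂ), z.2 ≠ 0 → pullback scaleSnd η z ≠ 0 →
      ∀ X, X ≠ 0 → (extDeriv (pullback scaleSnd η) z).compContinuousLinearMap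
          (incl (Fin (q + 2) → ℂ) (Fin k → ℂ)) = (volForm (q + 2)).curryLeft X →
        incl _ _ X ∈ formKernel (extDeriv (pullback scaleSnd η) z) ∧
        (∀ U, ((extDeriv (pullback scaleSnd η) z).curryLeft U).compContinuousLinearMap
          (incl _ _) = 0 → U ∈ formKernel (extDeriv (pullback scaleSnd η) z)) ∧
        formKernel (extDeriv (pullback scaleSnd η) z) ≤ formKernel (pullback scaleSnd η z) := by
  have ht : Tendsto (scaleSnd : ((Fin (q + 2) → ℂ) × (Fin k → ℂ)) × ℂ → _) (𝓝 0) (𝓝 0) := by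
    have := (analyticAt_scaleSnd (0 : ((Fin (q + 2) → ℂ) × (Fin k → ℂ)) × ℂ)).continuousAt.tendsto
    rwa [scaleSnd_zero] at this
  filter_upwards [ht.eventually hη.2, ht.eventually hη.1.eventually_analyticAt] with z h1 h2 hz hne X
    hX hXθ
  have hS := scaleSndDeriv_surjective hz
  have hpull : pullback scaleSnd η z = (η (scaleSnd z)).compContinuousLinearMap (scaleSndDeriv z) := by
    rw [pullback, (hasFDerivAt_scaleSnd z).fderiv]
  have hθ : extDeriv (pullback scaleSnd η) z =
      (extDeriv η (scaleSnd z)).compContinuousLinearMap (scaleSndDeriv z) := by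
    rw [extDeriv_pullback_apply h2 (analyticAt_scaleSnd z), pullback, (hasFDerivAt_scaleSnd z).fderiv]
  have hne' : η (scaleSnd z) ≠ 0 := by
    rw [hpull, ne_eq, compContinuousLinearMap_eq_zero_iff hS] at hne
    exact hne
  obtain ⟨ω, hω, hev⟩ := h1 hne'
  obtain ⟨hdim, hker⟩ := formKernel_extDeriv_of_integrable hq h2.differentiableAt
    (fun j => (hω j).differentiableAt) (hev.mono fun x hx => hx.1) hev.self_of_nhds.2 hne'
  have hK : formKernel (extDeriv (pullback scaleSnd η) z) =
      (formKernel (extDeriv η (scaleSnd z))).comap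
        (scaleSndDeriv z : _ →ₗ[ℂ] (Fin (q + 2) → ℂ) × (Fin k → ℂ)) := by
    rw [hθ, formKernel_comp_of_surjective hS]
  -- For `t ≠ 0` the scaling is a submersion, so the kernel of the pulled back derivative has the
  -- same codimension as the original one.
  have hcomap := finrank_comap_of_surjective (T := (scaleSndDeriv z :
    ((Fin (q + 2) → ℂ) × (Fin k → ℂ)) × ℂ →ₗ[ℂ] (Fin (q + 2) → ℂ) × (Fin k → ℂ))) hS
    (formKernel (extDeriv η (scaleSnd z)))
  rw [← hK] at hcomap
  have hinj : Function.Injective (incl (Fin (q + 2) → ℂ) (Fin k → ℂ)) := fun u v huv => by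
    simpa [incl_apply] using huv
  obtain ⟨hr1, hr2⟩ := rotational_mem_formKernel hinj (by omega) hX hXθ
  refine ⟨hr1, hr2, ?_⟩
  have hd0 : extDeriv η (scaleSnd z) ≠ 0 := by
    intro h0
    rw [hθ, h0] at hXθ
    have h3 : (volForm (q + 2)).curryLeft X = (volForm (q + 2)).curryLeft 0 := by
      rw [← hXθ, map_zero]
      rfl
    exact hX (curryLeft_volForm_injective h3)
  rw [hK, hpull, formKernel_comp_of_surjective hS]
  exact Submodule.comap_mono (hker hd0)

/-- The vector field whose flow trivializes the deformation `(x, ty)^* η`. -/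
theorem exists_transport {q k d : ℕ} (hq : 1 ≤ q) (P : Fin (q + 2) → MvPolynomial (Fin (q + 2)) ℂ)
    (hPd : ∀ j, (P j).IsHomogeneous d) (hP : ∀ x, (∀ j, MvPolynomial.eval x (P j) = 0) → x = 0)
    {η : (Fin (q + 2) → ℂ) × (Fin k → ℂ) → ((Fin (q + 2) → ℂ) × (Fin k → ℂ)) [⋀^Fin q]→L[ℂ] ℂ}
    (hη : IsIntegrable η)
    (hζ : ∀ᶠ x in 𝓝 0, extDeriv (pullback (fun x => (x, 0)) η) x =
      (volForm (q + 2)).curryLeft (fun j => MvPolynomial.eval x (P j))) :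
    ∃ a : ((Fin (q + 2) → ℂ) × (Fin k → ℂ)) × ℂ → Fin (q + 2) → ℂ, AnalyticAt ℂ a 0 ∧
      ∀ᶠ z in 𝓝 0, ((a z, 0), 1) ∈ formKernel (extDeriv (pullback scaleSnd η) z) ∧
        ((a z, 0), 1) ∈ formKernel (pullback scaleSnd η z) := by
  obtain ⟨r, rfl⟩ : ∃ r, q = r + 1 := ⟨q - 1, by omega⟩
  have hη0 : AnalyticAt ℂ η (scaleSnd (0 : ((Fin (r + 1 + 2) → ℂ) × (Fin k → ℂ)) × ℂ)) := by
    rw [scaleSnd_zero]; exact hη.1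
  have hη' : AnalyticAt ℂ (pullback scaleSnd η) 0 := analyticAt_pullback hη0 (analyticAt_scaleSnd 0)
  have hθ' := analyticAt_extDeriv hη'
  set η' := pullback scaleSnd η with hη'_def
  set θ := extDeriv η' with hθ_def
  let ι := incl (Fin (r + 1 + 2) → ℂ) (Fin k → ℂ)
  -- The rotational along the `x`-directions, depending on `(y, t)` as parameters; at `t = 0` it is
  -- the homogeneous field `P`.
  let X : ((Fin (r + 1 + 2) → ℂ) × (Fin k → ℂ)) × ℂ → Fin (r + 1 + 2) → ℂ :=
    fun z j => vecOf j ((θ z).compContinuousLinearMap ι)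
  have hXθ : ∀ z, (θ z).compContinuousLinearMap ι = (volForm (r + 1 + 2)).curryLeft (X z) := fun z =>
    (curryLeft_vecOf _).symm
  have hXa : AnalyticAt ℂ X 0 := AnalyticAt.pi fun j =>
    ((vecOf j).analyticAt _).fun_comp (analyticAt_compContinuousLinearMap hθ' analyticAt_const)
  have hemb : ∀ x : Fin (r + 1 + 2) → ℂ, HasFDerivAt (fun x : Fin (r + 1 + 2) → ℂ => (x, (0 : Fin k → ℂ)))
      (ContinuousLinearMap.inl ℂ (Fin (r + 1 + 2) → ℂ) (Fin k → ℂ)) x := fun x =>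
    (ContinuousLinearMap.inl ℂ (Fin (r + 1 + 2) → ℂ) (Fin k → ℂ)).hasFDerivAt
  have hXP : ∀ᶠ p in 𝓝 (0 : (Fin (r + 1 + 2) → ℂ) × (Fin k → ℂ)), ∀ j,
      X (p, 0) j = MvPolynomial.eval p.1 (P j) := by
    have h1 : Tendsto (fun p : (Fin (r + 1 + 2) → ℂ) × (Fin k → ℂ) =>
        (p.1, (0 : Fin k → ℂ))) (𝓝 0) (𝓝 0) := by
      have : Continuous (fun p : (Fin (r + 1 + 2) → ℂ) × (Fin k → ℂ) => (p.1, (0 : Fin k → ℂ))) := by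
        fun_prop
      exact this.tendsto 0
    have h2 : Tendsto (fun p : (Fin (r + 1 + 2) → ℂ) × (Fin k → ℂ) => p.1) (𝓝 0) (𝓝 0) :=
      continuous_fst.tendsto 0
    filter_upwards [h2.eventually hζ, h1.eventually hη.1.eventually_analyticAt] with p h3 h4 j
    have h5 : scaleSnd (p, (0 : ℂ)) = (p.1, 0) := by simp [scaleSnd]
    have h6 : (θ (p, 0)).compContinuousLinearMap ι =
        extDeriv (pullback (fun x : Fin (r + 1 + 2) → ℂ => (x, (0 : Fin k → ℂ))) η) p.1 := by
      rw [extDeriv_pullback_apply (f := fun x : Fin (r + 1 + 2) → ℂ => (x, (0 : Fin k → ℂ))) h4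
        (analyticAt_id.prod analyticAt_const), hθ_def, hη'_def, extDeriv_pullback_apply (by rw [h5]; exact h4)
        (analyticAt_scaleSnd _), pullback, pullback, (hasFDerivAt_scaleSnd _).fderiv,
        (hemb p.1).fderiv, h5]
      ext v
      change extDeriv η (p.1, 0) _ = extDeriv η (p.1, 0) _
      congr 1
      funext i
      simp [scaleSndDeriv_apply, ι, incl_apply]
    change vecOf j ((θ (p, 0)).compContinuousLinearMap ι) = _
    rw [h6, h3, vecOf_curryLeft]
  have hXne : ¬ ∀ᶠ z in 𝓝 0, X z = 0 := by
    intro h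
    have h1 : Tendsto (fun x : Fin (r + 1 + 2) → ℂ =>
        (((x, 0), 0) : ((Fin (r + 1 + 2) → ℂ) × (Fin k → ℂ)) × ℂ)) (𝓝 0) (𝓝 0) := by
      have : Continuous fun x : Fin (r + 1 + 2) → ℂ =>
        (((x, 0), 0) : ((Fin (r + 1 + 2) → ℂ) × (Fin k → ℂ)) × ℂ) := by fun_prop
      exact this.tendsto 0
    have h2 : Tendsto (fun x : Fin (r + 1 + 2) → ℂ =>
        ((x, 0) : (Fin (r + 1 + 2) → ℂ) × (Fin k → ℂ))) (𝓝 0) (𝓝 0) := by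
      have : Continuous fun x : Fin (r + 1 + 2) → ℂ =>
        ((x, 0) : (Fin (r + 1 + 2) → ℂ) × (Fin k → ℂ)) := by fun_prop
      exact this.tendsto 0
    obtain ⟨x, ⟨hx1, hx2⟩, hx3⟩ := ((((h1.eventually h).and (h2.eventually hXP)).filter_mono
      nhdsWithin_le_nhds).and (self_mem_nhdsWithin (s := {(0 : Fin (r + 1 + 2) → ℂ)}ᶜ))).exists
    refine hx3 (hP x fun j => ?_)
    rw [← hx2 j]
    exact congrFun hx1 j
  have hη'ne : ¬ ∀ᶠ z in 𝓝 0, η' z = 0 := by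
    intro h
    apply hXne
    filter_upwards [h.eventually_nhds] with z hz
    have h1 : θ z = 0 := by
      have h2 : η' =ᶠ[𝓝 z] fun _ => 0 := hz
      rw [hθ_def, h2.extDeriv_eq, extDeriv]
      simp only [fderiv_fun_const, Pi.zero_apply]
      exact map_zero (ContinuousAlternatingMap.alternatizeUncurryFinCLM ℂ _ ℂ)
    funext j
    change vecOf j ((θ z).compContinuousLinearMap ι) = 0
    rw [h1, show (0 : (((Fin (r + 1 + 2) → ℂ) × (Fin k → ℂ)) × ℂ) [⋀^Fin (r + 1 + 1)]→L[ℂ]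
      ℂ).compContinuousLinearMap ι = 0 from rfl, map_zero]
  have htne : ¬ ∀ᶠ z : ((Fin (r + 1 + 2) → ℂ) × (Fin k → ℂ)) × ℂ in 𝓝 0, z.2 = 0 := by
    intro h
    have h1 : Tendsto (fun t : ℂ => ((0, t) : ((Fin (r + 1 + 2) → ℂ) × (Fin k → ℂ)) × ℂ))
        (𝓝 0) (𝓝 0) := by
      have : Continuous fun t : ℂ => ((0, t) : ((Fin (r + 1 + 2) → ℂ) × (Fin k → ℂ)) × ℂ) := by
        fun_prop
      exact this.tendsto 0
    obtain ⟨x, hx1, hx2⟩ := (((h1.eventually h).filter_mono nhdsWithin_le_nhds).and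
      (self_mem_nhdsWithin (s := {(0 : ℂ)}ᶜ))).exists
    exact hx2 hx1
  have hgen := kernel_pullback_scaleSnd hq hη
  -- The kernel statements come from integrability only where `t`, `η'` and `X` do not vanish. Each
  -- condition defines a dense open set, so analytic identities extend from there.
  have hdense : ∀ {F : Type} [NormedAddCommGroup F] [NormedSpace ℂ F] [CompleteSpace F]
      {G : ((Fin (r + 1 + 2) → ℂ) × (Fin k → ℂ)) × ℂ → F}, AnalyticAt ℂ G 0 →
      (∀ᶠ z in 𝓝 0, z.2 ≠ 0 → η' z ≠ 0 → X z ≠ 0 → G z = 0) → ∀ᶠ z in 𝓝 0, G z = 0 := by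
    intro F _ _ _ G hG h
    have h1 := eventually_frequently_ne (f := fun z : ((Fin (r + 1 + 2) → ℂ) × (Fin k → ℂ)) × ℂ =>
      z.2) analyticAt_snd htne
    have h2 := eventually_frequently_and_ne h1 (.of_forall fun z hz =>
      continuous_snd.continuousAt.eventually_ne hz) hη' hη'ne
    have h3 := eventually_frequently_and_ne h2 (by
      filter_upwards [hη'.eventually_analyticAt] with z hz hz'
      exact (continuous_snd.continuousAt.eventually_ne hz'.1).and
        (hz.continuousAt.eventually_ne hz'.2)) hXa hXne
    filter_upwards [h3, h.eventually_nhds, hG.eventually_analyticAt] with z hz hz1 hz2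
    by_contra hne
    obtain ⟨w, ⟨hw1, hw2⟩, hw3⟩ := (hz.and_eventually
      (hz1.and (hz2.continuousAt.eventually_ne hne))).exists
    exact hw3.2 (hw3.1 hw1.1 hw1.2 hw2)
  let V0 : ((Fin (r + 1 + 2) → ℂ) × (Fin k → ℂ)) × ℂ := ((0, 0), 1)
  -- `β` is the restriction of `i_{∂_t} dη'` to the `x`-directions, the obstruction to `∂_t` itself
  -- being in the kernel. It is annihilated by `X` because `X` lies in the kernel of `dη'`.
  let β : ((Fin (r + 1 + 2) → ℂ) × (Fin k → ℂ)) × ℂ →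
      (Fin (r + 1 + 2) → ℂ) [⋀^Fin (r + 1)]→L[ℂ] ℂ :=
    fun z => ((θ z).curryLeft V0).compContinuousLinearMap ι
  have hβ : AnalyticAt ℂ β 0 :=
    analyticAt_compContinuousLinearMap (analyticAt_curryLeft hθ' analyticAt_const) analyticAt_const
  have hXβ : ∀ᶠ z in 𝓝 0, X z ∈ formKernel (β z) := by
    have h1 := hdense (analyticAt_curryLeft hβ hXa) (by
      filter_upwards [hgen] with z hz h1 h2 h3
      obtain ⟨h4, -, -⟩ := hz h1 h2 (X z) h3 (hXθ z)
      rw [mem_formKernel_iff] at h4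
      ext v
      change θ z (Matrix.vecCons V0 fun i => ι (Matrix.vecCons (X z) v i)) = 0
      exact apply_eq_zero_of_mem_formKernel (i := 1) (mem_formKernel_iff.2 h4))
    filter_upwards [h1] with z hz
    exact mem_formKernel_iff.2 hz
  obtain ⟨a, ha, hβa⟩ := exists_division hq P hPd hP hXa hXP hβ hXβ
  have hU : AnalyticAt ℂ (fun z => (((-a z, 0), 1) :
      ((Fin (r + 1 + 2) → ℂ) × (Fin k → ℂ)) × ℂ)) 0 :=
    (ha.neg.prod analyticAt_const).prod analyticAt_const
  -- Correcting `∂_t` by the quotient `a` cancels `β`; at generic points a field whose contraction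
  -- with `dη'` restricts to zero lies in the kernel.
  have hres : ∀ᶠ z in 𝓝 0, ((θ z).curryLeft ((-a z, 0), 1)).compContinuousLinearMap ι = 0 := by
    filter_upwards [hβa] with z hz
    have h1 : (((-a z, 0), 1) : ((Fin (r + 1 + 2) → ℂ) × (Fin k → ℂ)) × ℂ) = V0 - ι (a z) := by
      simp [V0, ι, incl_apply]
    rw [h1, map_sub]
    have h2 : ((θ z).curryLeft (ι (a z))).compContinuousLinearMap ι =
        ((volForm (r + 1 + 2)).curryLeft (X z)).curryLeft (a z) := by
      rw [← hXθ, ContinuousAlternatingMap.curryLeft_compContinuousLinearMap]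
    ext v
    have h3 := congrArg (fun γ => γ v) (hz.trans h2.symm)
    exact sub_eq_zero.2 h3
  have hker : ∀ᶠ z in 𝓝 0, z.2 ≠ 0 → η' z ≠ 0 → X z ≠ 0 →
      ((-a z, 0), 1) ∈ formKernel (θ z) ∧ ((-a z, 0), 1) ∈ formKernel (η' z) := by
    filter_upwards [hgen, hres] with z hz hz' h1 h2 h3
    obtain ⟨-, h5, h6⟩ := hz h1 h2 (X z) h3 (hXθ z)
    exact ⟨h5 _ hz', h6 (h5 _ hz')⟩
  refine ⟨fun z => -a z, ha.neg, ?_⟩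
  filter_upwards [hdense (analyticAt_curryLeft hθ' hU) (hker.mono fun z hz h1 h2 h3 =>
    mem_formKernel_iff.1 (hz h1 h2 h3).1), hdense (analyticAt_curryLeft hη' hU) (hker.mono fun z hz h1 h2 h3 =>
    mem_formKernel_iff.1 (hz h1 h2 h3).2)] with z h1 h2
  exact ⟨mem_formKernel_iff.2 h1, mem_formKernel_iff.2 h2⟩

/-! ### Trivialization of a form by a flow. -/

section Flow

variable {E F : Type*} [NormedAddCommGroup E] [NormedSpace ℂ E]
  [NormedAddCommGroup F] [NormedSpace ℂ F]

lemma curryLeft_comp_eq_zero {q : ℕ} {α : F [⋀^Fin (q + 1)]→L[ℂ] ℂ} {T : E →L[ℂ] F} {w : E}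
    (h : T w ∈ formKernel α) : (α.compContinuousLinearMap T).curryLeft w = 0 := by
  rw [ContinuousAlternatingMap.curryLeft_compContinuousLinearMap, mem_formKernel_iff.1 h]
  rfl

/-- A form is invariant along a constant field in the kernel of the form and of its derivative. -/
lemma fderiv_apply_eq_zero_of_curryLeft_eq_zero {q : ℕ} {ω : E → E [⋀^Fin (q + 1)]→L[ℂ] ℂ} {z w : E}
    (hω : DifferentiableAt ℂ ω z) (h : ∀ᶠ x in 𝓝 z, (ω x).curryLeft w = 0)
    (hd : (extDeriv ω z).curryLeft w = 0) : fderiv ℂ ω z w = 0 := by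
  have h1 : contractRight (fderiv ℂ ω z) w = 0 := by
    let L : (E [⋀^Fin (q + 1)]→L[ℂ] ℂ) →L[ℂ] E [⋀^Fin q]→L[ℂ] ℂ :=
      ContinuousLinearMap.apply ℂ (E [⋀^Fin q]→L[ℂ] ℂ) w ∘L
        (ContinuousAlternatingMap.curryLeftLI (𝕜 := ℂ) (E := E) (F := ℂ)).toContinuousLinearMap
    have h2 : HasFDerivAt (fun x => L (ω x)) (L ∘L fderiv ℂ ω z) z :=
      L.hasFDerivAt.comp z hω.hasFDerivAt
    have h3 : (fun x => L (ω x)) =ᶠ[𝓝 z] fun _ => 0 := h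
    exact h2.unique ((hasFDerivAt_const _ _).congr_of_eventuallyEq h3)
  rw [extDeriv, curryLeft_alternatizeUncurryFin, h1] at hd
  rw [← hd, eq_comm, sub_eq_self]
  exact map_zero (ContinuousAlternatingMap.alternatizeUncurryFinCLM ℂ E ℂ)

/-- If the field `(a, 1)` is in the kernel of the form `η` on `E × ℂ` and of its derivative, then
the flow of `a` trivializes `η`. -/
theorem exists_flow_pullback_eq [FiniteDimensional ℂ E] {q : ℕ}
    {η : E × ℂ → (E × ℂ) [⋀^Fin (q + 1)]→L[ℂ] ℂ} (hη : AnalyticAt ℂ η 0) {a : E × ℂ → E}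
    (ha : AnalyticAt ℂ a 0)
    (h : ∀ᶠ z in 𝓝 0, (a z, 1) ∈ formKernel (extDeriv η z) ∧ (a z, 1) ∈ formKernel (η z)) :
    ∃ g : E × ℂ → E, AnalyticAt ℂ g 0 ∧ (∀ᶠ z in 𝓝 (0 : E × ℂ), z.2 = 0 → g z = z.1) ∧
      (∀ᶠ z in 𝓝 (0 : E × ℂ), fderiv ℂ g z (0, 1) = a (g z, z.2)) ∧
      ∀ᶠ z in 𝓝 (0 : E × ℂ), pullback (fun z => (g z, z.2)) η z =
        pullback (fun z => (g z, z.2)) η (z.1, 0) := by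
  have : CompleteSpace E := FiniteDimensional.complete ℂ E
  obtain ⟨g, hg, hg0, hga⟩ := exists_flow ha
  refine ⟨g, hg, hg0, hga, ?_⟩
  set Γ : E × ℂ → E × ℂ := fun z => (g z, z.2) with hΓ_def
  have hΓ : AnalyticAt ℂ Γ 0 := hg.prod analyticAt_snd
  have hΓ0 : Γ 0 = 0 := Prod.ext (hg0.self_of_nhds rfl) rfl
  have hΓt : Tendsto Γ (𝓝 0) (𝓝 0) := by
    have := hΓ.continuousAt.tendsto
    rwa [hΓ0] at this
  have hη0 : AnalyticAt ℂ η (Γ 0) := by rwa [hΓ0]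
  have hω : AnalyticAt ℂ (pullback Γ η) 0 := analyticAt_pullback hη0 hΓ
  -- `Γ` straightens the field `(a, 1)` to the constant field `∂_t`, so the pulled back form and its
  -- derivative are annihilated by `∂_t`, and the form does not depend on `t`.
  have hw : ∀ᶠ z in 𝓝 0, fderiv ℂ Γ z (0, 1) = (a (Γ z), 1) := by
    filter_upwards [hga, hg.eventually_analyticAt] with z h1 h2
    have h3 : HasFDerivAt Γ ((fderiv ℂ g z).prod (ContinuousLinearMap.snd ℂ E ℂ)) z :=
      h2.differentiableAt.hasFDerivAt.prodMk hasFDerivAt_snd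
    rw [h3.fderiv]
    exact Prod.ext h1 rfl
  have h1 : ∀ᶠ z in 𝓝 0, (pullback Γ η z).curryLeft (0, 1) = 0 := by
    filter_upwards [hw, hΓt.eventually h] with z hz hz'
    refine curryLeft_comp_eq_zero ?_
    rw [hz]
    exact hz'.2
  have h2 : ∀ᶠ z in 𝓝 0, (extDeriv (pullback Γ η) z).curryLeft (0, 1) = 0 := by
    filter_upwards [hw, hΓt.eventually h, hΓt.eventually hη.eventually_analyticAt,
      hΓ.eventually_analyticAt] with z hz hz' hz1 hz2
    rw [extDeriv_pullback_apply hz1 hz2]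
    refine curryLeft_comp_eq_zero ?_
    rw [hz]
    exact hz'.1
  refine eventually_eq_of_fderiv_snd_eq_zero hω ?_
  filter_upwards [h1.eventually_nhds, h2, hω.eventually_analyticAt] with z hz1 hz2 hz3
  exact fderiv_apply_eq_zero_of_curryLeft_eq_zero hz3.differentiableAt hz1 hz2

end Flow

/-! ### Triviality of the form in the transverse directions. -/

section Unfolding

variable {V W : Type*} [NormedAddCommGroup V] [NormedSpace ℂ V]
  [NormedAddCommGroup W] [NormedSpace ℂ W]

/-- The time-0 map is the identity, so nearby time maps keep an invertible derivative, and for `ρ ≠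
0` the scaling is a linear isomorphism on the slice. -/
lemma exists_fderiv_slice [FiniteDimensional ℂ V] [FiniteDimensional ℂ W]
    {g : (V × W) × ℂ → V × W} (hg : AnalyticAt ℂ g 0)
    (hg0 : ∀ᶠ z in 𝓝 (0 : (V × W) × ℂ), z.2 = 0 → g z = z.1) :
    ∀ᶠ ρ in 𝓝 (0 : ℂ), ρ ≠ 0 →
      ∃ T : (V × W) ≃L[ℂ] V × W, HasFDerivAt (fun p => scaleSnd (g (p, ρ), ρ)) (T : _ →L[ℂ] _) 0 := by
  have : CompleteSpace V := FiniteDimensional.complete ℂ V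
  have : CompleteSpace W := FiniteDimensional.complete ℂ W
  have hc : ContinuousAt (fun ρ : ℂ => ((0 : V × W), ρ)) 0 :=
    (continuous_const.prodMk continuous_id).continuousAt
  have hslice : ∀ ρ : ℂ, HasFDerivAt (fun p : V × W => (p, ρ))
      (ContinuousLinearMap.inl ℂ (V × W) ℂ) 0 := fun ρ =>
    (hasFDerivAt_id _).prodMk (hasFDerivAt_const _ _)
  have h1 : ContinuousAt (fun ρ : ℂ => fderiv ℂ g (0, ρ) ∘L ContinuousLinearMap.inl ℂ (V × W) ℂ)
      0 := by
    have h2 : ContinuousAt (fun ρ : ℂ => fderiv ℂ g (0, ρ)) 0 :=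
      ContinuousAt.comp (g := fderiv ℂ g) (f := fun ρ : ℂ => ((0 : V × W), ρ))
        hg.fderiv.continuousAt hc
    exact h2.clm_comp continuousAt_const
  have h3 : fderiv ℂ g (0, 0) ∘L ContinuousLinearMap.inl ℂ (V × W) ℂ =
      ContinuousLinearEquiv.refl ℂ (V × W) := by
    have h4 : HasFDerivAt (fun p : V × W => g (p, (0 : ℂ)))
        (fderiv ℂ g (0, 0) ∘L ContinuousLinearMap.inl ℂ (V × W) ℂ) 0 :=
      HasFDerivAt.comp (g := g) (0 : V × W) hg.differentiableAt.hasFDerivAt (hslice 0)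
    have h5 : (fun p : V × W => g (p, (0 : ℂ))) =ᶠ[𝓝 0] id := by
      filter_upwards [(continuous_id.prodMk continuous_const).tendsto (0 : V × W)
        |>.eventually hg0] with p hp using hp rfl
    exact h4.unique ((hasFDerivAt_id _).congr_of_eventuallyEq h5)
  have h6 : Set.range ((↑) : ((V × W) ≃L[ℂ] V × W) → _) ∈
      𝓝 (fderiv ℂ g (0, 0) ∘L ContinuousLinearMap.inl ℂ (V × W) ℂ) := by
    rw [h3]; exact ContinuousLinearEquiv.nhds _
  filter_upwards [h1.eventually h6, hc.eventually hg.eventually_analyticAt] with ρ hρ hρ' hne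
  obtain ⟨T, hT⟩ := hρ
  let S : (V × W) ≃L[ℂ] V × W := (ContinuousLinearEquiv.refl ℂ V).prodCongr
    (ContinuousLinearEquiv.smulLeft (Units.mk0 ρ hne))
  refine ⟨T.trans S, ?_⟩
  have h7 : HasFDerivAt (fun p : V × W => g (p, ρ)) (T : _ →L[ℂ] _) 0 := by
    rw [hT]
    exact HasFDerivAt.comp (g := g) (0 : V × W) hρ'.differentiableAt.hasFDerivAt (hslice ρ)
  exact (S : (V × W) →L[ℂ] V × W).hasFDerivAt.comp (0 : V × W) h7

/-- The inclusions of all slices have the same derivative, so only the values of the two forms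
matter. -/
lemma pullback_slice_congr {q : ℕ} {ω ω' : (V × W) × ℂ → ((V × W) × ℂ) [⋀^Fin q]→L[ℂ] ℂ}
    {p : V × W} {ρ ρ' : ℂ}
    (h : ω (p, ρ) = ω' (p, ρ')) :
    pullback (fun p => (p, ρ)) ω p = pullback (fun p => (p, ρ')) ω' p := by
  have hslice : ∀ ρ : ℂ, HasFDerivAt (fun p : V × W => (p, ρ))
      (ContinuousLinearMap.inl ℂ (V × W) ℂ) p := fun ρ =>
    (hasFDerivAt_id _).prodMk (hasFDerivAt_const _ _)
  rw [pullback, pullback, h, (hslice ρ).fderiv, (hslice ρ').fderiv]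

end Unfolding

/-- A form on `V × W` whose restriction to `V` is a conic homogeneous form is a pull back of this
restriction, up to a change of coordinates. -/
theorem exists_unfolding {q k d : ℕ} (hq : 1 ≤ q) (hd : 1 ≤ d)
    (P : Fin (q + 2) → MvPolynomial (Fin (q + 2)) ℂ)
    (hPd : ∀ j, (P j).IsHomogeneous d) (hP : ∀ x, (∀ j, MvPolynomial.eval x (P j) = 0) → x = 0)
    {η : (Fin (q + 2) → ℂ) × (Fin k → ℂ) → ((Fin (q + 2) → ℂ) × (Fin k → ℂ)) [⋀^Fin q]→L[ℂ] ℂ}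
    (hη : IsIntegrable η)
    (hζ : ∀ᶠ x in 𝓝 0, extDeriv (pullback (fun x => (x, 0)) η) x =
      (volForm (q + 2)).curryLeft (fun j => MvPolynomial.eval x (P j))) :
    ∃ F : (Fin (q + 2) → ℂ) × (Fin k → ℂ) → (Fin (q + 2) → ℂ) × (Fin k → ℂ),
      AnalyticAt ℂ F 0 ∧ F 0 = 0 ∧
      (∃ T : ((Fin (q + 2) → ℂ) × (Fin k → ℂ)) ≃L[ℂ] (Fin (q + 2) → ℂ) × (Fin k → ℂ),
        fderiv ℂ F 0 = T) ∧
      ∀ᶠ p in 𝓝 0, pullback F η p = pullback Prod.fst (pullback (fun x => (x, 0)) η) p := by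
  obtain ⟨a, ha, haU⟩ := exists_transport hq P hPd hP hη hζ
  obtain ⟨r, rfl⟩ : ∃ r, q = r + 1 := ⟨q - 1, by omega⟩
  have hη0 : AnalyticAt ℂ η (scaleSnd (0 : ((Fin (r + 1 + 2) → ℂ) × (Fin k → ℂ)) × ℂ)) := by
    rw [scaleSnd_zero]; exact hη.1
  have hη' : AnalyticAt ℂ (pullback scaleSnd η) 0 := analyticAt_pullback hη0 (analyticAt_scaleSnd 0)
  obtain ⟨g, hg, hg0, hga, hgω⟩ := exists_flow_pullback_eq hη'
    (ha.prod (analyticAt_const (v := (0 : Fin k → ℂ)))) haU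
  set Γ : ((Fin (r + 1 + 2) → ℂ) × (Fin k → ℂ)) × ℂ → _ := fun z => (g z, z.2) with hΓ_def
  have hΓ : AnalyticAt ℂ Γ 0 := hg.prod analyticAt_snd
  have hΓ0 : Γ 0 = 0 := Prod.ext (hg0.self_of_nhds rfl) rfl
  have hΓt : Tendsto Γ (𝓝 0) (𝓝 0) := by
    have := hΓ.continuousAt.tendsto
    rwa [hΓ0] at this
  have hemb : Tendsto (fun x : Fin (r + 1 + 2) → ℂ => (x, (0 : Fin k → ℂ))) (𝓝 0) (𝓝 0) := by
    have : Continuous fun x : Fin (r + 1 + 2) → ℂ => (x, (0 : Fin k → ℂ)) := by fun_prop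
    exact this.tendsto 0
  have hpull : ∀ᶠ ρ in 𝓝 (0 : ℂ), ∀ᶠ p in 𝓝 (0 : (Fin (r + 1 + 2) → ℂ) × (Fin k → ℂ)),
      pullback (fun p => scaleSnd (Γ (p, ρ))) η p = pullback (fun p => (p, ρ))
        (pullback Γ (pullback scaleSnd η)) p := by
    refine (eventually_slice hΓ.eventually_analyticAt).mono fun ρ h1 => ?_
    filter_upwards [h1] with p h1
    have h2 : DifferentiableAt ℂ (fun p : (Fin (r + 1 + 2) → ℂ) × (Fin k → ℂ) => (p, ρ)) p :=
      differentiableAt_id.prodMk (differentiableAt_const _)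
    exact (pullback_comp (f := scaleSnd) (g := Γ ∘ fun p => (p, ρ))
      (analyticAt_scaleSnd _).differentiableAt (h1.differentiableAt.comp p h2)).trans
      (pullback_comp (f := Γ) h1.differentiableAt h2)
  -- At time 0 the flow is the identity and the scaling projects `(x, y)` to `(x, 0)`.
  have hzero : ∀ᶠ p in 𝓝 (0 : (Fin (r + 1 + 2) → ℂ) × (Fin k → ℂ)),
      pullback (fun p => (p, 0)) (pullback Γ (pullback scaleSnd η)) p =
        pullback Prod.fst (pullback (fun x => (x, 0)) η) p := by
    have h1 : Tendsto (fun p : (Fin (r + 1 + 2) → ℂ) × (Fin k → ℂ) => (p, (0 : ℂ))) (𝓝 0) (𝓝 0) := by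
      have : Continuous fun p : (Fin (r + 1 + 2) → ℂ) × (Fin k → ℂ) => (p, (0 : ℂ)) := by fun_prop
      exact this.tendsto 0
    filter_upwards [hpull.self_of_nhds, (h1.eventually hg0).eventually_nhds] with p h2 h3
    rw [← h2, ← pullback_comp (differentiableAt_id.prodMk (differentiableAt_const _))
      differentiableAt_fst]
    refine pullback_congr (h3.mono fun p' hp' => ?_)
    simp [scaleSnd, Γ, hp' rfl]
  -- The transport field has no component along `y`, so its flow preserves `y`.
  have hsnd : ∀ᶠ z in 𝓝 0, (g z).2 = z.1.2 := by
    have h1 : AnalyticAt ℂ (fun z => (g z).2) 0 := analyticAt_snd.fun_comp hg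
    have h2 := eventually_eq_of_fderiv_snd_eq_zero h1 (by
      filter_upwards [hga, hg.eventually_analyticAt] with z h2 h3
      have h4 : HasFDerivAt (fun z => (g z).2)
          (ContinuousLinearMap.snd ℂ (Fin (r + 1 + 2) → ℂ) (Fin k → ℂ) ∘L fderiv ℂ g z) z :=
        (ContinuousLinearMap.snd ℂ (Fin (r + 1 + 2) → ℂ) (Fin k → ℂ)).hasFDerivAt.comp z
          h3.differentiableAt.hasFDerivAt
      rw [h4.fderiv]
      change (fderiv ℂ g z (0, 1)).2 = 0
      rw [h2])
    have h3 : Tendsto (fun z : ((Fin (r + 1 + 2) → ℂ) × (Fin k → ℂ)) × ℂ => (z.1, (0 : ℂ))) (𝓝 0)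
        (𝓝 0) := by
      have : Continuous fun z : ((Fin (r + 1 + 2) → ℂ) × (Fin k → ℂ)) × ℂ => (z.1, (0 : ℂ)) := by
        fun_prop
      exact this.tendsto 0
    filter_upwards [h2, h3.eventually hg0] with z h4 h5
    rw [h4, h5 rfl]
  have hζa : AnalyticAt ℂ (pullback (fun x : Fin (r + 1 + 2) → ℂ => (x, (0 : Fin k → ℂ))) η) 0 :=
    analyticAt_pullback hη.1 (analyticAt_id.prod analyticAt_const)
  have hρ0 : Tendsto (fun ρ : ℂ => ((0, ρ) : ((Fin (r + 1 + 2) → ℂ) × (Fin k → ℂ)) × ℂ))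
      (𝓝 0) (𝓝 0) := by
    have : Continuous fun ρ : ℂ => ((0, ρ) : ((Fin (r + 1 + 2) → ℂ) × (Fin k → ℂ)) × ℂ) := by
      fun_prop
    exact this.tendsto 0
  have hg1 : Tendsto (fun z => (g z).1) (𝓝 0) (𝓝 0) := by
    have h1 : ContinuousAt (fun z => (g z).1) 0 := continuousAt_fst.comp hg.continuousAt
    have h2 := h1.tendsto
    rwa [show (g 0).1 = 0 from congrArg (fun z => z.1.1) hΓ0] at h2
  have hall := (eventually_slice hgω).and (hpull.and ((exists_fderiv_slice hg hg0).and
    ((hρ0.eventually hsnd).and ((hρ0.eventually (hg1.eventually hζ)).and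
    ((hρ0.eventually hΓ.eventually_analyticAt).and
    (hρ0.eventually (hg1.eventually (hemb.eventually hη.1.eventually_analyticAt))))))))
  obtain ⟨ρ, ⟨h1, h2, h3, h4, h5, h6, h7⟩, hρ⟩ := ((hall.filter_mono nhdsWithin_le_nhds).and
    (self_mem_nhdsWithin (s := {(0 : ℂ)}ᶜ))).exists
  obtain ⟨T, hT⟩ := h3 hρ
  have hF : AnalyticAt ℂ (fun p => scaleSnd (Γ (p, ρ))) 0 :=
    (analyticAt_scaleSnd _).fun_comp (AnalyticAt.fun_comp (g := Γ) h6
      (analyticAt_id.prod analyticAt_const))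
  have hF1 : ∀ᶠ p in 𝓝 0, pullback (fun p => scaleSnd (Γ (p, ρ))) η p =
      pullback Prod.fst (pullback (fun x => (x, 0)) η) p := by
    filter_upwards [h1, h2, hzero] with p h1 h2 h3
    rw [h2, ← h3]
    exact pullback_slice_congr h1
  have hFb : scaleSnd (Γ (0, ρ)) = ((g (0, ρ)).1, 0) := by
    refine Prod.ext rfl ?_
    change ρ • (g (0, ρ)).2 = 0
    rw [h4]
    exact smul_zero _
  -- Nothing forces the transport field to vanish at the origin, so the flow might move it. But `dη`
  -- must vanish at the image point, since the model derivative vanishes at 0, and the only zero of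
  -- `P` is the origin.
  have hb : (g (0, ρ)).1 = 0 := by
    have h8 : extDeriv (pullback (fun p => scaleSnd (Γ (p, ρ))) η) 0 =
        extDeriv (pullback Prod.fst (pullback (fun x => (x, 0)) η)) 0 :=
      Filter.EventuallyEq.extDeriv_eq hF1
    rw [extDeriv_pullback_apply (by rw [hFb]; exact h7) hF,
      extDeriv_pullback_apply (f := Prod.fst) (x := (0 : (Fin (r + 1 + 2) → ℂ) × (Fin k → ℂ))) hζa
        analyticAt_fst, pullback, pullback, hT.fderiv, hFb] at h8
    have h9 : extDeriv (pullback (fun x : Fin (r + 1 + 2) → ℂ => (x, (0 : Fin k → ℂ))) η) 0 = 0 := by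
      rw [hζ.self_of_nhds, show (fun j => MvPolynomial.eval 0 (P j)) = (0 : Fin (r + 1 + 2) → ℂ) from
        funext fun j => eval_zero_of_isHomogeneous (by omega) (hPd j)]
      exact map_zero _
    have h10 : extDeriv η ((g (0, ρ)).1, 0) = 0 := by
      rw [← compContinuousLinearMap_eq_zero_iff
        (T := (T : ((Fin (r + 1 + 2) → ℂ) × (Fin k → ℂ)) →L[ℂ] _)) T.surjective, h8,
        show ((0 : (Fin (r + 1 + 2) → ℂ) × (Fin k → ℂ)).1) = 0 from rfl, h9]
      rfl
    have h11 : (volForm (r + 1 + 2)).curryLeft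
        (fun j => MvPolynomial.eval (g (0, ρ)).1 (P j)) = (volForm (r + 1 + 2)).curryLeft 0 := by
      rw [← h5, extDeriv_pullback_apply (f := fun x : Fin (r + 1 + 2) → ℂ => (x, (0 : Fin k → ℂ))) h7
        (analyticAt_id.prod analyticAt_const), pullback, h10, map_zero]
      rfl
    exact hP _ fun j => congrFun (curryLeft_volForm_injective h11) j
  refine ⟨fun p => scaleSnd (Γ (p, ρ)), hF, ?_, ⟨T, hT.fderiv⟩, hF1⟩
  exact hFb.trans (by rw [hb]; rfl)

/-! ### Integrable germs under congruence, and germs of biholomorphisms. -/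

section Germs

variable {E F : Type*} [NormedAddCommGroup E] [NormedSpace ℂ E]
  [NormedAddCommGroup F] [NormedSpace ℂ F]

lemma IsIntegrable.congr {q : ℕ} {η η' : E → E [⋀^Fin q]→L[ℂ] ℂ} (hη : IsIntegrable η)
    (h : η =ᶠ[𝓝 0] η') : IsIntegrable η' := by
  refine ⟨hη.1.congr h, ?_⟩
  filter_upwards [hη.2, h.eventually_nhds] with p h1 h2 hne
  have h3 : η =ᶠ[𝓝 p] η' := h2
  obtain ⟨ω, hω, hev⟩ := h1 (by rwa [h3.eq_of_nhds])
  refine ⟨ω, hω, ?_⟩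
  filter_upwards [hev, h3] with x h4 h5
  rwa [← h5]

lemma IsIntegrable.finrank_formKernel [FiniteDimensional ℂ E] {q : ℕ} {η : E → E [⋀^Fin q]→L[ℂ] ℂ}
    (hη : IsIntegrable η) : ∀ᶠ p in 𝓝 (0 : E), η p ≠ 0 →
      Module.finrank ℂ (formKernel (η p)) + q = Module.finrank ℂ E := by
  filter_upwards [hη.2] with p h hne
  obtain ⟨ω, -, hev⟩ := h hne
  have h1 := hev.self_of_nhds.1
  rw [h1] at hne ⊢
  obtain ⟨e, he⟩ := exists_isDualTo hne
  exact he.finrank_formKernel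

lemma IsGermBiholomorphism.fderiv_comp {φ : OpenPartialHomeomorph E F}
    (h : IsGermBiholomorphism φ) {p : E} (hp : p ∈ φ.source) :
    fderiv ℂ φ.symm (φ p) ∘L fderiv ℂ φ p = ContinuousLinearMap.id ℂ E ∧
      fderiv ℂ φ p ∘L fderiv ℂ φ.symm (φ p) = ContinuousLinearMap.id ℂ F := by
  have hp' := φ.map_source hp
  have h1 := (h.2.2.1 p hp).differentiableAt.hasFDerivAt
  have h2 := (h.2.2.2 _ hp').differentiableAt.hasFDerivAt
  constructor
  · have h3 := h2.comp p h1
    refine h3.unique ((hasFDerivAt_id p).congr_of_eventuallyEq ?_)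
    filter_upwards [φ.open_source.mem_nhds hp] with x hx using φ.left_inv hx
  · have h1' : HasFDerivAt φ (fderiv ℂ φ p) (φ.symm (φ p)) := by rwa [φ.left_inv hp]
    have h3 := h1'.comp (φ p) h2
    refine h3.unique ((hasFDerivAt_id _).congr_of_eventuallyEq ?_)
    filter_upwards [φ.open_target.mem_nhds hp'] with x hx using φ.right_inv hx

lemma IsGermBiholomorphism.exists_fderiv_symm {φ : OpenPartialHomeomorph E F}
    (h : IsGermBiholomorphism φ) : ∃ T : F ≃L[ℂ] E, fderiv ℂ φ.symm 0 = T := by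
  obtain ⟨h1, h2⟩ := h.fderiv_comp h.1
  rw [h.2.1] at h1 h2
  exact ⟨ContinuousLinearEquiv.equivOfInverse (fderiv ℂ φ.symm 0) (fderiv ℂ φ 0)
    (fun x => DFunLike.congr_fun h2 x) (fun x => DFunLike.congr_fun h1 x), rfl⟩

/-- The inverse function theorem for germs of holomorphic maps. -/
theorem exists_isGermBiholomorphism [CompleteSpace E] [CompleteSpace F] {f : F → E}
    (hf : AnalyticAt ℂ f 0) (hf0 : f 0 = 0) {T : F ≃L[ℂ] E} (hT : fderiv ℂ f 0 = T) :
    ∃ φ : OpenPartialHomeomorph E F, IsGermBiholomorphism φ ∧ ⇑φ.symm = f := by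
  have hs : HasStrictFDerivAt f (T : F →L[ℂ] E) 0 := by
    rw [← hT]; exact hf.hasStrictFDerivAt
  let e := hs.toOpenPartialHomeomorph f
  have h0 : (0 : F) ∈ e.source := hs.mem_toOpenPartialHomeomorph_source
  have hef : ⇑e = f := rfl
  have hsymm : AnalyticAt ℂ e.symm 0 := by
    have := e.analyticAt_symm' (i := T) h0 hf hT
    rwa [hef, hf0] at this
  -- The local inverse is cut down twice, to the open sets where `f` and where its inverse are
  -- analytic, so that both directions are analytic on all of their domains.
  let e' := e.restrOpen {x | AnalyticAt ℂ f x} (isOpen_analyticAt ℂ f)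
  let φ := e'.symm.restrOpen {x | AnalyticAt ℂ e.symm x} (isOpen_analyticAt ℂ e.symm)
  have h0' : (0 : F) ∈ e'.source := by
    rw [OpenPartialHomeomorph.restrOpen_source]
    exact ⟨h0, hf⟩
  have hφ : ⇑φ = e.symm := rfl
  have hφs : ⇑φ.symm = f := rfl
  have he0 : e.symm 0 = 0 := by
    have := e.left_inv h0
    rwa [hef, hf0] at this
  have hsrc : φ.source = e'.target ∩ {x | AnalyticAt ℂ e.symm x} :=
    OpenPartialHomeomorph.restrOpen_source _ _ _
  refine ⟨φ, ⟨?_, he0, ?_, ?_⟩, hφs⟩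
  · rw [hsrc]
    refine ⟨?_, hsymm⟩
    have := e'.map_source h0'
    rwa [show e' 0 = 0 from hf0] at this
  · intro x hx
    rw [hsrc] at hx
    exact hx.2
  · intro y hy
    have h1 := φ.map_target hy
    rw [hsrc] at h1
    have h2 : e'.symm (φ.symm y) ∈ e'.source := e'.map_target h1.1
    have h3 : e'.symm (φ.symm y) = y := φ.right_inv hy
    rw [h3, OpenPartialHomeomorph.restrOpen_source] at h2
    exact h2.2

end Germs

/-- A conic homogeneous form has homogeneous polynomial coefficients. -/
lemma exists_polyForm_eq {q d : ℕ} (a : ℂ) {P : Fin (q + 2) → MvPolynomial (Fin (q + 2)) ℂ}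
    (hPd : ∀ j, (P j).IsHomogeneous d) :
    ∃ A : (Fin q ↪o Fin (q + 2)) → MvPolynomial (Fin (q + 2)) ℂ,
      (∀ σ, (A σ).IsHomogeneous (d + 1)) ∧ ∀ x, polyForm A x =
        a • ((volForm (q + 2)).curryLeft (fun j => MvPolynomial.eval x (P j))).curryLeft x := by
  let c : (Fin q ↪o Fin (q + 2)) → Fin (q + 2) → Fin (q + 2) → ℂ := fun σ j k =>
    ((volForm (q + 2)).curryLeft (stdVec j)).curryLeft (stdVec k) fun i => stdVec (σ i)
  refine ⟨fun σ => MvPolynomial.C a * ∑ j, ∑ k, MvPolynomial.C (c σ j k) * P j * MvPolynomial.X k,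
    fun σ => ?_, fun x => polyForm_eq_of_forall fun σ => ?_⟩
  · rw [← zero_add (d + 1)]
    refine (MvPolynomial.isHomogeneous_C _ _).mul (.sum _ _ _ fun j _ => .sum _ _ _ fun k _ => ?_)
    have := ((MvPolynomial.isHomogeneous_C (Fin (q + 2)) (c σ j k)).mul (hPd j)).mul
      (MvPolynomial.isHomogeneous_X ℂ k)
    rwa [zero_add] at this
  · have h1 : ∀ v w : Fin (q + 2) → ℂ, ((volForm (q + 2)).curryLeft v).curryLeft w
        (fun i => stdVec (σ i)) = ∑ j, ∑ k, v j * w k * c σ j k := by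
      intro v w
      let L1 : (Fin (q + 2) → ℂ) →ₗ[ℂ] ℂ :=
        { toFun := fun v => (volForm (q + 2)).curryLeft v (Matrix.vecCons w fun i => stdVec (σ i))
          map_add' := fun u v => by rw [map_add]; rfl
          map_smul' := fun c v => by rw [map_smul]; rfl }
      let L2 : Fin (q + 2) → (Fin (q + 2) → ℂ) →ₗ[ℂ] ℂ := fun j =>
        { toFun := fun w => ((volForm (q + 2)).curryLeft (stdVec j)).curryLeft w
            fun i => stdVec (σ i)
          map_add' := fun u v => by rw [map_add]; rfl
          map_smul' := fun c v => by rw [map_smul]; rfl }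
      have h2 : ∀ (L : (Fin (q + 2) → ℂ) →ₗ[ℂ] ℂ) (v : Fin (q + 2) → ℂ),
          L v = ∑ j, v j * L (stdVec j) := by
        intro L v
        conv_lhs => rw [← sum_smul_stdVec v]
        simp only [map_sum, map_smul, smul_eq_mul]
      change L1 v = _
      rw [h2 L1 v]
      refine Finset.sum_congr rfl fun j _ => ?_
      change v j * L2 j w = _
      rw [h2 (L2 j) w, Finset.mul_sum]
      exact Finset.sum_congr rfl fun k _ => (mul_assoc _ _ _).symm
    change _ = a * ((volForm (q + 2)).curryLeft _).curryLeft x _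
    rw [h1]
    simp only [map_mul, map_sum, MvPolynomial.eval_C, MvPolynomial.eval_X]
    congr 1
    refine Finset.sum_congr rfl fun j _ => Finset.sum_congr rfl fun k _ => ?_
    ring

end NGK

end

/-! ### Assembly of the normal form. -/

theorem lemmal (n q d : ℕ) (hq : 1 ≤ q) (hn : q + 3 ≤ n) (hd : 2 ≤ d)
    (η : (Fin n → ℂ) → (Fin n → ℂ) [⋀^Fin q]→L[ℂ] ℂ)
    (hη : NGK.IsIntegrable η) (hc : NGK.HasConicNGK η d) :
    ∃ (φ : OpenPartialHomeomorph (Fin n → ℂ) ((Fin (q + 2) → ℂ) × (Fin (n - q - 2) → ℂ)))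
      (A : (Fin q ↪o Fin (q + 2)) → MvPolynomial (Fin (q + 2)) ℂ),
      NGK.IsGermBiholomorphism φ ∧
      -- the coefficients are homogeneous of degree `d + 1`
      (∀ σ, (A σ).IsHomogeneous (d + 1)) ∧
      -- `φ_* η = ∑_σ A_σ(x) dx_σ(1) ∧ ... ∧ dx_σ(q)` as germs at `(0, 0)`
      (∀ᶠ z in 𝓝 (0 : (Fin (q + 2) → ℂ) × (Fin (n - q - 2) → ℂ)),
        NGK.pullback φ.symm η z = NGK.pullback Prod.fst (NGK.polyForm A) z) ∧
      -- `φ_* η` is dicritical: it is annihilated by the radial vector field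
      (∀ x : Fin (q + 2) → ℂ, x ∈ NGK.formKernel (NGK.polyForm A x)) ∧
      -- the form in `x` defines a singular foliation of dimension two on `ℂ^(q+2)`
      NGK.IsIntegrable (NGK.polyForm A) ∧
      NGK.polyForm A 0 = 0 ∧
      (∃ᶠ x in 𝓝 (0 : Fin (q + 2) → ℂ), NGK.polyForm A x ≠ 0) ∧
      (∀ᶠ x in 𝓝 (0 : Fin (q + 2) → ℂ), NGK.polyForm A x ≠ 0 →
        Module.finrank ℂ (NGK.formKernel (NGK.polyForm A x)) = 2) ∧
      -- `φ` maps the foliation of `η` to the product of that foliation with `ℂ^(n-q-2)`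
      (∀ᶠ p in 𝓝 (0 : Fin n → ℂ),
        NGK.formKernel (η p) =
          ((NGK.formKernel (NGK.polyForm A (φ p).1)).prod ⊤).comap
            (fderiv ℂ φ p : (Fin n → ℂ) →ₗ[ℂ] (Fin (q + 2) → ℂ) × (Fin (n - q - 2) → ℂ))) := by
  obtain ⟨φ₀, hφ₀, hNGK⟩ := hc
  obtain ⟨ψ, T, a, P, hψ, hψ0, hψT, hPd, hP, hmodel⟩ := NGK.exists_homogeneous_model hd hNGK
  obtain ⟨A, hA, hAP⟩ := NGK.exists_polyForm_eq a hPd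
  have hφ₀0 : φ₀.symm 0 = 0 := by
    have := φ₀.left_inv hφ₀.1
    rwa [hφ₀.2.1] at this
  have h0 : (0 : (Fin (q + 2) → ℂ) × (Fin (n - q - 2) → ℂ)) ∈ φ₀.target := by
    have := φ₀.map_source hφ₀.1
    rwa [hφ₀.2.1] at this
  have hφ₀a : AnalyticAt ℂ φ₀.symm 0 := hφ₀.2.2.2 0 h0
  obtain ⟨T₀, hT₀⟩ := hφ₀.exists_fderiv_symm
  have hζint : NGK.IsIntegrable
      (NGK.pullback (fun x : Fin (q + 2) → ℂ => φ₀.symm (x, 0)) η) := by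
    obtain ⟨-, -, -, X, Y, hX, -⟩ := hNGK
    exact hX.integrable
  have hpoly : NGK.pullback ψ (NGK.pullback (fun x : Fin (q + 2) → ℂ => φ₀.symm (x, 0)) η)
      =ᶠ[𝓝 0] NGK.polyForm A := hmodel.mono fun x hx => hx.2.trans (hAP x).symm
  have hint : NGK.IsIntegrable (NGK.polyForm A) := (hζint.pullback hψ hψ0).congr hpoly
  -- straighten the transverse coordinates
  let S : (Fin (q + 2) → ℂ) × (Fin (n - q - 2) → ℂ) → (Fin (q + 2) → ℂ) × (Fin (n - q - 2) → ℂ) :=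
    fun z => (ψ z.1, z.2)
  have hS : AnalyticAt ℂ S 0 :=
    (AnalyticAt.comp (g := ψ) (f := Prod.fst) hψ analyticAt_fst).prod analyticAt_snd
  have hS0 : S 0 = 0 := Prod.ext hψ0 rfl
  have hSd : HasFDerivAt S ((T.prodCongr (ContinuousLinearEquiv.refl ℂ (Fin (n - q - 2) → ℂ)) :
      ((Fin (q + 2) → ℂ) × (Fin (n - q - 2) → ℂ)) →L[ℂ] _)) 0 := by
    have h1 : HasFDerivAt ψ (T : (Fin (q + 2) → ℂ) →L[ℂ] _)
        (0 : (Fin (q + 2) → ℂ) × (Fin (n - q - 2) → ℂ)).1 := by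
      rw [← hψT]
      exact hψ.differentiableAt.hasFDerivAt
    exact (h1.comp (0 : (Fin (q + 2) → ℂ) × (Fin (n - q - 2) → ℂ)) hasFDerivAt_fst).prodMk
      hasFDerivAt_snd
  have hΘ₀ : AnalyticAt ℂ (φ₀.symm ∘ S) 0 := AnalyticAt.comp (by rwa [hS0]) hS
  have hΘ₀0 : (φ₀.symm ∘ S) 0 = 0 := by rw [Function.comp_apply, hS0, hφ₀0]
  have hη₁ : NGK.IsIntegrable (NGK.pullback (φ₀.symm ∘ S) η) := hη.pullback hΘ₀ hΘ₀0
  -- Both sides are the pull-back of `η` along `x ↦ φ₀.symm (ψ x, 0)`, factored in two ways; so in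
  -- the new coordinates the restriction to `y = 0` is the homogeneous model.
  have hres : NGK.pullback (fun x : Fin (q + 2) → ℂ => (x, (0 : Fin (n - q - 2) → ℂ)))
      (NGK.pullback (φ₀.symm ∘ S) η) =ᶠ[𝓝 0]
      NGK.pullback ψ (NGK.pullback (fun x : Fin (q + 2) → ℂ => φ₀.symm (x, 0)) η) := by
    have hi : Tendsto (fun x : Fin (q + 2) → ℂ => (x, (0 : Fin (n - q - 2) → ℂ))) (𝓝 0) (𝓝 0) := by
      have : Continuous fun x : Fin (q + 2) → ℂ => (x, (0 : Fin (n - q - 2) → ℂ)) := by fun_prop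
      exact this.tendsto 0
    have hψt : Tendsto ψ (𝓝 0) (𝓝 0) := by
      have := hψ.continuousAt.tendsto
      rwa [hψ0] at this
    have hid : ∀ x : Fin (q + 2) → ℂ,
        DifferentiableAt ℂ (fun x : Fin (q + 2) → ℂ => (x, (0 : Fin (n - q - 2) → ℂ))) x := fun x =>
      differentiableAt_id.prodMk (differentiableAt_const _)
    filter_upwards [hi.eventually hΘ₀.eventually_analyticAt, hψ.eventually_analyticAt,
      hψt.eventually (hi.eventually hφ₀a.eventually_analyticAt)] with x h1 h2 h3
    exact (NGK.pullback_comp (f := φ₀.symm ∘ S)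
      (g := fun x : Fin (q + 2) → ℂ => (x, (0 : Fin (n - q - 2) → ℂ))) h1.differentiableAt (hid x)).symm.trans
      (NGK.pullback_comp (f := fun x : Fin (q + 2) → ℂ => φ₀.symm (x, 0)) (g := ψ)
        (h3.differentiableAt.comp (ψ x) (hid (ψ x))) h2.differentiableAt)
  obtain ⟨F, hF, hF0, ⟨TF, hTF⟩, hFη⟩ := NGK.exists_unfolding hq (by omega) P hPd hP hη₁ (by
    filter_upwards [hres.eventually_nhds, hmodel] with x h1 h2
    rw [← h2.1]
    exact Filter.EventuallyEq.extDeriv_eq h1)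
  have hΘ : AnalyticAt ℂ ((φ₀.symm ∘ S) ∘ F) 0 := AnalyticAt.comp (by rwa [hF0]) hF
  have hΘ0 : ((φ₀.symm ∘ S) ∘ F) 0 = 0 := by rw [Function.comp_apply, hF0, hΘ₀0]
  have hΘd : fderiv ℂ ((φ₀.symm ∘ S) ∘ F) 0 = ((TF.trans (T.prodCongr
      (ContinuousLinearEquiv.refl ℂ (Fin (n - q - 2) → ℂ)))).trans T₀ :
      ((Fin (q + 2) → ℂ) × (Fin (n - q - 2) → ℂ)) →L[ℂ] (Fin n → ℂ)) := by
    have h1 : HasFDerivAt φ₀.symm (T₀ : _ →L[ℂ] (Fin n → ℂ)) (S 0) := by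
      rw [hS0, ← hT₀]
      exact hφ₀a.differentiableAt.hasFDerivAt
    have h2 := h1.comp (0 : (Fin (q + 2) → ℂ) × (Fin (n - q - 2) → ℂ)) hSd
    have h3 : HasFDerivAt F (TF : _ →L[ℂ] (Fin (q + 2) → ℂ) × (Fin (n - q - 2) → ℂ)) 0 := by
      rw [← hTF]
      exact hF.differentiableAt.hasFDerivAt
    rw [← hF0] at h2
    exact (h2.comp (0 : (Fin (q + 2) → ℂ) × (Fin (n - q - 2) → ℂ)) h3).fderiv
  obtain ⟨φ, hφ, hφΘ⟩ := NGK.exists_isGermBiholomorphism hΘ hΘ0 hΘd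
  have hnormal : ∀ᶠ z in 𝓝 (0 : (Fin (q + 2) → ℂ) × (Fin (n - q - 2) → ℂ)),
      NGK.pullback φ.symm η z = NGK.pullback Prod.fst (NGK.polyForm A) z := by
    have hFt : Tendsto F (𝓝 0) (𝓝 0) := by
      have := hF.continuousAt.tendsto
      rwa [hF0] at this
    have hfst : Tendsto (Prod.fst : (Fin (q + 2) → ℂ) × (Fin (n - q - 2) → ℂ) → _) (𝓝 0) (𝓝 0) :=
      continuous_fst.tendsto 0
    filter_upwards [hFη, hfst.eventually (hres.trans hpoly), hF.eventually_analyticAt,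
      hFt.eventually hΘ₀.eventually_analyticAt] with z h1 h2 h3 h4
    rw [hφΘ, NGK.pullback_comp h4.differentiableAt h3.differentiableAt, h1, NGK.pullback, h2,
      NGK.pullback]
  refine ⟨φ, A, hφ, hA, hnormal, fun x => ?_, hint, ?_, ?_, ?_, ?_⟩
  · obtain ⟨r, rfl⟩ : ∃ r, q = r + 1 := ⟨q - 1, by omega⟩
    rw [NGK.mem_formKernel_iff, hAP, ContinuousAlternatingMap.curryLeft_smul]
    have h1 := ((NGK.volForm (r + 1 + 2)).curryLeft
      (fun j => MvPolynomial.eval x (P j))).curryLeft_same x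
    exact (congrArg (fun β => a • β) h1).trans (smul_zero a)
  · rw [hAP, map_zero, smul_zero]
  -- If the form vanished near 0, so would its derivative `i_P ν`, hence `P`; but `P` vanishes only
  -- at the origin.
  · intro h
    have h1 : ∀ᶠ x in 𝓝 (0 : Fin (q + 2) → ℂ), x = 0 := by
      filter_upwards [(hpoly.and h).eventually_nhds, hmodel] with x h2 h3
      have h4 : NGK.pullback ψ (NGK.pullback (fun x : Fin (q + 2) → ℂ => φ₀.symm (x, 0)) η)
          =ᶠ[𝓝 x] fun _ => 0 := h2.mono fun y hy => hy.1.trans (not_not.1 hy.2)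
      have h5 : (NGK.volForm (q + 2)).curryLeft (fun j => MvPolynomial.eval x (P j)) =
          (NGK.volForm (q + 2)).curryLeft 0 := by
        rw [← h3.1, h4.extDeriv_eq, extDeriv, map_zero]
        simp only [fderiv_fun_const, Pi.zero_apply]
        exact map_zero (ContinuousAlternatingMap.alternatizeUncurryFinCLM ℂ _ ℂ)
      exact hP x fun j => congrFun (NGK.curryLeft_volForm_injective h5) j
    obtain ⟨x, hx, hx'⟩ := ((h1.filter_mono nhdsWithin_le_nhds).and
      (self_mem_nhdsWithin (s := {(0 : Fin (q + 2) → ℂ)}ᶜ))).exists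
    exact hx' hx
  · filter_upwards [hint.finrank_formKernel] with x h1 h2
    have h3 := h1 h2
    rw [Module.finrank_fin_fun] at h3
    omega
  · have hφt : Tendsto φ (𝓝 0) (𝓝 0) := by
      have := (hφ.2.2.1 0 hφ.1).continuousAt.tendsto
      rwa [hφ.2.1] at this
    filter_upwards [hφt.eventually hnormal, φ.open_source.mem_nhds hφ.1] with p h1 hp
    obtain ⟨h2, h3⟩ := hφ.fderiv_comp hp
    -- The normal form read backwards: composing with the derivative of `φ` expresses `η` as the
    -- pull-back of the polynomial form by the submersion `x ∘ φ`, and kernels are then preimages.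
    have h4 : η p = (NGK.polyForm A (φ p).1).compContinuousLinearMap
        (ContinuousLinearMap.fst ℂ (Fin (q + 2) → ℂ) (Fin (n - q - 2) → ℂ) ∘L fderiv ℂ φ p) := by
      rw [NGK.pullback, NGK.pullback, φ.left_inv hp, hasFDerivAt_fst.fderiv] at h1
      ext v
      have h5 := congrArg (fun α => α fun i => fderiv ℂ φ p (v i)) h1
      have h6 : ∀ u, fderiv ℂ φ.symm (φ p) (fderiv ℂ φ p u) = u := fun u =>
        DFunLike.congr_fun h2 u
      change η p (fun i => fderiv ℂ φ.symm (φ p) (fderiv ℂ φ p (v i))) = _ at h5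
      simp only [h6] at h5
      exact h5
    have h5 : Function.Surjective
        (ContinuousLinearMap.fst ℂ (Fin (q + 2) → ℂ) (Fin (n - q - 2) → ℂ) ∘L fderiv ℂ φ p) :=
      fun x => ⟨fderiv ℂ φ.symm (φ p) (x, 0), by
        have := DFunLike.congr_fun h3 (x, 0)
        exact congrArg Prod.fst this⟩
    rw [h4, NGK.formKernel_comp_of_surjective h5]
    ext v
    simp [Submodule.mem_comap, Submodule.mem_prod]
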